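/- All circles lie in the Euclidean plane and have positive radius. For a finite set $S$ of circles, let $P$ be the set of points that lie on at least two circles of $S$. The *arcs* of $S$ are the connected components of the sets $C\setminus P$, $C\in S$, and the *faces* of $S$ are the connected components of the complement of $\bigcup S$ in the plane (including the unbounded one). The set $S$ is a *realization as a system of circles* of a simple graph $G$ if there are a bijection from $V(G)$ onto $P$ and a bijection from $E(G)$ onto the set of all arcs of $S$ such that an edge $uv$ is mapped to an arc whose end points are exactly the two points assigned to $u$ and $v$. The *oriented dual* of a realization is the directed graph whose vertices are the faces, with an edge from the face $f$ to the face $f'\neq f$ whenever some arc $e$ lies on the boundary of both $f$ and $f'$ and no open straight-line segment with end points on $e$ lies entirely in $f'$ (equivalently, $f$ lies in the interior and $f'$ in the exterior of the circle that contains $e$). Two realizations are *equivalent* if their oriented duals are isomorphic as directed graphs. Two circles *cross* if they have exactly two common points and *touch* if they have exactly one. **Lemma.** The octahedron graph $K_{2,2,2}$ has, up to equivalence, exactly three realizations as a system of circles. More precisely, every realization consists of 1. three mutually crossing circles, or 2. four mutually touching circles with pairwise disjoint interiors, or 3. four mutually touching circles, one of which contains the other three in its interior (touching it from inside), these three having pairwise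 disjoint interiors; each of the three configurations occurs as a realization of the octahedron graph; and two realizations are equivalent if and only if they show the same one of these three configurations. -/

import Mathlib

/-- The Euclidean plane. -/
abbrev Plane : Type := EuclideanSpace ℝ (Fin 2)

/-- A finite set of (non-degenerate) circles in the plane. -/
structure CircleSystem where
  circles : Finset (EuclideanGeometry.Sphere Plane)
  radius_pos : ∀ C ∈ circles, 0 < C.radius

namespace CircleSystem

/-- The intersection and touching points: points lying on two distinct circles. -/
def vertices (S : CircleSystem) : Set Plane :=
  {p | ∃ C ∈ S.circles, ∃ D ∈ S.circles, C ≠ D ∧ p ∈ C ∧ p ∈ D}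

/-- The (relatively open) arcs into which the vertices cut the circles. A circle without a vertex
contributes itself as an arc without end points. -/
def arcs (S : CircleSystem) : Set (Set Plane) :=
  {e | ∃ C ∈ S.circles, ∃ x ∈ (C : Set Plane) \ S.vertices,
    e = connectedComponentIn ((C : Set Plane) \ S.vertices) x}

/-- The set of all points of the drawing. -/
def carrier (S : CircleSystem) : Set Plane :=
  {p | ∃ C ∈ S.circles, p ∈ C}

/-- The faces (the unbounded one included): connected components of the complement of the
drawing. -/
def faces (S : CircleSystem) : Set (Set Plane) :=
  {f | ∃ x ∈ S.carrierᶜ, f = connectedComponentIn S.carrierᶜ x}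

/-- `S` is a drawing of the simple graph `G`: the vertices of `G` correspond bijectively to the
intersection and touching points, and the edges of `G` correspond bijectively to all the arcs, an
edge `uv` being drawn as an arc whose set of end points is `{u, v}`. -/
def Realizes {V : Type*} (S : CircleSystem) (G : SimpleGraph V) : Prop :=
  ∃ (φ : V ≃ S.vertices) (ψ : G.edgeSet ≃ S.arcs), ∀ e : G.edgeSet,
    closure (ψ e : Set Plane) \ (ψ e : Set Plane) =
      (fun v => (φ v : Plane)) '' {v | v ∈ (e : Sym2 V)}

/-- The oriented dual: its vertices are the faces, and for every arc `e` incident to two faces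
`f` and `f'` there is an edge oriented from `f` to `f'` if no straight-line segment with end points
on `e` lies (up to these end points) in `f'`. -/
def orientedDual (S : CircleSystem) : Digraph S.faces where
  Adj f f' := f ≠ f' ∧ ∃ e ∈ S.arcs, e ⊆ frontier (f : Set Plane) ∧ e ⊆ frontier (f' : Set Plane) ∧
    ∀ a ∈ e, ∀ b ∈ e, ¬ openSegment ℝ a b ⊆ (f' : Set Plane)

/-- The circles `C` and `D` cross: they have exactly two common points. -/
def Cross (C D : EuclideanGeometry.Sphere Plane) : Prop :=
  ((C : Set Plane) ∩ (D : Set Plane)).ncard = 2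

/-- The circles `C` and `D` touch: they have exactly one common point. -/
def Touch (C D : EuclideanGeometry.Sphere Plane) : Prop :=
  ((C : Set Plane) ∩ (D : Set Plane)).ncard = 1

/-- The interior of a circle: the open disc that it bounds. -/
def inside (C : EuclideanGeometry.Sphere Plane) : Set Plane :=
  Metric.ball C.center C.radius

/-- Three mutually crossing circles. -/
def IsThreeCrossing (S : CircleSystem) : Prop :=
  S.circles.card = 3 ∧ ∀ C ∈ S.circles, ∀ D ∈ S.circles, C ≠ D → Cross C D

/-- Four mutually touching circles with disjoint interiors. -/
def IsFourTouchingDisjoint (S : CircleSystem) : Prop :=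
  S.circles.card = 4 ∧ ∀ C ∈ S.circles, ∀ D ∈ S.circles, C ≠ D →
    Touch C D ∧ Disjoint (inside C) (inside D)

/-- Four mutually touching circles, one of which contains the other three in its interior, these
three having disjoint interiors. -/
def IsThreeTouchingInOne (S : CircleSystem) : Prop :=
  S.circles.card = 4 ∧ (∀ C ∈ S.circles, ∀ D ∈ S.circles, C ≠ D → Touch C D) ∧
    ∃ O ∈ S.circles, (∀ C ∈ S.circles, C ≠ O → inside C ⊆ inside O) ∧
      ∀ C ∈ S.circles, ∀ D ∈ S.circles, C ≠ O → D ≠ O → C ≠ D → Disjoint (inside C) (inside D)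

end CircleSystem

/-- The realizations of `G` as a system of circles. -/
def CircleRealization {V : Type*} (G : SimpleGraph V) : Type :=
  {S : CircleSystem // S.Realizes G}

namespace CircleRealization

/-- Two realizations are equivalent if their oriented duals are isomorphic digraphs. -/
def Equivalent {V : Type*} {G : SimpleGraph V} (R R' : CircleRealization G) : Prop :=
  Nonempty (R.1.orientedDual.Adj ≃r R'.1.orientedDual.Adj)

/-- Equivalence of realizations, as a setoid. -/
def setoid {V : Type*} (G : SimpleGraph V) : Setoid (CircleRealization G) where
  r := Equivalent
  iseqv :=
    { refl := fun _ => ⟨RelIso.refl _⟩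
      symm := fun ⟨h⟩ => ⟨h.symm⟩
      trans := fun ⟨h⟩ ⟨h'⟩ => ⟨h.trans h'⟩ }

end CircleRealization

/-- The octahedron graph, the complete tripartite graph with three parts of size two. -/
abbrev octahedronGraph : SimpleGraph (Fin 3 × Fin 2) :=
  SimpleGraph.completeEquipartiteGraph 3 2

/-! Counting determines the circles. A circle of a realization carries at least three vertices: with
at most one vertex it would have an arc without two distinct ends, and with two it would have two
arcs with the same ends, while the graph is simple. Every vertex lies on exactly two circles,
because three circles would send six arcs into a vertex of degree four. Hence the circles have
twelve incidences with the six vertices, and since two circles share at most two points there are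
three or four of them (`three_crossing_or_four_touching`). Three circles carry four vertices each,
so all pairs cross. Four circles carry three each, and two of them with two common points would both
have a free arc between these points, a double edge; so all pairs touch. If one circle touches
another from inside, all the rest touch that one from inside too, since otherwise three circles
would concur (`dist_centers_of_touch`).

The faces are computed in a model. The plane with a point at infinity is the set of rays of
three-space, and the octahedron has its vertices on the coordinate axes. Two subdivisions into
cones, or fans, are needed: `crossingFan`, cut out by the coordinate planes, and `tangentFan`, cut
out by the cones over the circumcircles of four alternate faces of the octahedron.

Three crossing circles without a double edge have a radical center inside all of them, and the three
powers, used as coordinates, turn the circles into the coordinate planes. For four touching circles,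
the surrounding one being given a negative radius, tangency reads `‖c i - c j‖ ^ 2 = (R i + R j) ^
2`. The four powers divided by the signed radii then satisfy the quadratic equation of Descartes'
circle theorem. In suitable coordinates this is the equation of a light cone over three-space, and
the circles become the cones of `tangentFan`.

A system described by a fan realizes the octahedron graph (`Fan.Represents.realizes`), which yields
the examples. Its oriented dual depends only on the fan and on the side of each circle that is its
interior (`Fan.Represents.nonempty_orientedDual_iso`). So there are at most three oriented duals,
and their numbers of sinks, 1, 4 and 2, tell them apart. -/

open Set Filter Topology
open scoped RealInnerProductSpace Matrix

/-- Euclidean three-space, whose rays serve as a model of the plane with a point at infinity. -/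
abbrev Space : Type := EuclideanSpace ℝ (Fin 3)

/-! ### Connected components, and the exterior of a disc -/

/-- If two open sets partition `U` and the part in the first is preconnected, then that part is a
connected component of `U`. -/
theorem connectedComponentIn_eq_inter_of_partition {X : Type*} [TopologicalSpace X]
    {U O O' : Set X} (hO : IsOpen O) (hO' : IsOpen O') (hU : U ⊆ O ∪ O')
    (hd : U ∩ (O ∩ O') = ∅) (hc : IsPreconnected (U ∩ O)) {x : X} (hx : x ∈ U ∩ O) :
    connectedComponentIn U x = U ∩ O := by
  refine Subset.antisymm (subset_inter (connectedComponentIn_subset U x) ?_)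
    (hc.subset_connectedComponentIn hx inter_subset_left)
  have hK : IsPreconnected (connectedComponentIn U x) := isPreconnected_connectedComponentIn
  have hKU := connectedComponentIn_subset U x
  rcases isPreconnected_iff_subset_of_disjoint.1 hK O O' hO hO' (hKU.trans hU)
    (subset_eq_empty (inter_subset_inter_left _ hKU) hd) with h | h
  · exact h
  · exfalso
    have : x ∈ U ∩ (O ∩ O') := ⟨hx.1, hx.2, h (mem_connectedComponentIn hx.1)⟩
    rw [hd] at this
    exact this

/-- The connected components of a set partitioned into preconnected relatively open pieces are
these pieces. -/
theorem connectedComponentIn_eq_of_open_family {X : Type*} [TopologicalSpace X] {κ : Type*}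
    {U : Set X} {O : κ → Set X} (hO : ∀ k, IsOpen (O k)) (hU : ∀ x ∈ U, ∃ k, x ∈ O k)
    (hd : ∀ x ∈ U, ∀ k l, x ∈ O k → x ∈ O l → k = l) (hc : ∀ k, IsPreconnected (U ∩ O k))
    {k : κ} {x : X} (hx : x ∈ U ∩ O k) : connectedComponentIn U x = U ∩ O k := by
  refine connectedComponentIn_eq_inter_of_partition (O' := ⋃ l ∈ {l | l ≠ k}, O l) (hO k)
    (isOpen_biUnion fun l _ => hO l) ?_ ?_ (hc k) hx
  · intro y hy
    obtain ⟨l, hl⟩ := hU y hy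
    by_cases h : l = k
    · exact Or.inl (h ▸ hl)
    · exact Or.inr (mem_biUnion (x := l) h hl)
  · rw [eq_empty_iff_forall_notMem]
    rintro y ⟨hy, hyk, hyl⟩
    simp only [mem_ofPred_eq, mem_iUnion, exists_prop] at hyl
    obtain ⟨l, hlk, hl⟩ := hyl
    exact hlk (hd y hy l k hl hyk)

theorem one_lt_rank_plane : 1 < Module.rank ℝ Plane := by
  rw [← Module.finrank_eq_rank, finrank_euclideanSpace_fin]
  norm_num

/-- The exterior of a disc is connected. -/
theorem isPreconnected_setOf_lt_norm {ρ : ℝ} (hρ : 0 ≤ ρ) :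
    IsPreconnected {x : Plane | ρ < ‖x‖} := by
  have h0 : IsPreconnected ({0}ᶜ : Set Plane) :=
    (isConnected_compl_singleton_of_one_lt_rank one_lt_rank_plane 0).isPreconnected
  -- The punctured plane is pushed outwards along rays; this map adds `ρ` to the norm.
  have h1 := h0.image (fun x : Plane => (ρ / ‖x‖ + 1) • x) (by
    refine ContinuousOn.smul (ContinuousOn.add (ContinuousOn.div continuousOn_const
      continuous_norm.continuousOn ?_) continuousOn_const) continuousOn_id
    intro x hx
    simpa using hx)
  convert h1 using 1
  ext y
  simp only [mem_ofPred_eq, mem_image, mem_compl_iff, mem_singleton_iff]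
  constructor
  · intro hy
    have hy0 : 0 < ‖y‖ := hρ.trans_lt hy
    have hk : 0 < 1 - ρ / ‖y‖ := by rw [sub_pos, div_lt_one hy0]; exact hy
    refine ⟨(1 - ρ / ‖y‖) • y, smul_ne_zero hk.ne' (norm_pos_iff.1 hy0), ?_⟩
    have hn : ‖(1 - ρ / ‖y‖) • y‖ = ‖y‖ - ρ := by
      rw [norm_smul, Real.norm_of_nonneg hk.le]; field_simp
    have : ‖y‖ - ρ ≠ 0 := (sub_pos.2 hy).ne'
    rw [hn, smul_smul]
    have : (ρ / (‖y‖ - ρ) + 1) * (1 - ρ / ‖y‖) = 1 := by field_simp; ring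
    rw [this, one_smul]
  · rintro ⟨x, hx, rfl⟩
    have hx0 : 0 < ‖x‖ := norm_pos_iff.2 hx
    rw [norm_smul, Real.norm_of_nonneg (by positivity)]
    have : (ρ / ‖x‖ + 1) * ‖x‖ = ρ + ‖x‖ := by field_simp
    rw [this]; linarith

/-! ### The plane as the space of rays without the point at infinity -/

/-- A description of the plane as the set of rays of three-space from the origin, with the ray
through `pole` removed. -/
structure SphereChart where
  toFun : Plane → Space
  inv : Space → Plane
  pole : Space
  pole_ne : pole ≠ 0
  cont : Continuous toFun
  cont_inv : ContinuousOn inv {w | ¬ SameRay ℝ w pole}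
  not_sameRay : ∀ x, ¬ SameRay ℝ (toFun x) pole
  inv_toFun : ∀ x, inv (toFun x) = x
  inv_smul : ∀ w, ∀ s : ℝ, 0 < s → inv (s • w) = inv w
  toFun_inv : ∀ w, ¬ SameRay ℝ w pole → ∃ s : ℝ, 0 < s ∧ toFun (inv w) = s • w

namespace SphereChart

variable (χ : SphereChart)

theorem toFun_ne (x : Plane) : χ.toFun x ≠ 0 := fun h =>
  χ.not_sameRay x (by rw [h]; exact SameRay.zero_left _)

theorem isOpen_not_sameRay : IsOpen {w | ¬ SameRay ℝ w χ.pole} := by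
  have : {w | SameRay ℝ w χ.pole} = {w | ‖w‖ • χ.pole = ‖χ.pole‖ • w} := by
    ext w
    exact sameRay_iff_norm_smul_eq
  rw [← isClosed_compl_iff]
  have h2 : {w | ¬ SameRay ℝ w χ.pole}ᶜ = {w | SameRay ℝ w χ.pole} := by ext; simp
  rw [h2, this]
  exact isClosed_eq (by fun_prop) (by fun_prop)

theorem sameRay_smul_iff {w : Space} {s : ℝ} (hs : 0 < s) :
    SameRay ℝ (s • w) χ.pole ↔ SameRay ℝ w χ.pole := by
  constructor
  · intro h
    have := h.pos_smul_left (inv_pos.2 hs)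
    rwa [smul_smul, inv_mul_cancel₀ hs.ne', one_smul] at this
  · intro h
    exact h.pos_smul_left hs

/-- A set of rays that avoids the pole is mapped onto its part of the plane. -/
theorem image_inv_eq_preimage {R : Set Space} (hR : ∀ w ∈ R, ∀ s : ℝ, 0 < s → s • w ∈ R)
    (hU : ∀ w ∈ R, ¬ SameRay ℝ w χ.pole) : χ.inv '' R = χ.toFun ⁻¹' R := by
  ext x
  constructor
  · rintro ⟨w, hw, rfl⟩
    obtain ⟨s, hs, h⟩ := χ.toFun_inv w (hU w hw)
    rw [mem_preimage, h]
    exact hR w hw s hs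
  · intro hx
    exact ⟨χ.toFun x, hx, χ.inv_toFun x⟩

theorem mem_of_sameRay {R : Set Space} (hR : ∀ w ∈ R, ∀ s : ℝ, 0 < s → s • w ∈ R)
    (h0 : (0 : Space) ∉ R) {w : Space} (hw : w ∈ R) (h : SameRay ℝ w χ.pole) : χ.pole ∈ R := by
  obtain ⟨r, hr, h⟩ := h.exists_pos_left (fun h => h0 (h ▸ hw)) χ.pole_ne
  rw [← h]
  exact hR w hw r hr

/-- The unit vectors outside an open cone around the pole form a compact set on which `inv` is
continuous, so they come from a bounded part of the plane. -/
theorem exists_norm_bound {R : Set Space} (hR : ∀ w ∈ R, ∀ s : ℝ, 0 < s → s • w ∈ R)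
    (hRo : IsOpen R) (hp : χ.pole ∈ R) : ∃ ρ : ℝ, 0 ≤ ρ ∧ ∀ x, ρ < ‖x‖ → χ.toFun x ∈ R := by
  have hK : IsCompact (Metric.sphere (0 : Space) 1 ∩ Rᶜ) :=
    (isCompact_sphere _ _).inter_right hRo.isClosed_compl
  have hKU : Metric.sphere (0 : Space) 1 ∩ Rᶜ ⊆ {w | ¬ SameRay ℝ w χ.pole} := by
    rintro w ⟨hw, hwR⟩ h
    have hw0 : w ≠ 0 := by rintro rfl; simp at hw
    obtain ⟨r, hr, h⟩ := h.exists_pos_right hw0 χ.pole_ne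
    exact hwR (h ▸ hR _ hp r hr)
  obtain ⟨ρ, hρ⟩ := (hK.image_of_continuousOn (χ.cont_inv.mono hKU)).isBounded.exists_norm_le
  refine ⟨max ρ 0, le_max_right _ _, fun x hx => ?_⟩
  by_contra h
  have hx0 : 0 < ‖χ.toFun x‖ := norm_pos_iff.2 (χ.toFun_ne x)
  have hmem : ‖χ.toFun x‖⁻¹ • χ.toFun x ∈ Metric.sphere (0 : Space) 1 ∩ Rᶜ := by
    refine ⟨by simp [norm_smul, hx0.ne'], fun h' => h ?_⟩
    have := hR _ h' _ hx0
    rwa [smul_smul, mul_inv_cancel₀ hx0.ne', one_smul] at this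
  have := hρ _ (mem_image_of_mem _ hmem)
  rw [χ.inv_smul _ _ (inv_pos.2 hx0), χ.inv_toFun] at this
  exact absurd (hx.trans_le this) (not_lt.2 (le_max_left _ _))

/-- The directions of the points of a closed disc form a compact set that misses the direction of
the pole, so rays near the pole belong to points far away. -/
theorem eventually_lt_norm_inv {w : Space} (hw0 : w ≠ 0) (hw : SameRay ℝ w χ.pole) (ρ : ℝ) :
    ∀ᶠ z in 𝓝 w, ¬ SameRay ℝ z χ.pole → ρ < ‖χ.inv z‖ := by
  have hN : Continuous fun x => ‖χ.toFun x‖⁻¹ • χ.toFun x :=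
    (χ.cont.norm.inv₀ fun x => norm_ne_zero_iff.2 (χ.toFun_ne x)).smul χ.cont
  have hK := ((isCompact_closedBall (0 : Plane) ρ).image hN).isClosed
  have hwK : ‖w‖⁻¹ • w ∉ (fun x => ‖χ.toFun x‖⁻¹ • χ.toFun x) '' Metric.closedBall 0 ρ := by
    rintro ⟨x, -, hx⟩
    have h1 : SameRay ℝ (‖w‖⁻¹ • w) χ.pole :=
      (χ.sameRay_smul_iff (inv_pos.2 (norm_pos_iff.2 hw0))).2 hw
    rw [← hx] at h1
    exact χ.not_sameRay x ((χ.sameRay_smul_iff (inv_pos.2 (norm_pos_iff.2 (χ.toFun_ne x)))).1 h1)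
  have hcw : ContinuousAt (fun z : Space => ‖z‖⁻¹ • z) w :=
    (continuousAt_id.norm.inv₀ (norm_ne_zero_iff.2 hw0)).smul continuousAt_id
  filter_upwards [hcw.preimage_mem_nhds (hK.isOpen_compl.mem_nhds hwK),
    isOpen_ne.mem_nhds hw0] with z hz hz0 hzU
  by_contra! hle
  refine hz ⟨χ.inv z, by simpa using hle, ?_⟩
  obtain ⟨s, hs, h⟩ := χ.toFun_inv z hzU
  simp only [h, norm_smul, Real.norm_of_nonneg hs.le, smul_smul]
  congr 1
  have : ‖z‖ ≠ 0 := norm_ne_zero_iff.2 hz0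
  field_simp

/-- The part of the plane given by a preconnected cone is preconnected; if the cone contains the
pole, it has to be open. -/
theorem isPreconnected_preimage {R : Set Space} (hR : ∀ w ∈ R, ∀ s : ℝ, 0 < s → s • w ∈ R)
    (h0 : (0 : Space) ∉ R) (hRc : IsPreconnected R) (hRo : χ.pole ∈ R → IsOpen R) :
    IsPreconnected (χ.toFun ⁻¹' R) := by
  by_cases hp : χ.pole ∈ R
  · obtain ⟨ρ, hρ0, hρ⟩ := χ.exists_norm_bound hR (hRo hp) hp
    -- A continuous two-valued function on the preimage is constant far out, since the exterior of a
    -- disc is connected. It therefore transfers to the cone `R`, taking that constant value on the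
    -- ray of the pole.
    refine isPreconnected_of_forall_constant fun f hf => ?_
    obtain ⟨x₀, hx₀⟩ : ∃ x₀ : Plane, ρ < ‖x₀‖ := NormedSpace.exists_lt_norm ℝ Plane ρ
    have hext : ∀ x, ρ < ‖x‖ → f x = f x₀ := fun x hx =>
      (isPreconnected_setOf_lt_norm hρ0).constant (hf.mono fun y hy => hρ y hy) hx hx₀
    classical
    let g : Space → Bool := fun w => if SameRay ℝ w χ.pole then f x₀ else f (χ.inv w)
    have hg : ContinuousOn g R := by
      intro w hw
      refine ContinuousAt.continuousWithinAt ?_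
      by_cases hwp : SameRay ℝ w χ.pole
      · have : g =ᶠ[𝓝 w] fun _ => f x₀ := by
          filter_upwards [χ.eventually_lt_norm_inv (fun h => h0 (h ▸ hw)) hwp ρ] with z hz
          by_cases hzp : SameRay ℝ z χ.pole
          · simp [g, hzp]
          · simp only [g, hzp, if_false]
            exact hext _ (hz hzp)
        exact continuousAt_const.congr this.symm
      · have : g =ᶠ[𝓝 w] f ∘ χ.inv := by
          filter_upwards [χ.isOpen_not_sameRay.mem_nhds hwp] with z hz
          replace hz : ¬ SameRay ℝ z χ.pole := hz
          simp [g, hz]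
        refine ContinuousAt.congr ?_ this.symm
        refine ContinuousAt.comp ?_ (χ.cont_inv.continuousAt (χ.isOpen_not_sameRay.mem_nhds hwp))
        obtain ⟨s, hs, h⟩ := χ.toFun_inv w hwp
        exact hf.continuousAt (((hRo hp).preimage χ.cont).mem_nhds
          (by rw [mem_preimage, h]; exact hR w hw s hs))
    intro x hx y hy
    have := hRc.constant hg hx hy
    simpa [g, χ.not_sameRay, χ.inv_toFun] using this
  · have hU : ∀ w ∈ R, ¬ SameRay ℝ w χ.pole := fun w hw h => hp (χ.mem_of_sameRay hR h0 hw h)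
    rw [← χ.image_inv_eq_preimage hR hU]
    exact hRc.image _ (χ.cont_inv.mono hU)

theorem nonempty_preimage {R : Set Space} (hR : ∀ w ∈ R, ∀ s : ℝ, 0 < s → s • w ∈ R)
    (h0 : (0 : Space) ∉ R) (hne : R.Nonempty) (hRo : χ.pole ∈ R → IsOpen R) :
    (χ.toFun ⁻¹' R).Nonempty := by
  by_cases hp : χ.pole ∈ R
  · obtain ⟨ρ, -, hρ⟩ := χ.exists_norm_bound hR (hRo hp) hp
    obtain ⟨x₀, hx₀⟩ : ∃ x₀ : Plane, ρ < ‖x₀‖ := NormedSpace.exists_lt_norm ℝ Plane ρ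
    exact ⟨x₀, hρ x₀ hx₀⟩
  · rw [← χ.image_inv_eq_preimage hR fun w hw h => hp (χ.mem_of_sameRay hR h0 hw h)]
    exact hne.image _

end SphereChart

/-! ### Vertices and edges of the octahedron in three-space -/

/-- The two signs `1` and `-1`. -/
def sg (s : Fin 2) : ℝ := if s = 0 then 1 else -1

theorem sg_mul_self (s : Fin 2) : sg s * sg s = 1 := by
  fin_cases s <;> simp [sg]

theorem sg_ne_zero (s : Fin 2) : sg s ≠ 0 := by
  fin_cases s <;> simp [sg]

/-- The six unit vectors on the coordinate axes, corresponding to the vertices of the octahedron. -/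
noncomputable def axis (v : Fin 3 × Fin 2) : Space := EuclideanSpace.single v.1 (sg v.2)

/-- Names for the edges of the octahedron: `(j, s, t)` is the edge from `(j + 1, s)` to
`(j + 2, t)`. -/
abbrev EdgeIndex : Type := Fin 3 × Fin 2 × Fin 2

/-- The part of three-space where the coordinates belonging to the ends of an edge have the
correct signs. -/
def quadrant (e : EdgeIndex) : Set Space :=
  {w | 0 < sg e.2.1 * w (e.1 + 1) ∧ 0 < sg e.2.2 * w (e.1 + 2)}

theorem isOpen_quadrant (e : EdgeIndex) : IsOpen (quadrant e) := by
  simp only [quadrant, Set.ofPred_and]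
  exact IsOpen.inter (isOpen_lt (by fun_prop) (by fun_prop)) (isOpen_lt (by fun_prop) (by fun_prop))

theorem smul_mem_quadrant {e : EdgeIndex} {w : Space} (hw : w ∈ quadrant e) {s : ℝ} (hs : 0 < s) :
    s • w ∈ quadrant e := by
  refine ⟨?_, ?_⟩
  · have := mul_pos hs hw.1
    simp only [PiLp.smul_apply, smul_eq_mul]
    linarith
  · have := mul_pos hs hw.2
    simp only [PiLp.smul_apply, smul_eq_mul]
    linarith

theorem space_ext (j : Fin 3) {w z : Space} (h0 : w j = z j) (h1 : w (j + 1) = z (j + 1))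
    (h2 : w (j + 2) = z (j + 2)) : w = z := by
  ext k
  have : ∀ j k : Fin 3, k = j ∨ k = j + 1 ∨ k = j + 2 := by decide
  rcases this j k with rfl | rfl | rfl <;> assumption

/-- The point of the quadrant of `e` with prescribed coordinates on a curve bent by `c`. -/
noncomputable def edgePoint (c : ℝ) (e : EdgeIndex) (a b : ℝ) : Space :=
  a • axis (e.1 + 1, e.2.1) + b • axis (e.1 + 2, e.2.2) +
    EuclideanSpace.single e.1 (c * (a * b / (a + b)))

theorem edgePoint_apply_zero (c : ℝ) (e : EdgeIndex) (a b : ℝ) :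
    edgePoint c e a b e.1 = c * (a * b / (a + b)) := by
  obtain ⟨j, s, t⟩ := e
  fin_cases j <;> simp [edgePoint, axis]

theorem edgePoint_apply_one (c : ℝ) (e : EdgeIndex) (a b : ℝ) :
    edgePoint c e a b (e.1 + 1) = a * sg e.2.1 := by
  obtain ⟨j, s, t⟩ := e
  fin_cases j <;> simp [edgePoint, axis]

theorem edgePoint_apply_two (c : ℝ) (e : EdgeIndex) (a b : ℝ) :
    edgePoint c e a b (e.1 + 2) = b * sg e.2.2 := by
  obtain ⟨j, s, t⟩ := e
  fin_cases j <;> simp [edgePoint, axis]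

theorem edgePoint_mem_quadrant (c : ℝ) (e : EdgeIndex) {a b : ℝ} (ha : 0 < a) (hb : 0 < b) :
    edgePoint c e a b ∈ quadrant e := by
  refine ⟨?_, ?_⟩
  · rw [edgePoint_apply_one, mul_comm, mul_assoc, sg_mul_self]; simpa
  · rw [edgePoint_apply_two, mul_comm, mul_assoc, sg_mul_self]; simpa

theorem continuousAt_edgePoint (c : ℝ) (e : EdgeIndex) {p : ℝ × ℝ} (hp : p.1 + p.2 ≠ 0) :
    ContinuousAt (fun p : ℝ × ℝ => edgePoint c e p.1 p.2) p := by
  have hc : ContinuousAt (fun p : ℝ × ℝ => c * (p.1 * p.2 / (p.1 + p.2))) p :=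
    continuousAt_const.mul ((by fun_prop : ContinuousAt (fun p : ℝ × ℝ => p.1 * p.2) p).div
      (by fun_prop) hp)
  have h1 : ∀ y : ℝ, (EuclideanSpace.single e.1 y : Space) =
      y • (EuclideanSpace.single e.1 (1 : ℝ) : Space) := by
    intro y; ext k; simp
  simp only [edgePoint]
  simp only [h1 (_ * _)]
  fun_prop

theorem axis_apply_same (j : Fin 3) (s : Fin 2) : axis (j, s) j = sg s := by
  simp [axis]

theorem axis_apply_of_ne {j k : Fin 3} (s : Fin 2) (h : k ≠ j) : axis (j, s) k = 0 := by
  simp [axis, h]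

theorem axis_ne_zero (v : Fin 3 × Fin 2) : axis v ≠ 0 := by
  intro h
  have := axis_apply_same v.1 v.2
  rw [h] at this
  exact sg_ne_zero _ this.symm

theorem edgePoint_right_zero (c : ℝ) (e : EdgeIndex) (a : ℝ) :
    edgePoint c e a 0 = a • axis (e.1 + 1, e.2.1) := by
  simp [edgePoint]

theorem edgePoint_left_zero (c : ℝ) (e : EdgeIndex) (b : ℝ) :
    edgePoint c e 0 b = b • axis (e.1 + 2, e.2.2) := by
  simp [edgePoint]

/-- A point with two nonvanishing coordinates is on no coordinate axis. -/
theorem ne_smul_axis_of_mem_quadrant {e : EdgeIndex} {w : Space} (hw : w ∈ quadrant e)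
    (v : Fin 3 × Fin 2) (s : ℝ) : w ≠ s • axis v := by
  rintro rfl
  obtain ⟨h1, h2⟩ := hw
  obtain ⟨k, u⟩ := v
  have hne : ∀ j k : Fin 3, j + 1 ≠ k ∨ j + 2 ≠ k := by decide
  rcases hne e.1 k with h | h
  · simp [axis_apply_of_ne u h] at h1
  · simp [axis_apply_of_ne u h] at h2

theorem axis_sameRay_injective {v v' : Fin 3 × Fin 2} {s : ℝ} (hs : 0 < s)
    (h : axis v = s • axis v') : v = v' := by
  obtain ⟨j, a⟩ := v
  obtain ⟨k, b⟩ := v'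
  have hj : j = k := by
    by_contra hne
    have := congrArg (fun w : Space => w j) h
    simp only [axis_apply_same, PiLp.smul_apply, axis_apply_of_ne b hne, smul_zero] at this
    exact sg_ne_zero _ this
  subst hj
  have := congrArg (fun w : Space => w j) h
  simp only [axis_apply_same, PiLp.smul_apply, smul_eq_mul] at this
  fin_cases a <;> fin_cases b <;> simp [sg] at this ⊢ <;> linarith

/-! ### Fans, and the vertices, arcs and faces of the systems they describe -/

/-- A subdivision of three-space into cones that has the combinatorial type of the octahedron:
the edges and vertices arise from the zero sets of the functions `h i`, which will correspond to
the circles of a system. -/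
structure Fan (ι F : Type) where
  h : ι → Space → ℝ
  cont_h : ∀ i, Continuous (h i)
  smul_h : ∀ i w, ∀ s : ℝ, 0 < s → h i (s • w) = s * h i w
  cell : F → Set Space
  isOpen_cell : ∀ f, IsOpen (cell f)
  smul_cell : ∀ f, ∀ w ∈ cell f, ∀ s : ℝ, 0 < s → s • w ∈ cell f
  zero_notMem_cell : ∀ f, (0 : Space) ∉ cell f
  isPreconnected_cell : ∀ f, IsPreconnected (cell f)
  nonempty_cell : ∀ f, (cell f).Nonempty
  cell_unique : ∀ w f f', w ∈ cell f → w ∈ cell f' → f = f'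
  exists_cell_iff : ∀ w, w ≠ 0 → ((∃ f, w ∈ cell f) ↔ ∀ i, h i w ≠ 0)
  circ : EdgeIndex → ι
  -- Inside a quadrant the cone of an edge is a graph over the two coordinates of its ends. One
  -- formula covers both fans: a bend of `0` gives a coordinate plane, a bend of `±1` a circular
  -- cone through both axes.
  bend : EdgeIndex → ℝ
  abs_bend_le : ∀ e, |bend e| ≤ 1
  h_eq_zero_iff : ∀ e, ∀ a b : ℝ, 0 < a → 0 < b → ∀ w : Space, w (e.1 + 1) = a * sg e.2.1 →
    w (e.1 + 2) = b * sg e.2.2 → (h (circ e) w = 0 ↔ w e.1 = bend e * (a * b / (a + b)))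
  exists_edge : ∀ w i, w ≠ 0 → h i w = 0 → (∀ i', i' ≠ i → h i' w ≠ 0) →
    ∃ e, circ e = i ∧ w ∈ quadrant e
  edge_unique : ∀ w e e', circ e = circ e' → h (circ e) w = 0 → w ∈ quadrant e →
    w ∈ quadrant e' → e = e'
  vertex_iff : ∀ w, w ≠ 0 → ((∃ i i', i ≠ i' ∧ h i w = 0 ∧ h i' w = 0) ↔
    ∃ v, ∃ s : ℝ, 0 < s ∧ w = s • axis v)
  pos : EdgeIndex → F
  neg : EdgeIndex → F
  h_pos : ∀ e, ∀ w ∈ cell (pos e), 0 < h (circ e) w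
  h_neg : ∀ e, ∀ w ∈ cell (neg e), h (circ e) w < 0
  sides : ∀ e w, h (circ e) w = 0 → w ∈ quadrant e → ∀ᶠ z in 𝓝 w,
    (0 < h (circ e) z → z ∈ cell (pos e)) ∧ (h (circ e) z < 0 → z ∈ cell (neg e))

namespace Fan

variable {ι F : Type} (K : Fan ι F)

/-- The two-dimensional cone that corresponds to an edge. -/
def edge (e : EdgeIndex) : Set Space := {w | K.h (K.circ e) w = 0 ∧ w ∈ quadrant e}

theorem smul_edge {e : EdgeIndex} {w : Space} (hw : w ∈ K.edge e) {s : ℝ} (hs : 0 < s) :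
    s • w ∈ K.edge e :=
  ⟨by rw [K.smul_h _ _ _ hs, hw.1, mul_zero], smul_mem_quadrant hw.2 hs⟩

theorem edgePoint_mem (e : EdgeIndex) {a b : ℝ} (ha : 0 < a) (hb : 0 < b) :
    edgePoint (K.bend e) e a b ∈ K.edge e :=
  ⟨(K.h_eq_zero_iff e a b ha hb _ (edgePoint_apply_one _ _ _ _) (edgePoint_apply_two _ _ _ _)).2
    (edgePoint_apply_zero _ _ _ _), edgePoint_mem_quadrant _ _ ha hb⟩

theorem eq_edgePoint {e : EdgeIndex} {w : Space} (hw : w ∈ K.edge e) :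
    w = edgePoint (K.bend e) e (sg e.2.1 * w (e.1 + 1)) (sg e.2.2 * w (e.1 + 2)) := by
  have h1 : w (e.1 + 1) = sg e.2.1 * w (e.1 + 1) * sg e.2.1 := by
    rw [mul_comm, ← mul_assoc, sg_mul_self, one_mul]
  have h2 : w (e.1 + 2) = sg e.2.2 * w (e.1 + 2) * sg e.2.2 := by
    rw [mul_comm, ← mul_assoc, sg_mul_self, one_mul]
  refine space_ext e.1 ?_ ?_ ?_
  · rw [edgePoint_apply_zero]
    exact (K.h_eq_zero_iff e _ _ hw.2.1 hw.2.2 w h1 h2).1 hw.1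
  · rw [edgePoint_apply_one]; exact h1
  · rw [edgePoint_apply_two]; exact h2

theorem edge_eq_image (e : EdgeIndex) :
    K.edge e = (fun p : ℝ × ℝ => edgePoint (K.bend e) e p.1 p.2) '' (Ioi 0 ×ˢ Ioi 0) := by
  ext w
  constructor
  · intro hw
    exact ⟨(_, _), ⟨hw.2.1, hw.2.2⟩, (K.eq_edgePoint hw).symm⟩
  · rintro ⟨⟨a, b⟩, ⟨ha, hb⟩, rfl⟩
    exact K.edgePoint_mem e ha hb

theorem isPreconnected_edge (e : EdgeIndex) : IsPreconnected (K.edge e) := by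
  rw [K.edge_eq_image]
  refine (isPreconnected_Ioi.prod isPreconnected_Ioi).image _ fun p hp =>
    (continuousAt_edgePoint _ _ ?_).continuousWithinAt
  exact (add_pos hp.1 hp.2).ne'

theorem zero_notMem_edge (e : EdgeIndex) : (0 : Space) ∉ K.edge e := by
  rintro ⟨-, h, -⟩
  simp at h

theorem nonempty_edge (e : EdgeIndex) : (K.edge e).Nonempty :=
  ⟨_, K.edgePoint_mem e one_pos one_pos⟩

theorem ne_zero_of_mem_edge {e : EdgeIndex} {w : Space} (hw : w ∈ K.edge e) : w ≠ 0 := by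
  rintro rfl
  exact K.zero_notMem_edge e hw

theorem h_ne_of_mem_edge {e : EdgeIndex} {w : Space} (hw : w ∈ K.edge e) {i : ι}
    (hi : i ≠ K.circ e) : K.h i w ≠ 0 := by
  intro h
  obtain ⟨v, s, -, h⟩ := (K.vertex_iff w (K.ne_zero_of_mem_edge hw)).1
    ⟨i, K.circ e, hi, h, hw.1⟩
  exact ne_smul_axis_of_mem_quadrant hw.2 v s h

/-- A point in the closure of an edge that is not on the edge is on one of the rays bounding it. -/
theorem mem_closure_edge {e : EdgeIndex} {w : Space} (hw : w ∈ closure (K.edge e))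
    (hwe : w ∉ K.edge e) (hw0 : w ≠ 0) : ∃ s : ℝ, 0 < s ∧
      (w = s • axis (e.1 + 1, e.2.1) ∨ w = s • axis (e.1 + 2, e.2.2)) := by
  -- Since `a * b / (a + b)` is at most `a` and at most `b`, and the bend is at most `1`, the third
  -- coordinate is dominated by each of the other two. This survives in the closure, so when one of
  -- them vanishes there, the third coordinate vanishes with it.
  let T : Set Space := {w | K.h (K.circ e) w = 0 ∧ |w e.1| ≤ sg e.2.1 * w (e.1 + 1) ∧
    |w e.1| ≤ sg e.2.2 * w (e.1 + 2)}
  have hT : IsClosed T := by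
    simp only [T, Set.ofPred_and]
    exact (isClosed_eq (K.cont_h _) continuous_const).inter
      (IsClosed.inter (isClosed_le (by fun_prop) (by fun_prop))
        (isClosed_le (by fun_prop) (by fun_prop)))
  have hsub : K.edge e ⊆ T := by
    intro z hz
    refine ⟨hz.1, ?_⟩
    have h1 := hz.2.1
    have h2 := hz.2.2
    have h3 := congrArg (fun w : Space => w e.1) (K.eq_edgePoint hz)
    simp only [edgePoint_apply_zero] at h3
    set a := sg e.2.1 * z (e.1 + 1)
    set b := sg e.2.2 * z (e.1 + 2)
    have hab : 0 < a * b / (a + b) := by positivity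
    have h4 : |z e.1| ≤ a * b / (a + b) := by
      rw [h3, abs_mul, abs_of_pos hab]
      nlinarith [K.abs_bend_le e]
    refine ⟨h4.trans ?_, h4.trans ?_⟩
    · rw [div_le_iff₀ (by positivity)]; nlinarith [mul_pos h1 h1]
    · rw [div_le_iff₀ (by positivity)]; nlinarith [mul_pos h2 h2]
  obtain ⟨h0, h1, h2⟩ := closure_minimal hsub hT hw
  have hw1 : w (e.1 + 1) = sg e.2.1 * w (e.1 + 1) * sg e.2.1 := by
    rw [mul_comm, ← mul_assoc, sg_mul_self, one_mul]
  have hw2 : w (e.1 + 2) = sg e.2.2 * w (e.1 + 2) * sg e.2.2 := by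
    rw [mul_comm, ← mul_assoc, sg_mul_self, one_mul]
  set a := sg e.2.1 * w (e.1 + 1)
  set b := sg e.2.2 * w (e.1 + 2)
  have key : ∀ a' b' : ℝ, a' = a → b' = b → w e.1 = 0 → (a' = 0 ∨ b' = 0) →
      w = edgePoint 0 e a' b' := by
    rintro a' b' rfl rfl h00 -
    refine space_ext e.1 ?_ ?_ ?_
    · rw [edgePoint_apply_zero, h00, zero_mul]
    · rw [edgePoint_apply_one]; exact hw1
    · rw [edgePoint_apply_two]; exact hw2
  have ha := (abs_nonneg _).trans h1
  have hb := (abs_nonneg _).trans h2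
  rcases ha.eq_or_lt with ha | ha
  · have h00 : w e.1 = 0 := abs_eq_zero.1 (le_antisymm (h1.trans ha.ge) (abs_nonneg _))
    have hw' := key 0 b ha rfl h00 (Or.inl rfl)
    rw [edgePoint_left_zero] at hw'
    refine ⟨b, lt_of_le_of_ne hb ?_, Or.inr hw'⟩
    intro hb0
    rw [← hb0, zero_smul] at hw'
    exact hw0 hw'
  · rcases hb.eq_or_lt with hb | hb
    · have h00 : w e.1 = 0 := abs_eq_zero.1 (le_antisymm (h2.trans hb.ge) (abs_nonneg _))
      have hw' := key a 0 rfl hb h00 (Or.inr rfl)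
      rw [edgePoint_right_zero] at hw'
      exact ⟨a, ha, Or.inl hw'⟩
    · exact absurd ⟨h0, ha, hb⟩ hwe

theorem nonempty_preimage_cell (χ : SphereChart) (f : F) : (χ.toFun ⁻¹' K.cell f).Nonempty :=
  χ.nonempty_preimage (K.smul_cell f) (K.zero_notMem_cell f) (K.nonempty_cell f)
    fun _ => K.isOpen_cell f

theorem preimage_cell_injective (χ : SphereChart) :
    Function.Injective fun f => χ.toFun ⁻¹' K.cell f := by
  intro f f' h
  obtain ⟨x, hx⟩ := K.nonempty_preimage_cell χ f
  have h' : χ.toFun ⁻¹' K.cell f = χ.toFun ⁻¹' K.cell f' := h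
  exact K.cell_unique _ f f' hx (h' ▸ hx : x ∈ χ.toFun ⁻¹' K.cell f')

/-- The system `S` of the circles `C i` is described by the fan `K` in the chart `χ`. The circle
`C i` is the zero set of `h i`, and `flip i` tells whether `h i` is positive in its interior. -/
structure Represents (χ : SphereChart) (S : CircleSystem)
    (C : ι → EuclideanGeometry.Sphere Plane) (flip : ι → Bool) : Prop where
  injective : Function.Injective C
  mem_circles : ∀ D, D ∈ S.circles ↔ ∃ i, C i = D
  mem_iff : ∀ i x, x ∈ C i ↔ K.h i (χ.toFun x) = 0
  mem_inside_iff : ∀ i x, x ∈ CircleSystem.inside (C i) ↔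
    if flip i then 0 < K.h i (χ.toFun x) else K.h i (χ.toFun x) < 0
  -- No circle passes through the point at infinity.
  h_pole : ∀ i, K.h i χ.pole ≠ 0

namespace Represents

variable {K} {χ : SphereChart} {S : CircleSystem} {C : ι → EuclideanGeometry.Sphere Plane}
  {flip : ι → Bool}

theorem mem_carrier_iff (H : K.Represents χ S C flip)
    (x : Plane) : x ∈ S.carrier ↔ ∃ i, K.h i (χ.toFun x) = 0 := by
  constructor
  · rintro ⟨D, hD, hx⟩
    obtain ⟨i, rfl⟩ := (H.mem_circles D).1 hD
    exact ⟨i, (H.mem_iff i x).1 hx⟩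
  · rintro ⟨i, hi⟩
    exact ⟨C i, (H.mem_circles _).2 ⟨i, rfl⟩, (H.mem_iff i x).2 hi⟩

theorem mem_compl_carrier_iff (H : K.Represents χ S C flip)
    (x : Plane) : x ∈ S.carrierᶜ ↔ ∃ f, χ.toFun x ∈ K.cell f := by
  rw [K.exists_cell_iff _ (χ.toFun_ne x), mem_compl_iff, H.mem_carrier_iff, not_exists]

/-- The cells are open, connected and pairwise disjoint, and they cover the complement of the
drawing. -/
theorem connectedComponentIn_compl_carrier (H : K.Represents χ S C flip)
    {f : F} {x : Plane} (hx : χ.toFun x ∈ K.cell f) :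
    connectedComponentIn S.carrierᶜ x = χ.toFun ⁻¹' K.cell f := by
  have hsub : ∀ f, S.carrierᶜ ∩ χ.toFun ⁻¹' K.cell f = χ.toFun ⁻¹' K.cell f := fun f =>
    inter_eq_right.2 fun y hy => (H.mem_compl_carrier_iff y).2 ⟨f, hy⟩
  rw [← hsub f]
  refine connectedComponentIn_eq_of_open_family (O := fun f => χ.toFun ⁻¹' K.cell f)
    (fun f => (K.isOpen_cell f).preimage χ.cont) (fun y hy => (H.mem_compl_carrier_iff y).1 hy)
    (fun y _ f f' h h' => K.cell_unique _ f f' h h') (fun f => ?_) ?_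
  · rw [hsub]
    exact χ.isPreconnected_preimage (K.smul_cell f) (K.zero_notMem_cell f)
      (K.isPreconnected_cell f) fun _ => K.isOpen_cell f
  · rw [hsub]; exact hx

theorem mem_faces_iff (H : K.Represents χ S C flip)
    (f' : Set Plane) :
    f' ∈ S.faces ↔ ∃ f, χ.toFun ⁻¹' K.cell f = f' := by
  constructor
  · rintro ⟨x, hx, rfl⟩
    obtain ⟨f, hf⟩ := (H.mem_compl_carrier_iff x).1 hx
    exact ⟨f, (H.connectedComponentIn_compl_carrier hf).symm⟩
  · rintro ⟨f, rfl⟩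
    obtain ⟨x, hx⟩ := K.nonempty_preimage_cell χ f
    exact ⟨x, (H.mem_compl_carrier_iff x).2 ⟨f, hx⟩,
      (H.connectedComponentIn_compl_carrier hx).symm⟩

theorem mem_vertices_iff_h (H : K.Represents χ S C flip)
    (x : Plane) : x ∈ S.vertices ↔
    ∃ i i', i ≠ i' ∧ K.h i (χ.toFun x) = 0 ∧ K.h i' (χ.toFun x) = 0 := by
  constructor
  · rintro ⟨D, hD, D', hD', hne, hx, hx'⟩
    obtain ⟨i, rfl⟩ := (H.mem_circles D).1 hD
    obtain ⟨i', rfl⟩ := (H.mem_circles D').1 hD'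
    exact ⟨i, i', fun h => hne (h ▸ rfl), (H.mem_iff i x).1 hx, (H.mem_iff i' x).1 hx'⟩
  · rintro ⟨i, i', hne, hi, hi'⟩
    exact ⟨C i, (H.mem_circles _).2 ⟨i, rfl⟩, C i', (H.mem_circles _).2 ⟨i', rfl⟩,
      fun h => hne (H.injective h), (H.mem_iff i x).2 hi, (H.mem_iff i' x).2 hi'⟩

theorem not_sameRay_of_h_eq_zero (H : K.Represents χ S C flip)
    {w : Space} (hw0 : w ≠ 0) {i : ι} (hi : K.h i w = 0) :
    ¬ SameRay ℝ w χ.pole := by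
  intro h
  obtain ⟨r, hr, h⟩ := h.exists_pos_left hw0 χ.pole_ne
  refine H.h_pole i ?_
  rw [← h, K.smul_h _ _ _ hr, hi, mul_zero]

theorem not_sameRay_axis (H : K.Represents χ S C flip)
    (v : Fin 3 × Fin 2) : ¬ SameRay ℝ (axis v) χ.pole := by
  obtain ⟨i, -, -, hi, -⟩ := (K.vertex_iff _ (axis_ne_zero v)).2 ⟨v, 1, one_pos, by simp⟩
  exact H.not_sameRay_of_h_eq_zero (axis_ne_zero v) hi

theorem mem_vertices_iff (H : K.Represents χ S C flip)
    (x : Plane) : x ∈ S.vertices ↔ ∃ v, χ.inv (axis v) = x := by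
  rw [H.mem_vertices_iff_h, K.vertex_iff _ (χ.toFun_ne x)]
  constructor
  · rintro ⟨v, s, hs, h⟩
    refine ⟨v, ?_⟩
    rw [← χ.inv_toFun x, h, χ.inv_smul _ _ hs]
  · rintro ⟨v, rfl⟩
    obtain ⟨s, hs, h⟩ := χ.toFun_inv _ (H.not_sameRay_axis v)
    exact ⟨v, s, hs, h⟩

theorem vertex_injective (H : K.Represents χ S C flip) :
    Function.Injective fun v => χ.inv (axis v) := by
  intro v v' h
  obtain ⟨s, hs, h1⟩ := χ.toFun_inv _ (H.not_sameRay_axis v)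
  obtain ⟨s', hs', h2⟩ := χ.toFun_inv _ (H.not_sameRay_axis v')
  simp only at h
  rw [h, h2] at h1
  refine axis_sameRay_injective (s := s⁻¹ * s') (by positivity) ?_
  rw [mul_smul, h1, smul_smul, inv_mul_cancel₀ hs.ne', one_smul]

theorem mem_circle_diff_vertices (H : K.Represents χ S C flip)
    {e : EdgeIndex} {x : Plane} (hx : χ.toFun x ∈ K.edge e) :
    x ∈ (C (K.circ e) : Set Plane) \ S.vertices := by
  refine ⟨(H.mem_iff _ x).2 hx.1, fun h => ?_⟩
  obtain ⟨v, s, -, h⟩ := (K.vertex_iff _ (χ.toFun_ne x)).1 ((H.mem_vertices_iff_h x).1 h)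
  exact ne_smul_axis_of_mem_quadrant hx.2 v s h

theorem exists_edge (H : K.Represents χ S C flip)
    {i : ι} {x : Plane} (hx : x ∈ (C i : Set Plane) \ S.vertices) :
    ∃ e, K.circ e = i ∧ χ.toFun x ∈ K.edge e := by
  have hi := (H.mem_iff i x).1 hx.1
  obtain ⟨e, rfl, he⟩ := K.exists_edge _ i (χ.toFun_ne x) hi fun i' hne hi' =>
    hx.2 ((H.mem_vertices_iff_h x).2 ⟨i', i, hne, hi', hi⟩)
  exact ⟨e, rfl, hi, he⟩

/-- Arcs are not open in the plane, but each is the trace on its circle of an open quadrant, and on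
the circle the quadrants of different edges do not overlap. -/
theorem connectedComponentIn_circle (H : K.Represents χ S C flip)
    {e : EdgeIndex} {x : Plane} (hx : χ.toFun x ∈ K.edge e) :
    connectedComponentIn ((C (K.circ e) : Set Plane) \ S.vertices) x = χ.toFun ⁻¹' K.edge e := by
  have hsub : ∀ e', K.circ e' = K.circ e →
      ((C (K.circ e) : Set Plane) \ S.vertices) ∩ χ.toFun ⁻¹' quadrant e' =
        χ.toFun ⁻¹' K.edge e' := by
    intro e' he'
    ext y
    constructor
    · rintro ⟨h1, h2⟩
      exact ⟨by rw [he']; exact (H.mem_iff _ y).1 h1.1, h2⟩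
    · intro hy
      refine ⟨?_, hy.2⟩
      rw [← he']
      exact H.mem_circle_diff_vertices hy
  rw [← hsub e rfl]
  refine connectedComponentIn_eq_of_open_family (κ := {e' // K.circ e' = K.circ e})
    (O := fun e' => χ.toFun ⁻¹' quadrant e'.1) (k := ⟨e, rfl⟩)
    (fun e' => (isOpen_quadrant e'.1).preimage χ.cont) (fun y hy => ?_) ?_ (fun e' => ?_) ?_
  · obtain ⟨e', he', hy'⟩ := H.exists_edge hy
    exact ⟨⟨e', he'⟩, hy'.2⟩
  · rintro y hy ⟨e', he'⟩ ⟨e'', he''⟩ h' h''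
    refine Subtype.ext (K.edge_unique (χ.toFun y) e' e'' (he'.trans he''.symm) ?_ h' h'')
    rw [he']; exact (H.mem_iff _ y).1 hy.1
  · rw [hsub _ e'.2]
    exact χ.isPreconnected_preimage (fun _ hw _ hs => K.smul_edge hw hs) (K.zero_notMem_edge _)
      (K.isPreconnected_edge _) fun hp => absurd hp.1 (H.h_pole _)
  · rw [hsub _ rfl]; exact hx

theorem nonempty_arc (H : K.Represents χ S C flip)
    (e : EdgeIndex) : (χ.toFun ⁻¹' K.edge e).Nonempty :=
  χ.nonempty_preimage (fun _ hw _ hs => K.smul_edge hw hs) (K.zero_notMem_edge _)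
    (K.nonempty_edge e) fun hp => absurd hp.1 (H.h_pole _)

theorem mem_arcs_iff (H : K.Represents χ S C flip)
    (A : Set Plane) : A ∈ S.arcs ↔ ∃ e, χ.toFun ⁻¹' K.edge e = A := by
  constructor
  · rintro ⟨D, hD, x, hx, rfl⟩
    obtain ⟨i, rfl⟩ := (H.mem_circles D).1 hD
    obtain ⟨e, rfl, he⟩ := H.exists_edge hx
    exact ⟨e, (H.connectedComponentIn_circle he).symm⟩
  · rintro ⟨e, rfl⟩
    obtain ⟨x, hx⟩ := H.nonempty_arc e
    exact ⟨C (K.circ e), (H.mem_circles _).2 ⟨_, rfl⟩, x, H.mem_circle_diff_vertices hx,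
      (H.connectedComponentIn_circle hx).symm⟩

theorem arc_injective (H : K.Represents χ S C flip) :
    Function.Injective fun e => χ.toFun ⁻¹' K.edge e := by
  intro e e' h
  obtain ⟨x, hx⟩ := H.nonempty_arc e
  have h' : χ.toFun ⁻¹' K.edge e = χ.toFun ⁻¹' K.edge e' := h
  have hx' : x ∈ χ.toFun ⁻¹' K.edge e' := h' ▸ hx
  have hc : K.circ e = K.circ e' := by
    by_contra hne
    exact K.h_ne_of_mem_edge hx' hne hx.1
  exact K.edge_unique _ e e' hc hx.1 hx.2 hx'.2

/-- The parameters `(1 + δ, δ)` and `(δ, 1 + δ)` approach the two ends along the edge as `δ` tends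
to `0`; `mem_closure_edge` excludes all other limit points. -/
theorem closure_arc_diff (H : K.Represents χ S C flip)
    (e : EdgeIndex) :
    closure (χ.toFun ⁻¹' K.edge e) \ (χ.toFun ⁻¹' K.edge e) =
      {χ.inv (axis (e.1 + 1, e.2.1)), χ.inv (axis (e.1 + 2, e.2.2))} := by
  have hconv : ∀ v : Fin 3 × Fin 2, ∀ p : ℝ × ℝ, 0 < p.1 + p.2 → 0 ≤ p.1 → 0 ≤ p.2 →
      edgePoint (K.bend e) e p.1 p.2 = axis v →
      χ.inv (axis v) ∈ closure (χ.toFun ⁻¹' K.edge e) \ (χ.toFun ⁻¹' K.edge e) := by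
    rintro v ⟨p, q⟩ h0 hp hq hv
    have hc : Tendsto (fun δ : ℝ => χ.inv (edgePoint (K.bend e) e (p + δ) (q + δ))) (𝓝[>] 0)
        (𝓝 (χ.inv (axis v))) := by
      have h1 : ContinuousAt (fun δ : ℝ => edgePoint (K.bend e) e (p + δ) (q + δ)) 0 :=
        ContinuousAt.comp (f := fun δ : ℝ => (p + δ, q + δ))
          (g := fun p : ℝ × ℝ => edgePoint (K.bend e) e p.1 p.2)
          (continuousAt_edgePoint _ _ (by simpa using h0.ne')) (by fun_prop)
      have h2 : ContinuousAt χ.inv (edgePoint (K.bend e) e (p + 0) (q + 0)) := by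
        simp only [add_zero, hv]
        exact χ.cont_inv.continuousAt (χ.isOpen_not_sameRay.mem_nhds (H.not_sameRay_axis v))
      have h3 := (ContinuousAt.comp (f := fun δ : ℝ => edgePoint (K.bend e) e (p + δ) (q + δ))
        h2 h1).tendsto
      simp only [Function.comp_def, add_zero, hv] at h3
      exact h3.mono_left nhdsWithin_le_nhds
    obtain ⟨s, hs, h⟩ := χ.toFun_inv _ (H.not_sameRay_axis v)
    refine ⟨mem_closure_of_tendsto hc ?_, fun hm => ?_⟩
    · filter_upwards [self_mem_nhdsWithin] with δ (hδ : 0 < δ)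
      have hm := K.edgePoint_mem e (a := p + δ) (b := q + δ) (by positivity) (by positivity)
      obtain ⟨s, hs, h⟩ := χ.toFun_inv _
        (H.not_sameRay_of_h_eq_zero (K.ne_zero_of_mem_edge hm) hm.1)
      rw [mem_preimage, h]
      exact K.smul_edge hm hs
    · rw [mem_preimage, h] at hm
      exact ne_smul_axis_of_mem_quadrant hm.2 v s rfl
  apply Subset.antisymm
  · rintro x ⟨hx, hxe⟩
    obtain ⟨s, hs, h⟩ := K.mem_closure_edge
      (χ.cont.closure_preimage_subset _ hx) hxe (χ.toFun_ne x)
    rcases h with h | h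
    · left
      rw [← χ.inv_toFun x, h, χ.inv_smul _ _ hs]
    · right
      rw [mem_singleton_iff, ← χ.inv_toFun x, h, χ.inv_smul _ _ hs]
  · rintro x (rfl | rfl)
    · exact hconv _ (1, 0) (by simp) (by simp) (by simp) (by simp [edgePoint_right_zero])
    · exact hconv _ (0, 1) (by simp) (by simp) (by simp) (by simp [edgePoint_left_zero])

end Represents

end Fan

/-! ### The oriented dual of a system described by a fan -/

theorem openSegment_subset_inside {C : EuclideanGeometry.Sphere Plane} (hC : 0 < C.radius)
    {a b : Plane} (ha : a ∈ C) (hb : b ∈ C) (hab : a ≠ b) :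
    openSegment ℝ a b ⊆ CircleSystem.inside C := by
  have h := (strictConvex_closedBall ℝ C.center C.radius).openSegment_subset
    (EuclideanGeometry.mem_sphere.1 ha).le (EuclideanGeometry.mem_sphere.1 hb).le hab
  rwa [interior_closedBall _ hC.ne'] at h

theorem nontrivial_circle {C : EuclideanGeometry.Sphere Plane} (hC : 0 < C.radius) :
    (Metric.sphere C.center C.radius).Nontrivial := by
  obtain ⟨x, hx⟩ : (Metric.sphere C.center C.radius).Nonempty := NormedSpace.sphere_nonempty.2 hC.le
  rw [mem_sphere_iff_norm] at hx
  refine ⟨x, mem_sphere_iff_norm.2 hx, C.center - (x - C.center), ?_, fun h => ?_⟩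
  · rw [mem_sphere_iff_norm, sub_sub_cancel_left, norm_neg, hx]
  · have h1 : (2 : ℝ) • (x - C.center) = 0 := by
      rw [two_smul]; nth_rewrite 1 [h]; abel
    have h2 : x - C.center = 0 := by simpa using h1
    rw [h2, norm_zero] at hx
    exact hC.ne hx

theorem exists_mem_circle_ne {C : EuclideanGeometry.Sphere Plane} (hC : 0 < C.radius)
    {x : Plane} (hx : x ∈ C) {O : Set Plane} (hO : O ∈ 𝓝 x) : ∃ y ∈ O, y ∈ C ∧ y ≠ x := by
  have hacc := (isPreconnected_sphere one_lt_rank_plane C.center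
    C.radius).preperfect_of_nontrivial (nontrivial_circle hC) x (EuclideanGeometry.mem_sphere.1 hx)
  obtain ⟨y, ⟨hyO, hyC⟩, hyx⟩ := accPt_iff_nhds.1 hacc O hO
  exact ⟨y, hyO, hyC, hyx⟩

/-- The edge of the octahedron graph with a given name. -/
def octahedronEdge (e : EdgeIndex) : octahedronGraph.edgeSet :=
  ⟨s((e.1 + 1, e.2.1), (e.1 + 2, e.2.2)), by
    have : ∀ j : Fin 3, j + 1 ≠ j + 2 := by decide
    exact this e.1⟩

theorem octahedronEdge_bijective : Function.Bijective octahedronEdge := by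
  constructor
  · have : ∀ e e' : EdgeIndex, s((e.1 + 1, e.2.1), (e.1 + 2, e.2.2)) =
        s((e'.1 + 1, e'.2.1), (e'.1 + 2, e'.2.2)) → e = e' := by decide
    intro e e' h
    exact this e e' (congrArg Subtype.val h)
  · have : ∀ u v : Fin 3 × Fin 2, u.1 ≠ v.1 → ∃ e : EdgeIndex,
        s((e.1 + 1, e.2.1), (e.1 + 2, e.2.2)) = s(u, v) := by decide
    rintro ⟨⟨u, v⟩, h⟩
    obtain ⟨e, he⟩ := this u v h
    exact ⟨e, Subtype.ext he⟩

theorem dist_lineMap_center {D : EuclideanGeometry.Sphere Plane} {x : Plane} (hx : x ∈ D) (t : ℝ) :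
    dist (AffineMap.lineMap x D.center t) D.center = |1 - t| * D.radius := by
  rw [dist_lineMap_right, EuclideanGeometry.mem_sphere.1 hx, Real.norm_eq_abs]

namespace Fan

variable {ι F : Type} (K : Fan ι F)

/-- The cell at an edge that lies in the interior of the circle containing the edge. -/
def inner (flip : ι → Bool) (e : EdgeIndex) : F := if flip (K.circ e) then K.pos e else K.neg e

/-- The cell at an edge that lies in the exterior of the circle containing the edge. -/
def outer (flip : ι → Bool) (e : EdgeIndex) : F := if flip (K.circ e) then K.neg e else K.pos e

/-- The dual graph on the cells, every edge being oriented from the interior to the exterior of its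
circle. -/
def DualAdj (flip : ι → Bool) (f f' : F) : Prop :=
  ∃ e, K.inner flip e = f ∧ K.outer flip e = f'

theorem inner_ne_outer (flip : ι → Bool) (e : EdgeIndex) :
    K.inner flip e ≠ K.outer flip e := by
  intro h
  obtain ⟨w, hw⟩ := K.nonempty_cell (K.inner flip e)
  have hw' := hw
  rw [h] at hw'
  rw [inner] at hw
  rw [outer] at hw'
  split_ifs at hw hw'
  · exact (K.h_neg e _ hw').not_gt (K.h_pos e _ hw)
  · exact (K.h_neg e _ hw).not_gt (K.h_pos e _ hw')

theorem notMem_preimage_cell {χ : SphereChart} {e : EdgeIndex} {x : Plane}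
    (hx : χ.toFun x ∈ K.edge e) (f : F) : x ∉ χ.toFun ⁻¹' K.cell f := fun h =>
  (K.exists_cell_iff _ (χ.toFun_ne x)).1 ⟨f, h⟩ _ hx.1

namespace Represents

variable {K} {χ : SphereChart} {S : CircleSystem} {C : ι → EuclideanGeometry.Sphere Plane}
  {flip : ι → Bool}

/-- A system described by a fan is a realization of the octahedron graph. -/
theorem realizes (H : K.Represents χ S C flip) : S.Realizes octahedronGraph := by
  let φ : Fin 3 × Fin 2 ≃ S.vertices := Equiv.ofBijective
    (fun v => ⟨χ.inv (axis v), (H.mem_vertices_iff _).2 ⟨v, rfl⟩⟩)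
    ⟨fun v v' h => H.vertex_injective (congrArg Subtype.val h), fun ⟨x, hx⟩ => by
      obtain ⟨v, hv⟩ := (H.mem_vertices_iff x).1 hx
      exact ⟨v, Subtype.ext hv⟩⟩
  let A : EdgeIndex ≃ S.arcs := Equiv.ofBijective
    (fun e => ⟨χ.toFun ⁻¹' K.edge e, (H.mem_arcs_iff _).2 ⟨e, rfl⟩⟩)
    ⟨fun e e' h => H.arc_injective (congrArg Subtype.val h), fun ⟨a, ha⟩ => by
      obtain ⟨e, he⟩ := (H.mem_arcs_iff a).1 ha
      exact ⟨e, Subtype.ext he⟩⟩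
  let E := Equiv.ofBijective octahedronEdge octahedronEdge_bijective
  refine ⟨φ, E.symm.trans A, fun e => ?_⟩
  obtain ⟨e, rfl⟩ := E.surjective e
  have h1 : ((E.symm.trans A) (E e) : Set Plane) = χ.toFun ⁻¹' K.edge e := by
    simp only [Equiv.trans_apply, Equiv.symm_apply_apply]
    rfl
  have h2 : {v | v ∈ (E e : Sym2 (Fin 3 × Fin 2))} =
      {(e.1 + 1, e.2.1), (e.1 + 2, e.2.2)} := by
    ext v
    exact Sym2.mem_iff
  rw [h1, h2, H.closure_arc_diff, image_pair]
  rfl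

theorem radius_pos (H : K.Represents χ S C flip) (i : ι) : 0 < (C i).radius :=
  S.radius_pos _ ((H.mem_circles _).2 ⟨i, rfl⟩)

theorem eventually_mem_cell (H : K.Represents χ S C flip) {e : EdgeIndex} {x : Plane}
    (hx : χ.toFun x ∈ K.edge e) : ∀ᶠ z in 𝓝 x,
      (z ∈ CircleSystem.inside (C (K.circ e)) → χ.toFun z ∈ K.cell (K.inner flip e)) ∧
      (z ∉ C (K.circ e) → z ∉ CircleSystem.inside (C (K.circ e)) →
        χ.toFun z ∈ K.cell (K.outer flip e)) := by
  filter_upwards [χ.cont.continuousAt.eventually (K.sides e _ hx.1 hx.2)] with z hz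
  rw [H.mem_iff, H.mem_inside_iff, inner, outer]
  split_ifs
  · exact ⟨hz.1, fun h h' => hz.2 (lt_of_le_of_ne (not_lt.1 h') h)⟩
  · exact ⟨hz.2, fun h h' => hz.1 (lt_of_le_of_ne (not_lt.1 h') (Ne.symm h))⟩

/-- From a point of the arc one moves along the line to the center: parameters `t > 0` lead into the
disc, `t < 0` out of it. -/
theorem mem_closure_inner_outer (H : K.Represents χ S C flip) {e : EdgeIndex} {x : Plane}
    (hx : χ.toFun x ∈ K.edge e) : x ∈ closure (χ.toFun ⁻¹' K.cell (K.inner flip e)) ∧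
      x ∈ closure (χ.toFun ⁻¹' K.cell (K.outer flip e)) := by
  have hxC : x ∈ C (K.circ e) := (H.mem_iff _ _).2 hx.1
  have hr := H.radius_pos (K.circ e)
  set D := C (K.circ e)
  have hev := H.eventually_mem_cell hx
  have ht : Tendsto (fun t : ℝ => (AffineMap.lineMap x D.center t : Plane)) (𝓝 0) (𝓝 x) := by
    have : Continuous fun t : ℝ => (AffineMap.lineMap x D.center t : Plane) :=
      AffineMap.lineMap_continuous
    simpa using this.tendsto 0
  constructor
  · refine mem_closure_of_tendsto (ht.mono_left (nhdsWithin_le_nhds (s := Ioi 0))) ?_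
    filter_upwards [(ht.eventually hev).filter_mono nhdsWithin_le_nhds,
      Ioo_mem_nhdsGT (zero_lt_one (α := ℝ))] with t ht ht'
    refine ht.1 ?_
    have h1 : dist (AffineMap.lineMap x D.center t) D.center < D.radius := by
      rw [dist_lineMap_center hxC, abs_of_pos (by linarith [ht'.2])]
      nlinarith [ht'.1]
    exact h1
  · refine mem_closure_of_tendsto (ht.mono_left (nhdsWithin_le_nhds (s := Iio 0))) ?_
    filter_upwards [(ht.eventually hev).filter_mono nhdsWithin_le_nhds,
      self_mem_nhdsWithin] with t ht (ht' : t < 0)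
    have h1 : D.radius < dist (AffineMap.lineMap x D.center t) D.center := by
      rw [dist_lineMap_center hxC, abs_of_pos (by linarith)]
      nlinarith
    exact ht.2 (fun h => h1.ne' (EuclideanGeometry.mem_sphere.1 h)) (fun h => h1.not_gt h)

/-- Near a point of the arc every point off the circle belongs to one of these two cells, so no
third cell comes close. -/
theorem subset_frontier_iff (H : K.Represents χ S C flip) (e : EdgeIndex) (f : F) :
    χ.toFun ⁻¹' K.edge e ⊆ frontier (χ.toFun ⁻¹' K.cell f) ↔
      f = K.inner flip e ∨ f = K.outer flip e := by
  have ho : ∀ f, IsOpen (χ.toFun ⁻¹' K.cell f) := fun f => (K.isOpen_cell f).preimage χ.cont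
  constructor
  · intro h
    obtain ⟨x, hx⟩ := H.nonempty_arc e
    have hxf := frontier_subset_closure (h hx)
    obtain ⟨z, hz, hzf⟩ := mem_closure_iff_nhds.1 hxf _ (H.eventually_mem_cell hx)
    have hzC : z ∉ C (K.circ e) := fun hzC =>
      (K.exists_cell_iff _ (χ.toFun_ne z)).1 ⟨f, hzf⟩ _ ((H.mem_iff _ _).1 hzC)
    by_cases hzi : z ∈ CircleSystem.inside (C (K.circ e))
    · exact Or.inl (K.cell_unique _ _ _ hzf (hz.1 hzi))
    · exact Or.inr (K.cell_unique _ _ _ hzf (hz.2 hzC hzi))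
  · intro h x hx
    rw [(ho f).frontier_eq]
    refine ⟨?_, K.notMem_preimage_cell hx f⟩
    rcases h with rfl | rfl
    · exact (H.mem_closure_inner_outer hx).1
    · exact (H.mem_closure_inner_outer hx).2

/-- A short chord of the arc lies in the disc and close to the arc, hence in the inner cell. This is
what keeps the dual edge from pointing inwards. -/
theorem exists_openSegment_subset_inner (H : K.Represents χ S C flip) (e : EdgeIndex) :
    ∃ a ∈ χ.toFun ⁻¹' K.edge e, ∃ b ∈ χ.toFun ⁻¹' K.edge e,
      openSegment ℝ a b ⊆ χ.toFun ⁻¹' K.cell (K.inner flip e) := by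
  obtain ⟨x, hx⟩ := H.nonempty_arc e
  have hxC : x ∈ C (K.circ e) := (H.mem_iff _ _).2 hx.1
  have hr := H.radius_pos (K.circ e)
  obtain ⟨δ, hδ, hball⟩ := Metric.eventually_nhds_iff_ball.1 (H.eventually_mem_cell hx)
  have hO : Metric.ball x δ ∩ χ.toFun ⁻¹' quadrant e ∈ 𝓝 x :=
    inter_mem (Metric.ball_mem_nhds x hδ) (((isOpen_quadrant e).preimage χ.cont).mem_nhds hx.2)
  obtain ⟨y, ⟨hyδ, hyq⟩, hyC, hyx⟩ := exists_mem_circle_ne hr hxC hO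
  refine ⟨x, hx, y, ⟨(H.mem_iff _ _).1 hyC, hyq⟩, fun z hz => ?_⟩
  refine (hball z ?_).1 (openSegment_subset_inside hr hxC hyC (Ne.symm hyx) hz)
  exact (convex_ball x δ).segment_subset (Metric.mem_ball_self hδ) hyδ
    (openSegment_subset_segment ℝ x y hz)

theorem disjoint_inside_outer (H : K.Represents χ S C flip) (e : EdgeIndex) :
    Disjoint (CircleSystem.inside (C (K.circ e))) (χ.toFun ⁻¹' K.cell (K.outer flip e)) := by
  refine Set.disjoint_left.2 fun x hx hx' => ?_
  rw [H.mem_inside_iff] at hx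
  rw [mem_preimage, outer] at hx'
  split_ifs at hx hx'
  · exact (K.h_neg e _ hx').not_gt hx
  · exact (K.h_pos e _ hx').not_gt hx

/-- Short chords exclude the inner cell as a target. No chord lies in the outer cell, because chords
run inside the disc and the outer cell is disjoint from it. -/
theorem orientedDual_adj_iff (H : K.Represents χ S C flip) (f f' : F)
    (hf : χ.toFun ⁻¹' K.cell f ∈ S.faces) (hf' : χ.toFun ⁻¹' K.cell f' ∈ S.faces) :
    S.orientedDual.Adj ⟨_, hf⟩ ⟨_, hf'⟩ ↔ K.DualAdj flip f f' := by
  constructor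
  · rintro ⟨hne, a, ha, h1, h2, h3⟩
    obtain ⟨e, rfl⟩ := (H.mem_arcs_iff a).1 ha
    have hff : f ≠ f' := by rintro rfl; exact hne rfl
    rw [H.subset_frontier_iff] at h1 h2
    have hin : f' ≠ K.inner flip e := by
      rintro rfl
      obtain ⟨a, ha, b, hb, hab⟩ := H.exists_openSegment_subset_inner e
      exact h3 a ha b hb hab
    have hout := h2.resolve_left hin
    refine ⟨e, ?_, hout.symm⟩
    exact (h1.resolve_right fun h => hff (h.trans hout.symm)).symm
  · rintro ⟨e, rfl, rfl⟩
    refine ⟨fun h => K.inner_ne_outer flip e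
      (K.preimage_cell_injective χ (congrArg Subtype.val h)), _, (H.mem_arcs_iff _).2 ⟨e, rfl⟩,
      (H.subset_frontier_iff e _).2 (Or.inl rfl), (H.subset_frontier_iff e _).2 (Or.inr rfl), ?_⟩
    intro a ha b hb hab
    obtain ⟨z, hz⟩ : (openSegment ℝ a b).Nonempty := ⟨_, midpoint_mem_openSegment a b⟩
    -- For `a = b` the open segment is the point `a` itself, which lies on the arc and thus in no
    -- cell.
    by_cases h : a = b
    · subst h
      rw [openSegment_same, singleton_subset_iff] at hab
      exact K.notMem_preimage_cell ha _ hab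
    · exact Set.disjoint_left.1 (H.disjoint_inside_outer e)
        (openSegment_subset_inside (H.radius_pos _) ((H.mem_iff _ _).2 ha.1)
          ((H.mem_iff _ _).2 hb.1) h hz) (hab hz)

/-- The oriented dual of a system described by a fan is the oriented dual of the fan. -/
theorem nonempty_orientedDual_iso (H : K.Represents χ S C flip) :
    Nonempty (K.DualAdj flip ≃r S.orientedDual.Adj) := by
  let Φ : F ≃ S.faces := Equiv.ofBijective
    (fun f => ⟨χ.toFun ⁻¹' K.cell f, (H.mem_faces_iff _).2 ⟨f, rfl⟩⟩)
    ⟨fun f f' h => K.preimage_cell_injective χ (congrArg Subtype.val h), fun ⟨x, hx⟩ => by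
      obtain ⟨f, hf⟩ := (H.mem_faces_iff x).1 hx
      exact ⟨f, Subtype.ext hf⟩⟩
  exact ⟨⟨Φ, fun {f f'} => H.orientedDual_adj_iff f f' _ _⟩⟩

end Represents

end Fan

/-! ### The fan of three coordinate planes -/

/-- The sign vector with the signs given by an edge at its end points and a prescribed third
sign. -/
def edgeSigns (e : EdgeIndex) (u : Fin 2) (k : Fin 3) : Fin 2 :=
  if k = e.1 then u else if k = e.1 + 1 then e.2.1 else e.2.2

theorem fin_three_cases (j k : Fin 3) : k = j ∨ k = j + 1 ∨ k = j + 2 := by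
  revert j k; decide

theorem edgeSigns_self (e : EdgeIndex) (u : Fin 2) : edgeSigns e u e.1 = u := by
  simp [edgeSigns]

theorem edgeSigns_one (e : EdgeIndex) (u : Fin 2) : edgeSigns e u (e.1 + 1) = e.2.1 := by
  simp [edgeSigns]

theorem edgeSigns_two (e : EdgeIndex) (u : Fin 2) : edgeSigns e u (e.1 + 2) = e.2.2 := by
  have : ∀ j : Fin 3, j + 2 ≠ j ∧ j + 2 ≠ j + 1 := by decide
  simp [edgeSigns, this e.1]

/-- The open orthant of three-space given by a sign vector. -/
def orthant (σ : Fin 3 → Fin 2) : Set Space := {w | ∀ i, 0 < sg (σ i) * w i}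

theorem isOpen_orthant (σ : Fin 3 → Fin 2) : IsOpen (orthant σ) := by
  simp only [orthant, Set.ofPred_forall]
  exact isOpen_iInter_of_finite fun i => isOpen_lt (by fun_prop) (by fun_prop)

theorem smul_mem_orthant {σ : Fin 3 → Fin 2} {w : Space} (hw : w ∈ orthant σ) {s : ℝ}
    (hs : 0 < s) : s • w ∈ orthant σ := by
  intro i
  have := mul_pos hs (hw i)
  simp only [PiLp.smul_apply, smul_eq_mul]
  linarith

theorem convex_orthant (σ : Fin 3 → Fin 2) : Convex ℝ (orthant σ) := by
  intro w hw z hz a b ha hb hab i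
  have h1 := hw i
  have h2 := hz i
  simp only [PiLp.add_apply, PiLp.smul_apply, smul_eq_mul]
  have : sg (σ i) * (a * w i + b * z i) = a * (sg (σ i) * w i) + b * (sg (σ i) * z i) := by ring
  rw [this]
  rcases ha.eq_or_lt with rfl | ha
  · have : b = 1 := by linarith
    subst this; linarith
  · have := mul_pos ha h1
    have := mul_nonneg hb h2.le
    linarith

/-- The vector with entries `1` and `-1` given by a sign vector. -/
noncomputable def signPoint (σ : Fin 3 → Fin 2) : Space := WithLp.toLp 2 fun i => sg (σ i)

theorem signPoint_apply (σ : Fin 3 → Fin 2) (i : Fin 3) : signPoint σ i = sg (σ i) := rfl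

theorem signPoint_mem_orthant (σ : Fin 3 → Fin 2) : signPoint σ ∈ orthant σ := by
  intro i
  rw [signPoint_apply, sg_mul_self]
  exact one_pos

theorem sg_unique {s t : Fin 2} {x : ℝ} (hs : 0 < sg s * x) (ht : 0 < sg t * x) : s = t := by
  fin_cases s <;> fin_cases t <;> simp [sg] at * <;> linarith

theorem exists_sg_mul_pos {x : ℝ} (hx : x ≠ 0) : ∃ s, 0 < sg s * x := by
  rcases lt_or_gt_of_ne hx with h | h
  · exact ⟨1, by simpa [sg] using h⟩
  · exact ⟨0, by simpa [sg] using h⟩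

theorem mem_orthant_iff (e : EdgeIndex) (u : Fin 2) (w : Space) :
    w ∈ orthant (edgeSigns e u) ↔ w ∈ quadrant e ∧ 0 < sg u * w e.1 := by
  constructor
  · intro h
    have h0 := h e.1
    have h1 := h (e.1 + 1)
    have h2 := h (e.1 + 2)
    rw [edgeSigns_self] at h0
    rw [edgeSigns_one] at h1
    rw [edgeSigns_two] at h2
    exact ⟨⟨h1, h2⟩, h0⟩
  · rintro ⟨⟨h1, h2⟩, h0⟩ i
    rcases fin_three_cases e.1 i with rfl | rfl | rfl
    · rwa [edgeSigns_self]
    · rwa [edgeSigns_one]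
    · rwa [edgeSigns_two]

/-- A point with two vanishing coordinates is on a coordinate axis. -/
theorem exists_eq_smul_axis {w : Space} (hw : w ≠ 0) {j : Fin 3} (h1 : w (j + 1) = 0)
    (h2 : w (j + 2) = 0) : ∃ v, ∃ s : ℝ, 0 < s ∧ w = s • axis v := by
  have h0 : w j ≠ 0 := fun h => hw (space_ext j (by simpa) (by simpa) (by simpa))
  have hne : ∀ j : Fin 3, j + 1 ≠ j ∧ j + 2 ≠ j := by decide
  obtain ⟨s, hs⟩ := exists_sg_mul_pos h0
  refine ⟨(j, s), sg s * w j, hs, space_ext j ?_ ?_ ?_⟩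
  · rw [PiLp.smul_apply, axis_apply_same, smul_eq_mul, mul_comm, ← mul_assoc, sg_mul_self, one_mul]
  · rw [PiLp.smul_apply, axis_apply_of_ne _ (hne j).1, h1, smul_zero]
  · rw [PiLp.smul_apply, axis_apply_of_ne _ (hne j).2, h2, smul_zero]

/-- The fan of the three coordinate planes. -/
noncomputable def crossingFan : Fan (Fin 3) (Fin 3 → Fin 2) where
  h i w := w i
  cont_h i := by fun_prop
  smul_h i w s _ := rfl
  cell := orthant
  isOpen_cell := isOpen_orthant
  smul_cell _ _ hw _ hs := smul_mem_orthant hw hs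
  zero_notMem_cell σ h := by simpa using h 0
  isPreconnected_cell σ := (convex_orthant σ).isPreconnected
  nonempty_cell σ := ⟨_, signPoint_mem_orthant σ⟩
  cell_unique w σ τ h h' := funext fun i => sg_unique (h i) (h' i)
  exists_cell_iff w _ := by
    constructor
    · rintro ⟨σ, h⟩ i hi
      simpa [hi] using h i
    · intro h
      choose σ hσ using fun i => exists_sg_mul_pos (h i)
      exact ⟨σ, hσ⟩
  circ e := e.1
  bend _ := 0
  abs_bend_le _ := by simp
  h_eq_zero_iff e a b _ _ w _ _ := by rw [zero_mul]
  exists_edge w i _ hi hne := by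
    have h12 : ∀ j : Fin 3, j + 1 ≠ j ∧ j + 2 ≠ j := by decide
    obtain ⟨s, hs⟩ := exists_sg_mul_pos (hne _ (h12 i).1)
    obtain ⟨t, ht⟩ := exists_sg_mul_pos (hne _ (h12 i).2)
    exact ⟨(i, s, t), rfl, hs, ht⟩
  edge_unique w e e' hc _ h h' := by
    obtain ⟨j, s, t⟩ := e
    obtain ⟨j', s', t'⟩ := e'
    obtain rfl : j = j' := hc
    obtain rfl : s = s' := sg_unique h.1 h'.1
    obtain rfl : t = t' := sg_unique h.2 h'.2
    rfl
  vertex_iff w hw := by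
    constructor
    · rintro ⟨i, i', hne, h, h'⟩
      have : ∀ i i' : Fin 3, i ≠ i' → ∃ j : Fin 3, (i = j + 1 ∧ i' = j + 2) ∨
        (i = j + 2 ∧ i' = j + 1) := by decide
      obtain ⟨j, ⟨rfl, rfl⟩ | ⟨rfl, rfl⟩⟩ := this i i' hne
      · exact exists_eq_smul_axis hw h h'
      · exact exists_eq_smul_axis hw h' h
    · rintro ⟨⟨j, u⟩, s, -, rfl⟩
      have hne : ∀ j : Fin 3, j + 1 ≠ j ∧ j + 2 ≠ j ∧ j + 1 ≠ j + 2 := by decide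
      refine ⟨j + 1, j + 2, (hne j).2.2, ?_, ?_⟩
      · rw [PiLp.smul_apply, axis_apply_of_ne _ (hne j).1, smul_zero]
      · rw [PiLp.smul_apply, axis_apply_of_ne _ (hne j).2.1, smul_zero]
  pos e := edgeSigns e 0
  neg e := edgeSigns e 1
  h_pos e w hw := by simpa [sg] using ((mem_orthant_iff e 0 w).1 hw).2
  h_neg e w hw := by simpa [sg] using ((mem_orthant_iff e 1 w).1 hw).2
  sides e w _ hw := by
    filter_upwards [(isOpen_quadrant e).mem_nhds hw] with z hz
    refine ⟨fun h => (mem_orthant_iff e 0 z).2 ⟨hz, by simpa [sg] using h⟩,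
      fun h => (mem_orthant_iff e 1 z).2 ⟨hz, by simpa [sg] using h⟩⟩

/-! ### The fan of four mutually touching cones -/

/-- The four sign vectors with an even number of minus signs: the vertices of a tetrahedron. -/
def tetra (k : Fin 4) (j : Fin 3) : Fin 2 :=
  ![![0, 0, 0], ![0, 1, 1], ![1, 0, 1], ![1, 1, 0]] k j

/-- The index of an even sign vector, as determined by its first two entries. -/
def tetraIndex (σ : Fin 3 → Fin 2) : Fin 4 :=
  if σ 0 = 0 then if σ 1 = 0 then 0 else 1 else if σ 1 = 0 then 2 else 3

/-- The tetrahedron vertex in whose orthant an edge of the octahedron lies. -/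
def gapIndex (e : EdgeIndex) : Fin 4 := tetraIndex (edgeSigns e (e.2.1 + e.2.2))

/-- The tetrahedron vertex that is opposite to an edge of the octahedron at both its ends. -/
def capIndex (e : EdgeIndex) : Fin 4 :=
  tetraIndex (edgeSigns (e.1, e.2.1 + 1, e.2.2 + 1) (e.2.1 + e.2.2))

theorem tetra_gapIndex (e : EdgeIndex) : tetra (gapIndex e) = edgeSigns e (e.2.1 + e.2.2) := by
  revert e; decide

theorem tetra_capIndex (e : EdgeIndex) : tetra (capIndex e) e.1 = e.2.1 + e.2.2 ∧
    tetra (capIndex e) (e.1 + 1) = e.2.1 + 1 ∧ tetra (capIndex e) (e.1 + 2) = e.2.2 + 1 := by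
  revert e; decide

theorem sg_add_one (s : Fin 2) : sg (s + 1) = - sg s := by
  fin_cases s <;> simp [sg]

theorem norm_sq_space (w : Space) (j : Fin 3) :
    ‖w‖ ^ 2 = w j ^ 2 + w (j + 1) ^ 2 + w (j + 2) ^ 2 := by
  rw [EuclideanSpace.norm_sq_eq, Fin.sum_univ_three]
  fin_cases j <;> simp <;> ring

/-- The function vanishing on the cone over the circle that cuts off the tetrahedron vertex opposite
to the vertex `k`. -/
noncomputable def tangentForm (k : Fin 4) (w : Space) : ℝ := ‖w‖ + ∑ j, sg (tetra k j) * w j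

theorem tangentForm_eq (k : Fin 4) (w : Space) (j : Fin 3) : tangentForm k w =
    ‖w‖ + (sg (tetra k j) * w j + sg (tetra k (j + 1)) * w (j + 1) +
      sg (tetra k (j + 2)) * w (j + 2)) := by
  rw [tangentForm, Fin.sum_univ_three]
  fin_cases j <;> simp <;> ring

theorem continuous_tangentForm (k : Fin 4) : Continuous (tangentForm k) := by
  unfold tangentForm; fun_prop

theorem tangentForm_smul (k : Fin 4) (w : Space) {s : ℝ} (hs : 0 < s) :
    tangentForm k (s • w) = s * tangentForm k w := by
  simp only [tangentForm, norm_smul, Real.norm_of_nonneg hs.le, PiLp.smul_apply, smul_eq_mul,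
    mul_add, Finset.mul_sum]
  congr 1
  exact Finset.sum_congr rfl fun j _ => by ring

theorem sg_sq (s : Fin 2) : sg s ^ 2 = 1 := by rw [sq, sg_mul_self]

/-- On the zero set of a tangent form, the pairwise products of the signed coordinates add up
to zero. -/
theorem products_eq_zero {k : Fin 4} {w : Space} (h : tangentForm k w = 0) (j : Fin 3) :
    (sg (tetra k j) * w j) * (sg (tetra k (j + 1)) * w (j + 1)) +
    (sg (tetra k j) * w j) * (sg (tetra k (j + 2)) * w (j + 2)) +
    (sg (tetra k (j + 1)) * w (j + 1)) * (sg (tetra k (j + 2)) * w (j + 2)) = 0 := by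
  have h1 := norm_sq_space w j
  rw [tangentForm_eq k w j] at h
  have hsq : ∀ i, w i ^ 2 = (sg (tetra k i) * w i) ^ 2 := fun i => by
    rw [mul_pow, sg_sq, one_mul]
  rw [hsq j, hsq (j + 1), hsq (j + 2)] at h1
  set x := sg (tetra k j) * w j
  set y := sg (tetra k (j + 1)) * w (j + 1)
  set z := sg (tetra k (j + 2)) * w (j + 2)
  have h2 : ‖w‖ = - (x + y + z) := by linarith
  rw [h2] at h1
  nlinarith

theorem exists_common_sign {i k : Fin 4} (h : i ≠ k) : ∃ j, tetra i j = tetra k j ∧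
    tetra i (j + 1) = tetra k (j + 1) + 1 ∧ tetra i (j + 2) = tetra k (j + 2) + 1 := by
  revert i k; decide

/-- Two of the sign vectors agree in exactly one entry, so the other two coordinates cancel. The sum
is thus nonnegative and vanishes on a single axis ray only: there the two caps touch. -/
theorem tangentForm_add {i k : Fin 4} {w : Space} {j : Fin 3} (h0 : tetra i j = tetra k j)
    (h1 : tetra i (j + 1) = tetra k (j + 1) + 1) (h2 : tetra i (j + 2) = tetra k (j + 2) + 1) :
    tangentForm i w + tangentForm k w = 2 * (‖w‖ + sg (tetra k j) * w j) := by
  rw [tangentForm_eq i w j, tangentForm_eq k w j, h0, h1, h2, sg_add_one, sg_add_one]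
  ring

theorem abs_sg_mul_le_norm (s : Fin 2) (w : Space) (j : Fin 3) : |sg s * w j| ≤ ‖w‖ := by
  refine abs_le_of_sq_le_sq ?_ (norm_nonneg _)
  rw [norm_sq_space w j, mul_pow, sg_sq]
  nlinarith [sq_nonneg (w (j + 1)), sq_nonneg (w (j + 2))]

theorem tangentForm_add_nonneg {i k : Fin 4} (h : i ≠ k) (w : Space) :
    0 ≤ tangentForm i w + tangentForm k w := by
  obtain ⟨j, h0, h1, h2⟩ := exists_common_sign h
  rw [tangentForm_add h0 h1 h2]
  linarith [(abs_le.1 (abs_sg_mul_le_norm (tetra k j) w j)).1]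

theorem eq_axis_of_tangentForm_eq_zero {i k : Fin 4} (h : i ≠ k) {w : Space} (hw : w ≠ 0)
    (hi : tangentForm i w = 0) (hk : tangentForm k w = 0) :
    ∃ v, ∃ s : ℝ, 0 < s ∧ w = s • axis v := by
  obtain ⟨j, h0, h1, h2⟩ := exists_common_sign h
  have h3 := tangentForm_add (w := w) h0 h1 h2
  have h4 : ‖w‖ = -(sg (tetra k j) * w j) := by linarith
  have h5 := norm_sq_space w j
  rw [h4, neg_sq, mul_pow, sg_sq] at h5
  exact exists_eq_smul_axis hw (j := j) (by nlinarith [sq_nonneg (w (j + 1)), sq_nonneg (w (j + 2))])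
    (by nlinarith [sq_nonneg (w (j + 1)), sq_nonneg (w (j + 2))])

/-- The cone of `k` passes through the three axis rays whose signs are opposite to `tetra k`, the
vertices of one octahedron face. -/
theorem tangentForm_axis {k : Fin 4} {j : Fin 3} {s : Fin 2} (h : tetra k j = s + 1) :
    tangentForm k (axis (j, s)) = 0 := by
  have hne : ∀ j : Fin 3, j + 1 ≠ j ∧ j + 2 ≠ j := by decide
  have hn : ‖axis (j, s)‖ = 1 := by
    rw [axis, PiLp.norm_single]
    fin_cases s <;> simp [sg]
  rw [tangentForm_eq _ _ j, axis_apply_same, axis_apply_of_ne _ (hne j).1,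
    axis_apply_of_ne _ (hne j).2, hn, h, sg_add_one, neg_mul, sg_mul_self]
  ring

/-- The cells of the fan of a tetrahedron: the four caps and the four gaps between them. -/
def tangentCell : Fin 4 ⊕ Fin 4 → Set Space
  | .inl i => {w | tangentForm i w < 0}
  | .inr k => {w | ∀ i, 0 < tangentForm i w} ∩ orthant (tetra k)

theorem convex_cap (i : Fin 4) : Convex ℝ {w | tangentForm i w < 0} := by
  have h1 : ConvexOn ℝ univ (tangentForm i) := by
    unfold tangentForm
    refine (convexOn_norm convex_univ).add ?_
    refine ⟨convex_univ, fun w _ z _ a b _ _ _ => le_of_eq ?_⟩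
    simp only [PiLp.add_apply, PiLp.smul_apply, smul_eq_mul, mul_add, Finset.sum_add_distrib,
      Finset.mul_sum]
    congr 1 <;> exact Finset.sum_congr rfl fun j _ => by ring
  simpa using h1.convex_lt 0

theorem norm_signPoint_sq (σ : Fin 3 → Fin 2) : ‖signPoint σ‖ ^ 2 = 3 := by
  rw [norm_sq_space _ 0]
  simp only [signPoint_apply, sg_sq]
  norm_num

theorem tangentForm_signPoint_pos (i k : Fin 4) : 0 < tangentForm i (signPoint (tetra k)) := by
  have h := norm_signPoint_sq (tetra k)
  have h1 : 1 < ‖signPoint (tetra k)‖ := by nlinarith [norm_nonneg (signPoint (tetra k))]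
  rw [tangentForm_eq i _ 0]
  simp only [signPoint_apply]
  fin_cases i <;> fin_cases k <;> simp [tetra, sg] at h1 ⊢ <;> linarith

theorem tangentForm_neg_signPoint (i : Fin 4) : tangentForm i (-signPoint (tetra i)) < 0 := by
  have h := norm_signPoint_sq (tetra i)
  have h1 : ‖signPoint (tetra i)‖ < 3 := by nlinarith [norm_nonneg (signPoint (tetra i))]
  rw [tangentForm_eq i _ 0, norm_neg]
  simp only [PiLp.neg_apply, signPoint_apply, mul_neg, sg_mul_self]
  linarith

theorem signPoint_mem_gap (k : Fin 4) : signPoint (tetra k) ∈ tangentCell (.inr k) :=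
  ⟨fun i => tangentForm_signPoint_pos i k, signPoint_mem_orthant _⟩

/-- In the orthant of `σ` the sum of the absolute coordinates is at least `‖w‖`; therefore the mixed
term of the squared norm on the right is at least `2 * a * b * ‖w‖`. -/
theorem norm_add_signPoint_ge {σ : Fin 3 → Fin 2} {w : Space} (hw : w ∈ orthant σ) {a b : ℝ}
    (ha : 0 ≤ a) (hb : 0 ≤ b) : a * ‖w‖ + b ≤ ‖a • w + b • signPoint σ‖ := by
  have h0 := hw 0
  have h1 := hw 1
  have h2 := hw 2
  have hn := norm_sq_space w 0
  have hsum : ‖w‖ ≤ sg (σ 0) * w 0 + sg (σ 1) * w 1 + sg (σ 2) * w 2 := by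
    refine abs_le_of_sq_le_sq' ?_ (by positivity) |>.2
    have hsq : ∀ i, w i ^ 2 = (sg (σ i) * w i) ^ 2 := fun i => by
      rw [mul_pow, sg_sq, one_mul]
    simp only [zero_add] at hn
    rw [hn, hsq 0, hsq 1, hsq 2]
    nlinarith [mul_pos h0 h1, mul_pos h0 h2, mul_pos h1 h2]
  refine abs_le_of_sq_le_sq' ?_ (norm_nonneg _) |>.2
  have hz := norm_sq_space (a • w + b • signPoint σ) 0
  simp only [PiLp.add_apply, PiLp.smul_apply, smul_eq_mul, signPoint_apply, zero_add] at hz hn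
  rw [hz]
  have e : (a * w 0 + b * sg (σ 0)) ^ 2 + (a * w 1 + b * sg (σ 1)) ^ 2 +
      (a * w 2 + b * sg (σ 2)) ^ 2 = a ^ 2 * ‖w‖ ^ 2 + 3 * b ^ 2 +
      2 * (a * b) * (sg (σ 0) * w 0 + sg (σ 1) * w 1 + sg (σ 2) * w 2) := by
    rw [hn]
    linear_combination b ^ 2 * (sg_sq (σ 0) + sg_sq (σ 1) + sg_sq (σ 2))
  rw [e]
  nlinarith [mul_le_mul_of_nonneg_left hsum (mul_nonneg ha hb), sq_nonneg b]

/-- On the way to the sign vector the norm exceeds its share `a * ‖w‖` by at least `b`, while the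
added linear part of a tangent form is at least `-b`, because two tetrahedron vertices have inner
product `3` or `-1`. So the forms stay positive. -/
theorem starConvex_gap (k : Fin 4) : StarConvex ℝ (signPoint (tetra k)) (tangentCell (.inr k)) := by
  intro w hw b a hb ha hab
  rw [add_comm]
  rcases ha.eq_or_lt with rfl | ha
  · obtain rfl : b = 1 := by linarith
    simpa using signPoint_mem_gap k
  refine ⟨fun i => ?_, ?_⟩
  · have hn := norm_add_signPoint_ge hw.2 ha.le hb
    have hi := mul_pos ha (hw.1 i)
    have hs : -1 ≤ ∑ j, sg (tetra i j) * sg (tetra k j) := by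
      rw [Fin.sum_univ_three]
      fin_cases i <;> fin_cases k <;> simp [tetra, sg] <;> norm_num
    have e : tangentForm i (a • w + b • signPoint (tetra k)) =
        (‖a • w + b • signPoint (tetra k)‖ - a * ‖w‖) + a * tangentForm i w +
          b * ∑ j, sg (tetra i j) * sg (tetra k j) := by
      simp only [tangentForm, PiLp.add_apply, PiLp.smul_apply, smul_eq_mul, signPoint_apply,
        Fin.sum_univ_three]
      ring
    rw [e]
    nlinarith [mul_le_mul_of_nonneg_left hs hb]
  · exact convex_orthant _ hw.2 (signPoint_mem_orthant _) ha.le hb (by linarith)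

/-- If all four tangent forms are positive, then the signs of the coordinates are those of a
tetrahedron vertex. -/
theorem exists_mem_gap {w : Space} (h : ∀ i, 0 < tangentForm i w) :
    ∃ k, w ∈ tangentCell (.inr k) := by
  have hn := norm_sq_space w 0
  have hn0 := norm_nonneg w
  have h0 := h 0
  have h1 := h 1
  have h2 := h 2
  have h3 := h 3
  simp only [tangentForm_eq _ w 0] at h0 h1 h2 h3
  simp [tetra, sg] at h0 h1 h2 h3 hn
  have hu := abs_le.1 (abs_sg_mul_le_norm 0 w 0)
  simp only [sg, if_true, one_mul] at hu
  set n := ‖w‖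
  -- These products say `(n + w 0) ^ 2 > (w 1 + w 2) ^ 2` and `(n - w 0) ^ 2 > (w 1 - w 2) ^ 2`.
  -- They force `w 1 * w 2` to have the sign of `w 0`, so that the number of negative coordinates is
  -- even.
  have h01 := mul_pos h0 h1
  have h23 := mul_pos h2 h3
  have hlo : w 0 * (n - w 0) < w 1 * w 2 := by nlinarith
  have hhi : w 1 * w 2 < w 0 * (n + w 0) := by nlinarith
  have hu0 : w 0 ≠ 0 := by
    intro h
    rw [h] at hlo hhi
    linarith
  have mem : ∀ k, 0 < sg (tetra k 0) * w 0 → 0 < sg (tetra k 1) * w 1 →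
      0 < sg (tetra k 2) * w 2 → ∃ k, w ∈ tangentCell (.inr k) := by
    intro k a b c
    refine ⟨k, h, fun j => ?_⟩
    rcases fin_three_cases 0 j with rfl | rfl | rfl
    · exact a
    · exact b
    · exact c
  rcases lt_or_gt_of_ne hu0 with hneg | hpos
  · have hvt : w 1 * w 2 < 0 := by nlinarith
    rcases mul_neg_iff.1 hvt with ⟨a, b⟩ | ⟨a, b⟩
    · exact mem 2 (by simpa [tetra, sg]) (by simpa [tetra, sg]) (by simpa [tetra, sg])
    · exact mem 3 (by simpa [tetra, sg]) (by simpa [tetra, sg]) (by simpa [tetra, sg])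
  · have hvt : 0 < w 1 * w 2 := by nlinarith
    rcases mul_pos_iff.1 hvt with ⟨a, b⟩ | ⟨a, b⟩
    · exact mem 0 (by simpa [tetra, sg]) (by simpa [tetra, sg]) (by simpa [tetra, sg])
    · exact mem 1 (by simpa [tetra, sg]) (by simpa [tetra, sg]) (by simpa [tetra, sg])

theorem isOpen_tangentCell (f : Fin 4 ⊕ Fin 4) : IsOpen (tangentCell f) := by
  rcases f with i | k
  · exact isOpen_lt (continuous_tangentForm i) continuous_const
  · refine IsOpen.inter ?_ (isOpen_orthant _)
    simp only [Set.ofPred_forall]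
    exact isOpen_iInter_of_finite fun i => isOpen_lt continuous_const (continuous_tangentForm i)

theorem tangentForm_pos_of_ne {i k : Fin 4} {w : Space} (h : tangentForm i w < 0) (hne : k ≠ i) :
    0 < tangentForm k w := by
  linarith [tangentForm_add_nonneg hne w]

/-- With `x` the signed third coordinate, the equation is `‖w‖ = a + b - x`. Squaring it leaves `x *
(a + b) = a * b`. -/
theorem tangentForm_eq_zero_iff (e : EdgeIndex) (a b : ℝ) (ha : 0 < a) (hb : 0 < b) (w : Space)
    (h1 : w (e.1 + 1) = a * sg e.2.1) (h2 : w (e.1 + 2) = b * sg e.2.2) :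
    tangentForm (capIndex e) w = 0 ↔ w e.1 = sg (e.2.1 + e.2.2) * (a * b / (a + b)) := by
  obtain ⟨c0, c1, c2⟩ := tetra_capIndex e
  have hn := norm_sq_space w e.1
  have hn0 := norm_nonneg w
  rw [tangentForm_eq _ w e.1, c0, c1, c2, sg_add_one, sg_add_one, h1, h2]
  rw [h1, h2, mul_pow, mul_pow, sg_sq, sg_sq] at hn
  have e1 : -sg e.2.1 * (a * sg e.2.1) = -a := by linear_combination -a * sg_mul_self e.2.1
  have e2 : -sg e.2.2 * (b * sg e.2.2) = -b := by linear_combination -b * sg_mul_self e.2.2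
  rw [e1, e2]
  set ε := sg (e.2.1 + e.2.2)
  have hε : ε * ε = 1 := sg_mul_self _
  have hx : w e.1 ^ 2 = (ε * w e.1) ^ 2 := by rw [mul_pow, sq ε, hε, one_mul]
  have hiff : w e.1 = ε * (a * b / (a + b)) ↔ ε * w e.1 = a * b / (a + b) := by
    constructor
    · intro h; rw [h, ← mul_assoc, hε, one_mul]
    · intro h; rw [← h, ← mul_assoc, hε, one_mul]
  rw [hiff, eq_div_iff (by positivity)]
  rw [hx] at hn
  set x := ε * w e.1
  constructor
  · intro h
    have : ‖w‖ = a + b - x := by linarith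
    rw [this] at hn
    nlinarith
  · intro h
    -- Taking the square root needs `a + b - x` to be nonnegative.
    have hxab : x ≤ a + b := by nlinarith
    have : ‖w‖ = a + b - x := by
      refine (sq_eq_sq₀ hn0 (by linarith)).1 ?_
      rw [hn]; nlinarith
    rw [this]; ring

/-- The signed coordinates have negative sum and their pairwise products add up to zero. If one
vanished, so would another, and `w` would be on an axis. Two of them cannot be positive, as the sum
would then be positive; so two are negative, and these name the edge. -/
theorem exists_edge_of_tangentForm_eq_zero {w : Space} {i : Fin 4} (hw : w ≠ 0)
    (hi : tangentForm i w = 0) (hax : ∀ v, ∀ s : ℝ, 0 < s → w ≠ s • axis v) :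
    ∃ e, capIndex e = i ∧ w ∈ quadrant e := by
  have hz : ∃ j, sg (tetra i (j + 1)) * w (j + 1) < 0 ∧ sg (tetra i (j + 2)) * w (j + 2) < 0 := by
    have hne : ∀ j, w j ≠ 0 := by
      intro j hj
      have hp := products_eq_zero hi j
      rw [hj] at hp
      simp only [mul_zero, zero_mul, zero_add] at hp
      have ax : ∀ j : Fin 3, w (j + 1) = 0 → w (j + 2) = 0 → False := fun j h1 h2 => by
        obtain ⟨v, s, hs, h⟩ := exists_eq_smul_axis hw h1 h2
        exact hax v s hs h
      rcases mul_eq_zero.1 hp with h | h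
      · exact ax (j + 2) (by simpa [add_assoc] using hj)
          (by simpa [add_assoc, sg_ne_zero] using h)
      · exact ax (j + 1) (by simpa [add_assoc, sg_ne_zero] using h)
          (by simpa [add_assoc, sg_ne_zero] using hj)
    have hp := products_eq_zero hi 0
    have hs := tangentForm_eq i w 0
    have hn := norm_pos_iff.2 hw
    rw [hi] at hs
    have hx : sg (tetra i 0) * w 0 ≠ 0 := mul_ne_zero (sg_ne_zero _) (hne 0)
    have hy : sg (tetra i 1) * w 1 ≠ 0 := mul_ne_zero (sg_ne_zero _) (hne 1)
    have hz : sg (tetra i 2) * w 2 ≠ 0 := mul_ne_zero (sg_ne_zero _) (hne 2)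
    simp only [zero_add] at hp hs
    set x := sg (tetra i 0) * w 0
    set y := sg (tetra i 1) * w 1
    set z := sg (tetra i 2) * w 2
    have key : (y < 0 ∧ z < 0) ∨ (z < 0 ∧ x < 0) ∨ (x < 0 ∧ y < 0) := by
      have two : ∀ p q r : ℝ, 0 < p → 0 < q → p * q + p * r + q * r = 0 → p + q + r < 0 →
          False := fun p q r hp hq h1 h2 => by nlinarith [mul_pos hp hq]
      rcases lt_or_gt_of_ne hx with hx | hx <;> rcases lt_or_gt_of_ne hy with hy | hy
      · exact Or.inr (Or.inr ⟨hx, hy⟩)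
      · rcases lt_or_gt_of_ne hz with hz | hz
        · exact Or.inr (Or.inl ⟨hz, hx⟩)
        · exact (two y z x hy hz (by linarith) (by linarith)).elim
      · rcases lt_or_gt_of_ne hz with hz | hz
        · exact Or.inl ⟨hy, hz⟩
        · exact (two x z y hx hz (by linarith) (by linarith)).elim
      · exact (two x y z hx hy (by linarith) (by linarith)).elim
    rcases key with h | h | h
    · exact ⟨0, h⟩
    · exact ⟨1, h⟩
    · exact ⟨2, h⟩
  obtain ⟨j, h1, h2⟩ := hz
  refine ⟨(j, tetra i (j + 1) + 1, tetra i (j + 2) + 1), ?_, ?_, ?_⟩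
  · have : ∀ (i : Fin 4) (j : Fin 3),
        capIndex (j, tetra i (j + 1) + 1, tetra i (j + 2) + 1) = i := by decide
    exact this i j
  · simp only [sg_add_one]; linarith
  · simp only [sg_add_one]; linarith

/-- Two different edges on one cone would make all three signed coordinates negative, and their
pairwise products could not add up to zero. -/
theorem tangent_edge_unique {w : Space} {e e' : EdgeIndex} (hc : capIndex e = capIndex e')
    (h0 : tangentForm (capIndex e) w = 0) (h : w ∈ quadrant e) (h' : w ∈ quadrant e') :
    e = e' := by
  have hneg : ∀ e : EdgeIndex, w ∈ quadrant e →
      sg (tetra (capIndex e) (e.1 + 1)) * w (e.1 + 1) < 0 ∧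
      sg (tetra (capIndex e) (e.1 + 2)) * w (e.1 + 2) < 0 := by
    intro e h
    obtain ⟨-, c1, c2⟩ := tetra_capIndex e
    rw [c1, c2, sg_add_one, sg_add_one]
    exact ⟨by linarith [h.1], by linarith [h.2]⟩
  have hd : ∀ e e' : EdgeIndex, capIndex e = capIndex e' → e.1 = e'.1 → e = e' := by decide
  refine hd e e' hc ?_
  by_contra hne
  obtain ⟨a1, a2⟩ := hneg e h
  have b := hneg e' h'
  rw [← hc] at b
  have hb : sg (tetra (capIndex e) e.1) * w e.1 < 0 := by
    rcases fin_three_cases e'.1 e.1 with h | h | h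
    · exact absurd h hne
    · rw [h]; exact b.1
    · rw [h]; exact b.2
  have hp := products_eq_zero h0 e.1
  nlinarith [mul_pos_of_neg_of_neg a1 a2, mul_pos_of_neg_of_neg hb a2, mul_pos_of_neg_of_neg hb a1]

/-- The fan of the four cones that touch the six edges of a tetrahedron. -/
noncomputable def tangentFan : Fan (Fin 4) (Fin 4 ⊕ Fin 4) where
  h := tangentForm
  cont_h := continuous_tangentForm
  smul_h i w s hs := tangentForm_smul i w hs
  cell := tangentCell
  isOpen_cell := isOpen_tangentCell
  smul_cell f w hw s hs := by
    rcases f with i | k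
    · have : tangentForm i w < 0 := hw
      change tangentForm i (s • w) < 0
      rw [tangentForm_smul i w hs]
      exact mul_neg_of_pos_of_neg hs this
    · refine ⟨fun i => ?_, smul_mem_orthant hw.2 hs⟩
      rw [tangentForm_smul i w hs]
      exact mul_pos hs (hw.1 i)
  zero_notMem_cell f h := by
    rcases f with i | k
    · have : tangentForm i 0 < 0 := h
      simp [tangentForm] at this
    · simpa using h.2 0
  isPreconnected_cell f := by
    rcases f with i | k
    · exact (convex_cap i).isPreconnected
    · exact ((starConvex_gap k).isPathConnected (signPoint_mem_gap k)).isConnected.isPreconnected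
  nonempty_cell f := by
    rcases f with i | k
    · exact ⟨_, tangentForm_neg_signPoint i⟩
    · exact ⟨_, signPoint_mem_gap k⟩
  cell_unique w f f' h h' := by
    rcases f with i | k <;> rcases f' with i' | k'
    · by_contra hne
      exact (tangentForm_pos_of_ne (i := i') h' (fun h => hne (h ▸ rfl))).not_gt h
    · exact absurd (h'.1 i) (not_lt.2 (le_of_lt h))
    · exact absurd (h.1 i') (not_lt.2 (le_of_lt h'))
    · have hinj : Function.Injective tetra := by decide
      have : tetra k = tetra k' := funext fun j => sg_unique (h.2 j) (h'.2 j)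
      rw [hinj this]
  exists_cell_iff w _ := by
    constructor
    · rintro ⟨i | k, h⟩ i'
      · by_cases hi : i' = i
        · subst hi; exact ne_of_lt h
        · exact (tangentForm_pos_of_ne h hi).ne'
      · exact (h.1 i').ne'
    · intro h
      by_cases hp : ∀ i, 0 < tangentForm i w
      · obtain ⟨k, hk⟩ := exists_mem_gap hp
        exact ⟨_, hk⟩
      · push Not at hp
        obtain ⟨i, hi⟩ := hp
        exact ⟨.inl i, lt_of_le_of_ne hi (h i)⟩
  circ := capIndex
  bend e := sg (e.2.1 + e.2.2)
  abs_bend_le e := by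
    have : ∀ s, |sg s| ≤ 1 := fun s => by fin_cases s <;> simp [sg]
    exact this _
  h_eq_zero_iff := tangentForm_eq_zero_iff
  exists_edge w i hw hi hne := by
    refine exists_edge_of_tangentForm_eq_zero hw hi fun v s hs h => ?_
    -- On each axis ray some form other than that of `i` vanishes, so the hypothesis keeps `w` off
    -- the axes.
    have hex : ∀ (j : Fin 3) (s : Fin 2) (i : Fin 4), ∃ k, k ≠ i ∧ tetra k j = s + 1 := by decide
    obtain ⟨k, hki, hk⟩ := hex v.1 v.2 i
    refine hne k hki ?_
    rw [h, tangentForm_smul _ _ hs]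
    have := tangentForm_axis hk
    rw [show (v.1, v.2) = v from rfl] at this
    rw [this, mul_zero]
  edge_unique w e e' := tangent_edge_unique
  vertex_iff w hw := by
    constructor
    · rintro ⟨i, i', hne, h, h'⟩
      exact eq_axis_of_tangentForm_eq_zero hne hw h h'
    · rintro ⟨⟨j, u⟩, s, hs, rfl⟩
      have hex : ∀ (j : Fin 3) (s : Fin 2), ∃ i k, i ≠ k ∧ tetra i j = s + 1 ∧
        tetra k j = s + 1 := by decide
      obtain ⟨i, k, hik, hi, hk⟩ := hex j u
      refine ⟨i, k, hik, ?_, ?_⟩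
      · rw [tangentForm_smul _ _ hs, tangentForm_axis hi, mul_zero]
      · rw [tangentForm_smul _ _ hs, tangentForm_axis hk, mul_zero]
  pos e := .inr (gapIndex e)
  neg e := .inl (capIndex e)
  h_pos e w hw := hw.1 _
  h_neg e w hw := hw
  sides e w h0 hw := by
    -- On an edge the other three forms are strictly positive and all coordinate signs are those of
    -- the gap. Both conditions are open, so nearby only the sign of the form of the edge decides
    -- the cell.
    have hother : ∀ i, i ≠ capIndex e → 0 < tangentForm i w := by
      intro i hi
      refine lt_of_le_of_ne ?_ fun h => ?_
      · linarith [tangentForm_add_nonneg hi w]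
      · obtain ⟨v, s, -, hv⟩ := eq_axis_of_tangentForm_eq_zero hi
          (by rintro rfl; simpa using hw.1) h.symm h0
        exact ne_smul_axis_of_mem_quadrant hw v s hv
    have hwj : 0 < sg (e.2.1 + e.2.2) * w e.1 := by
      have := (tangentForm_eq_zero_iff e _ _ hw.1 hw.2 w
        (by rw [mul_comm, ← mul_assoc, sg_mul_self, one_mul])
        (by rw [mul_comm, ← mul_assoc, sg_mul_self, one_mul])).1 h0
      rw [this, ← mul_assoc, sg_mul_self, one_mul]
      exact div_pos (mul_pos hw.1 hw.2) (add_pos hw.1 hw.2)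
    have hort : w ∈ orthant (tetra (gapIndex e)) := by
      rw [tetra_gapIndex]
      exact (mem_orthant_iff e _ w).2 ⟨hw, hwj⟩
    have hev : ∀ᶠ z in 𝓝 w, ∀ i, i ≠ capIndex e → 0 < tangentForm i z :=
      eventually_all.2 fun i => by
        by_cases hi : i = capIndex e
        · exact Eventually.of_forall fun z h => absurd hi h
        · filter_upwards [(continuous_tangentForm i).continuousAt.eventually
            (lt_mem_nhds (hother i hi))] with z hz _ using hz
    filter_upwards [hev, (isOpen_orthant _).mem_nhds hort] with z hz hz'
    refine ⟨fun h => ⟨fun i => ?_, hz'⟩, fun h => h⟩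
    by_cases hi : i = capIndex e
    · rw [hi]; exact h
    · exact hz i hi

/-! ### Powers with respect to three circles as coordinates -/

/-- The power of a point with respect to a circle. -/
noncomputable def power (C : EuclideanGeometry.Sphere Plane) (x : Plane) : ℝ :=
  ‖x - C.center‖ ^ 2 - C.radius ^ 2

theorem mem_iff_power_eq_zero {C : EuclideanGeometry.Sphere Plane} (hC : 0 < C.radius) (x : Plane) :
    x ∈ C ↔ power C x = 0 := by
  rw [EuclideanGeometry.mem_sphere, dist_eq_norm, power, sub_eq_zero,
    sq_eq_sq₀ (norm_nonneg _) hC.le]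

theorem mem_inside_iff_power_neg {C : EuclideanGeometry.Sphere Plane} (hC : 0 < C.radius)
    (x : Plane) : x ∈ CircleSystem.inside C ↔ power C x < 0 := by
  rw [CircleSystem.inside, Metric.mem_ball, dist_eq_norm, power, sub_neg,
    sq_lt_sq₀ (norm_nonneg _) hC.le]

/-- The linear map that turns the coordinates of a stereographic projection into powers with respect
to three circles. -/
noncomputable def powerMap (d : Fin 3 → Plane) : Plane × ℝ →ₗ[ℝ] Space where
  toFun p := WithLp.toLp 2 fun i => p.2 - 2 * ⟪p.1, d i⟫
  map_add' p p' := by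
    ext i
    simp only [Prod.fst_add, Prod.snd_add, inner_add_left, PiLp.add_apply]
    ring
  map_smul' s p := by
    ext i
    simp only [Prod.smul_fst, Prod.smul_snd, real_inner_smul_left, PiLp.smul_apply, smul_eq_mul,
      RingHom.id_apply]
    ring

theorem powerMap_apply (d : Fin 3 → Plane) (p : Plane × ℝ) (i : Fin 3) :
    powerMap d p i = p.2 - 2 * ⟪p.1, d i⟫ := rfl

/-- The map `powerMap` is bijective if the three points do not lie on a line. -/
noncomputable def powerEquiv (d : Fin 3 → Plane) (hd : ∀ v : Plane, (∀ i j, ⟪v, d i - d j⟫ = 0) →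
    v = 0) : (Plane × ℝ) ≃ₗ[ℝ] Space :=
  LinearEquiv.ofInjectiveOfFinrankEq (powerMap d) (by
    rw [← LinearMap.ker_eq_bot, LinearMap.ker_eq_bot']
    rintro ⟨v, t⟩ h
    have hi : ∀ i, t - 2 * ⟪v, d i⟫ = 0 := fun i => by
      have := congrArg (fun w : Space => w i) h
      simpa [powerMap_apply] using this
    have hv : v = 0 := hd v fun i j => by
      rw [inner_sub_right]; linarith [hi i, hi j]
    have ht := hi 0
    rw [hv, inner_zero_left] at ht
    rw [hv, show t = 0 by linarith]
    rfl) (by simp)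

/-- The vertical ray is the point at infinity of the paraboloid. The zero vector counts as lying on
it, which is why `t < 0` is strict. -/
theorem not_sameRay_vertical_iff (v : Plane) (t : ℝ) :
    ¬ SameRay ℝ (v, t) ((0, 1) : Plane × ℝ) ↔ v ≠ 0 ∨ t < 0 := by
  rw [← not_iff_not, not_not]
  push Not
  constructor
  · intro h
    by_cases h0 : (v, t) = 0
    · simp only [Prod.mk_eq_zero] at h0
      exact ⟨h0.1, h0.2.ge⟩
    · obtain ⟨r, hr, h⟩ := h.exists_pos_right h0 (by simp)
      simp only [Prod.smul_mk, smul_zero, smul_eq_mul, mul_one, Prod.mk.injEq] at h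
      exact ⟨h.1, h.2 ▸ hr.le⟩
  · rintro ⟨rfl, ht⟩
    have : ((0, t) : Plane × ℝ) = t • ((0, 1) : Plane × ℝ) := by simp
    rw [this]
    exact SameRay.sameRay_nonneg_smul_left _ ht

/-- The inverse of a stereographic projection. -/
noncomputable def stereoInv (κ : ℝ) (p : Plane × ℝ) : Plane :=
  (2 * κ / (√(p.2 ^ 2 + 4 * κ * ‖p.1‖ ^ 2) - p.2)) • p.1

theorem stereo_denom_pos {κ : ℝ} (hκ : 0 < κ) {v : Plane} {t : ℝ} (h : v ≠ 0 ∨ t < 0) :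
    0 < √(t ^ 2 + 4 * κ * ‖v‖ ^ 2) - t := by
  rw [sub_pos]
  rcases h with h | h
  · have : 0 < ‖v‖ := norm_pos_iff.2 h
    exact Real.lt_sqrt_of_sq_lt (by nlinarith [mul_pos hκ (pow_pos this 2)])
  · exact h.trans_le (Real.sqrt_nonneg _)

theorem stereoInv_smul {κ : ℝ} (p : Plane × ℝ) {s : ℝ} (hs : 0 < s) :
    stereoInv κ (s • p) = stereoInv κ p := by
  obtain ⟨v, t⟩ := p
  simp only [stereoInv, Prod.smul_mk, smul_eq_mul, norm_smul, Real.norm_of_nonneg hs.le, smul_smul]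
  have h1 : (s * t) ^ 2 + 4 * κ * (s * ‖v‖) ^ 2 = s ^ 2 * (t ^ 2 + 4 * κ * ‖v‖ ^ 2) := by ring
  rw [h1, Real.sqrt_mul (sq_nonneg s), Real.sqrt_sq hs.le, ← mul_sub]
  congr 1
  rw [div_mul_eq_mul_div, mul_comm (2 * κ) s, mul_div_mul_left _ _ hs.ne']

/-- The ray of `(v, t)` meets the paraboloid of the points `(u, ‖u‖ ^ 2 - κ)` where `s ^ 2 * ‖v‖ ^ 2
- s * t - κ = 0`. The factor `s` is the positive root, written with the square root in the
denominator so that `v = 0` is allowed. -/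
theorem stereoInv_spec {κ : ℝ} (hκ : 0 < κ) {v : Plane} {t : ℝ} (h : v ≠ 0 ∨ t < 0) :
    ∃ s : ℝ, 0 < s ∧ stereoInv κ (v, t) = s • v ∧ ‖stereoInv κ (v, t)‖ ^ 2 - κ = s * t := by
  have hD := stereo_denom_pos hκ h
  have hsq : (√(t ^ 2 + 4 * κ * ‖v‖ ^ 2)) ^ 2 = t ^ 2 + 4 * κ * ‖v‖ ^ 2 :=
    Real.sq_sqrt (by positivity)
  refine ⟨2 * κ / (√(t ^ 2 + 4 * κ * ‖v‖ ^ 2) - t), by positivity, rfl, ?_⟩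
  simp only [stereoInv, norm_smul, mul_pow, Real.norm_eq_abs, sq_abs]
  set D := √(t ^ 2 + 4 * κ * ‖v‖ ^ 2)
  have hD' : D - t ≠ 0 := hD.ne'
  field_simp
  nlinarith

/-- The chart given by the powers with respect to three circles for which the point `q` has the
power `-κ`. -/
noncomputable def crossingChart (q : Plane) {κ : ℝ} (hκ : 0 < κ) (d : Fin 3 → Plane)
    (hd : ∀ v : Plane, (∀ i j, ⟪v, d i - d j⟫ = 0) → v = 0) : SphereChart where
  toFun x := powerEquiv d hd (x - q, ‖x - q‖ ^ 2 - κ)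
  inv w := q + stereoInv κ ((powerEquiv d hd).symm w)
  pole := powerEquiv d hd (0, 1)
  pole_ne := by simp
  cont := (powerEquiv d hd).toContinuousLinearEquiv.continuous.comp (by fun_prop)
  cont_inv := by
    refine continuousOn_const.add ?_
    have hc : Continuous fun w => (powerEquiv d hd).symm w :=
      (powerEquiv d hd).symm.toContinuousLinearEquiv.continuous
    have h1 : Continuous fun w => ((powerEquiv d hd).symm w).1 := hc.fst
    have h2 : Continuous fun w => ((powerEquiv d hd).symm w).2 := hc.snd
    have h3 : Continuous fun w => √(((powerEquiv d hd).symm w).2 ^ 2 +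
        4 * κ * ‖((powerEquiv d hd).symm w).1‖ ^ 2) - ((powerEquiv d hd).symm w).2 := by fun_prop
    refine ContinuousOn.smul (continuousOn_const.div h3.continuousOn ?_) h1.continuousOn
    intro w hw
    replace hw : ¬ SameRay ℝ w (powerEquiv d hd (0, 1)) := hw
    obtain ⟨⟨v, t⟩, rfl⟩ := (powerEquiv d hd).surjective w
    rw [SameRay.sameRay_map_iff, not_sameRay_vertical_iff] at hw
    rw [LinearEquiv.symm_apply_apply]
    exact (stereo_denom_pos hκ hw).ne'
  not_sameRay x := by
    rw [SameRay.sameRay_map_iff, not_sameRay_vertical_iff]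
    by_cases h : x - q = 0
    · right; simpa [h] using hκ
    · exact Or.inl h
  inv_toFun x := by
    rw [LinearEquiv.symm_apply_apply]
    simp only [stereoInv]
    have h1 : (‖x - q‖ ^ 2 - κ) ^ 2 + 4 * κ * ‖x - q‖ ^ 2 = (‖x - q‖ ^ 2 + κ) ^ 2 := by ring
    rw [h1, Real.sqrt_sq (by positivity)]
    have h2 : ‖x - q‖ ^ 2 + κ - (‖x - q‖ ^ 2 - κ) = 2 * κ := by ring
    rw [h2, div_self (by positivity), one_smul, add_sub_cancel]
  inv_smul w s hs := by rw [map_smul, stereoInv_smul _ hs]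
  toFun_inv w hw := by
    obtain ⟨⟨v, t⟩, rfl⟩ := (powerEquiv d hd).surjective w
    rw [SameRay.sameRay_map_iff, not_sameRay_vertical_iff] at hw
    obtain ⟨s, hs, h1, h2⟩ := stereoInv_spec hκ hw
    refine ⟨s, hs, ?_⟩
    rw [LinearEquiv.symm_apply_apply, add_sub_cancel_left, h2, h1, ← map_smul]
    rfl

/-- Expanding the power around `q` gives `‖x - q‖ ^ 2 - 2 * ⟪x - q, (C i).center - q⟫` plus the
power of `q`. As `q` has equal powers, one constant `κ` serves all three circles. -/
theorem crossingChart_apply {q : Plane} {κ : ℝ} (hκ : 0 < κ)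
    {C : Fin 3 → EuclideanGeometry.Sphere Plane} (hq : ∀ i, power (C i) q = -κ)
    (hd : ∀ v : Plane, (∀ i j, ⟪v, ((C i).center - q) - ((C j).center - q)⟫ = 0) → v = 0)
    (x : Plane) (i : Fin 3) :
    (crossingChart q hκ (fun i => (C i).center - q) hd).toFun x i = power (C i) x := by
  change ‖x - q‖ ^ 2 - κ - 2 * ⟪x - q, (C i).center - q⟫ = power (C i) x
  have h := hq i
  have h1 : x - (C i).center = (x - q) - ((C i).center - q) := by abel
  unfold power at h ⊢
  rw [h1, norm_sub_sq_real (x - q)]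
  rw [norm_sub_rev] at h
  linarith

/-- Three circles in general position with a point in the interior of all of them that has the same
power with respect to each are described by the fan of the coordinate planes. -/
theorem crossingFan_represents {S : CircleSystem} {C : Fin 3 → EuclideanGeometry.Sphere Plane}
    (hinj : Function.Injective C) (hS : ∀ D, D ∈ S.circles ↔ ∃ i, C i = D) {q : Plane} {κ : ℝ}
    (hκ : 0 < κ) (hq : ∀ i, power (C i) q = -κ)
    (hd : ∀ v : Plane, (∀ i j, ⟪v, ((C i).center - q) - ((C j).center - q)⟫ = 0) → v = 0) :
    crossingFan.Represents (crossingChart q hκ (fun i => (C i).center - q) hd) S C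
      (fun _ => false) where
  injective := hinj
  mem_circles := hS
  mem_iff i x := by
    rw [mem_iff_power_eq_zero (S.radius_pos _ ((hS _).2 ⟨i, rfl⟩))]
    change _ ↔ (crossingChart q hκ (fun i => (C i).center - q) hd).toFun x i = 0
    rw [crossingChart_apply hκ hq hd]
  mem_inside_iff i x := by
    rw [mem_inside_iff_power_neg (S.radius_pos _ ((hS _).2 ⟨i, rfl⟩))]
    change _ ↔ (crossingChart q hκ (fun i => (C i).center - q) hd).toFun x i < 0
    rw [crossingChart_apply hκ hq hd]
  h_pole i := by
    change (1 : ℝ) - 2 * ⟪(0 : Plane), _⟫ ≠ 0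
    simp

/-! ### Descartes' form and the chart for four touching circles -/

/-- The coefficients of the oriented powers divided by the radii with respect to the circles with
centers `c i` and signed radii `R i`, as linear forms in the quantities `x₀`, `x₁`, `‖x‖ ^ 2`
and `1`. -/
noncomputable def soddyMatrix (c : Fin 4 → Plane) (R : Fin 4 → ℝ) : Matrix (Fin 4) (Fin 4) ℝ :=
  Matrix.of fun i => ![-2 * c i 0 / R i, -2 * c i 1 / R i, 1 / R i,
    (c i 0 ^ 2 + c i 1 ^ 2 - R i ^ 2) / R i]

/-- The matrix dual to the form `x₀ ^ 2 + x₁ ^ 2 - x₂ * x₃`. -/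
def paraboloidDual : Matrix (Fin 4) (Fin 4) ℝ :=
  !![1, 0, 0, 0; 0, 1, 0, 0; 0, 0, 0, -2; 0, 0, -2, 0]

/-- The matrix of the form `2 * ∑ yᵢ ^ 2 - (∑ yᵢ) ^ 2`, divided by `16`. -/
noncomputable def soddyForm : Matrix (Fin 4) (Fin 4) ℝ :=
  Matrix.of fun i j => if i = j then 1 / 16 else -1 / 16

theorem norm_sub_sq_plane (x y : Plane) : ‖x - y‖ ^ 2 = (x 0 - y 0) ^ 2 + (x 1 - y 1) ^ 2 := by
  rw [EuclideanSpace.norm_sq_eq, Fin.sum_univ_two]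
  simp

section

variable {c : Fin 4 → Plane} {R : Fin 4 → ℝ}

/-- The Lorentz product of two circles depends only on the radii and the distance of the centers;
signed tangency makes it `-4` for every pair. -/
theorem soddyMatrix_gram (hR : ∀ i, R i ≠ 0)
    (hc : ∀ i j, i ≠ j → ‖c i - c j‖ ^ 2 = (R i + R j) ^ 2) :
    soddyMatrix c R * paraboloidDual * (soddyMatrix c R)ᵀ =
      Matrix.of fun i j => if i = j then 4 else -4 := by
  ext i j
  have hi := hR i
  have hj := hR j
  have e : (soddyMatrix c R * paraboloidDual * (soddyMatrix c R)ᵀ) i j =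
      (2 * R i ^ 2 + 2 * R j ^ 2 - 2 * ‖c i - c j‖ ^ 2) / (R i * R j) := by
    simp only [Matrix.mul_apply, Fin.sum_univ_four, Matrix.transpose_apply, soddyMatrix,
      paraboloidDual, Matrix.of_apply, norm_sub_sq_plane]
    simp
    field_simp
    ring
  rw [e, Matrix.of_apply]
  split_ifs with h
  · subst h
    simp only [sub_self, norm_zero]
    field_simp
    ring
  · rw [hc i j h]
    field_simp
    ring

theorem soddyForm_mul_gram :
    soddyForm * (Matrix.of fun i j : Fin 4 => if i = j then (4 : ℝ) else -4) = 1 := by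
  ext i j
  simp only [Matrix.mul_apply, Fin.sum_univ_four, soddyForm, Matrix.of_apply, Matrix.one_apply]
  fin_cases i <;> fin_cases j <;> norm_num [Fin.ext_iff]

/-- `soddyForm` inverts the Gram matrix, and a one-sided inverse of a square matrix may be rotated
to the other side. -/
theorem soddyMatrix_transpose_mul (hR : ∀ i, R i ≠ 0)
    (hc : ∀ i j, i ≠ j → ‖c i - c j‖ ^ 2 = (R i + R j) ^ 2) :
    (soddyMatrix c R)ᵀ * (soddyForm * soddyMatrix c R * paraboloidDual) = 1 := by
  rw [mul_eq_one_comm, Matrix.mul_assoc, Matrix.mul_assoc, ← Matrix.mul_assoc (soddyMatrix c R),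
    soddyMatrix_gram hR hc, soddyForm_mul_gram]

theorem soddyMatrix_isUnit (hR : ∀ i, R i ≠ 0)
    (hc : ∀ i j, i ≠ j → ‖c i - c j‖ ^ 2 = (R i + R j) ^ 2) : IsUnit (soddyMatrix c R).det := by
  rw [← Matrix.det_transpose]
  exact Matrix.isUnit_det_of_right_inverse (soddyMatrix_transpose_mul hR hc)

/-- The form `2 * ∑ yᵢ ^ 2 - (∑ yᵢ) ^ 2`, which vanishes on the curvatures of four mutually touching
circles. -/
def descartesForm (y : Fin 4 → ℝ) : ℝ := 2 * ∑ i, y i ^ 2 - (∑ i, y i) ^ 2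

/-- Inverting the Gram identity carries Descartes' form to the form of the paraboloid. Applied to
points of the paraboloid it gives the relation between the four powers; applied to the point at
infinity it is Descartes' theorem on curvatures. -/
theorem descartesForm_mulVec (hR : ∀ i, R i ≠ 0)
    (hc : ∀ i j, i ≠ j → ‖c i - c j‖ ^ 2 = (R i + R j) ^ 2) (X : Fin 4 → ℝ) :
    descartesForm (soddyMatrix c R *ᵥ X) = 16 * (X 0 ^ 2 + X 1 ^ 2 - X 2 * X 3) := by
  let N : Matrix (Fin 4) (Fin 4) ℝ :=
    !![1, 0, 0, 0; 0, 1, 0, 0; 0, 0, 0, -1 / 2; 0, 0, -1 / 2, 0]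
  have hN : paraboloidDual * N = 1 := by
    ext i j
    simp only [Matrix.mul_apply, Fin.sum_univ_four, paraboloidDual, N, Matrix.one_apply]
    fin_cases i <;> fin_cases j <;> simp <;> norm_num
  have h1 : (soddyMatrix c R)ᵀ * soddyForm * soddyMatrix c R = N := by
    have := congrArg (· * N) (soddyMatrix_transpose_mul hR hc)
    simp only [one_mul] at this
    rw [Matrix.mul_assoc, Matrix.mul_assoc, hN, Matrix.mul_one, ← Matrix.mul_assoc] at this
    exact this
  have h2 : (soddyMatrix c R *ᵥ X) ⬝ᵥ (soddyForm *ᵥ (soddyMatrix c R *ᵥ X)) = X ⬝ᵥ (N *ᵥ X) := by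
    rw [← h1, ← Matrix.mulVec_mulVec, ← Matrix.mulVec_mulVec, Matrix.dotProduct_mulVec X,
      Matrix.vecMul_transpose]
  have h3 : X ⬝ᵥ (N *ᵥ X) = X 0 ^ 2 + X 1 ^ 2 - X 2 * X 3 := by
    simp only [dotProduct, Matrix.mulVec, Fin.sum_univ_four, N]
    simp
    ring
  have h4 : ∀ y : Fin 4 → ℝ, y ⬝ᵥ (soddyForm *ᵥ y) = descartesForm y / 16 := by
    intro y
    simp only [dotProduct, Matrix.mulVec, Fin.sum_univ_four, soddyForm, descartesForm,
      Matrix.of_apply]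
    simp
    ring
  rw [h4, h3] at h2
  linarith

/-- The point of three-space whose tangent forms are the given four numbers. -/
noncomputable def soddyPoint (y : Fin 4 → ℝ) : Space :=
  WithLp.toLp 2 fun j => (∑ k, sg (tetra k j) * y k) / 4

/-- With `n` a quarter of the sum of the entries, Descartes' form equals `8 * (‖soddyPoint y‖ ^ 2 -
n ^ 2)`: its zeros form a light cone, and the sign of the sum selects the nappe. -/
theorem norm_soddyPoint {y : Fin 4 → ℝ} (h0 : descartesForm y = 0) (h : 0 ≤ ∑ i, y i) :
    ‖soddyPoint y‖ = (∑ i, y i) / 4 := by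
  refine (sq_eq_sq₀ (norm_nonneg _) (by positivity)).1 ?_
  rw [norm_sq_space _ 0]
  simp only [soddyPoint, descartesForm, Fin.sum_univ_four] at h0 ⊢
  simp [tetra, sg]
  nlinarith

theorem tangentForm_soddyPoint {y : Fin 4 → ℝ} (h0 : descartesForm y = 0) (h : 0 ≤ ∑ i, y i)
    (k : Fin 4) : tangentForm k (soddyPoint y) = y k := by
  rw [tangentForm, norm_soddyPoint h0 h]
  simp only [soddyPoint, Fin.sum_univ_four, Fin.sum_univ_three]
  fin_cases k <;> simp [tetra, sg] <;> ring

theorem soddyPoint_tangentForm (w : Space) : soddyPoint (fun k => tangentForm k w) = w := by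
  ext j
  simp only [soddyPoint, tangentForm, Fin.sum_univ_four, Fin.sum_univ_three]
  fin_cases j <;> simp [tetra, sg] <;> ring

theorem sum_tangentForm (w : Space) : ∑ k, tangentForm k w = 4 * ‖w‖ := by
  simp only [tangentForm, Fin.sum_univ_four, Fin.sum_univ_three]
  simp [tetra, sg]
  ring

theorem descartesForm_tangentForm (w : Space) : descartesForm (fun k => tangentForm k w) = 0 := by
  rw [descartesForm, sum_tangentForm]
  have h := norm_sq_space w 0
  simp only [tangentForm, Fin.sum_univ_four, Fin.sum_univ_three]
  simp [tetra, sg] at h ⊢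
  nlinarith

theorem soddyPoint_smul (s : ℝ) (y : Fin 4 → ℝ) : soddyPoint (s • y) = s • soddyPoint y := by
  ext j
  simp only [soddyPoint, PiLp.smul_apply, Pi.smul_apply, smul_eq_mul, Fin.sum_univ_four]
  ring

theorem continuous_soddyPoint : Continuous soddyPoint := by
  unfold soddyPoint
  fun_prop

/-- A point of the plane as a point on a paraboloid, in homogeneous coordinates. -/
noncomputable def paraboloidPoint (x : Plane) : Fin 4 → ℝ := ![x 0, x 1, x 0 ^ 2 + x 1 ^ 2, 1]

/-- The oriented powers of a point, divided by the signed radii. -/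
noncomputable def soddyCoord (c : Fin 4 → Plane) (R : Fin 4 → ℝ) (x : Plane) : Fin 4 → ℝ :=
  soddyMatrix c R *ᵥ paraboloidPoint x

theorem soddyCoord_apply (x : Plane) (i : Fin 4) :
    soddyCoord c R x i = (‖x - c i‖ ^ 2 - R i ^ 2) / R i := by
  rw [norm_sub_sq_plane]
  simp only [soddyCoord, paraboloidPoint, Matrix.mulVec, dotProduct, Fin.sum_univ_four, soddyMatrix,
    Matrix.of_apply]
  simp
  ring

theorem continuous_soddyCoord : Continuous (soddyCoord c R) := by
  refine continuous_pi fun i => ?_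
  simp only [soddyCoord_apply]
  fun_prop

theorem soddyMatrix_mulVec_single : soddyMatrix c R *ᵥ ![0, 0, 1, 0] = fun i => (R i)⁻¹ := by
  ext i
  simp [Matrix.mulVec, dotProduct, Fin.sum_univ_four, soddyMatrix]

theorem descartesForm_soddyCoord (hR : ∀ i, R i ≠ 0)
    (hc : ∀ i j, i ≠ j → ‖c i - c j‖ ^ 2 = (R i + R j) ^ 2) (x : Plane) :
    descartesForm (soddyCoord c R x) = 0 := by
  rw [soddyCoord, descartesForm_mulVec hR hc]
  simp [paraboloidPoint]

theorem descartesForm_curvature (hR : ∀ i, R i ≠ 0)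
    (hc : ∀ i j, i ≠ j → ‖c i - c j‖ ^ 2 = (R i + R j) ^ 2) :
    descartesForm (fun i => (R i)⁻¹) = 0 := by
  rw [← soddyMatrix_mulVec_single (c := c), descartesForm_mulVec hR hc]
  simp

/-- Finite points and infinity lie on the same nappe. Writing `σ` and `β` for the sums of the
coordinates and of the curvatures, the value of the form at the sum of these two null vectors gives
`2 * ∑ i, y i * b i = σ * β - 8`. Cauchy's inequality bounds the left side by `|σ * β|`, so `σ * β`
is positive. -/
theorem sum_soddyCoord_pos (hR : ∀ i, R i ≠ 0)
    (hc : ∀ i j, i ≠ j → ‖c i - c j‖ ^ 2 = (R i + R j) ^ 2) (hpos : 0 < ∑ i, (R i)⁻¹) (x : Plane) :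
    0 < ∑ i, soddyCoord c R x i := by
  have h1 := descartesForm_soddyCoord hR hc x
  have h2 := descartesForm_curvature hR hc
  have h3 := descartesForm_mulVec hR hc (paraboloidPoint x + ![0, 0, 1, 0])
  rw [Matrix.mulVec_add, soddyMatrix_mulVec_single] at h3
  change descartesForm (soddyCoord c R x + _) = _ at h3
  set y := soddyCoord c R x
  set b : Fin 4 → ℝ := fun i => (R i)⁻¹
  have h4 : ∀ X : Fin 4 → ℝ, X = paraboloidPoint x + ![0, 0, 1, 0] →
      X 0 ^ 2 + X 1 ^ 2 - X 2 * X 3 = -1 := by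
    rintro X rfl
    simp [paraboloidPoint]
  rw [h4 _ rfl] at h3
  have h5 : descartesForm (y + b) = descartesForm y + descartesForm b +
      4 * (∑ i, y i * b i) - 2 * (∑ i, y i) * ∑ i, b i := by
    simp only [descartesForm, Fin.sum_univ_four, Pi.add_apply]
    ring
  rw [h5, h1, h2] at h3
  have h6 := Finset.sum_mul_sq_le_sq_mul_sq Finset.univ y b
  simp only [descartesForm] at h1 h2
  by_contra! hle
  set σ := ∑ i, y i
  set β := ∑ i, b i
  set T := ∑ i, y i * b i
  have h7 : 2 * T = σ * β - 8 := by linarith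
  have h8 : (2 * T) ^ 2 ≤ σ ^ 2 * β ^ 2 := by
    have e1 : ∑ i, y i ^ 2 = σ ^ 2 / 2 := by linarith
    have e2 : ∑ i, b i ^ 2 = β ^ 2 / 2 := by linarith
    rw [e1, e2] at h6
    nlinarith
  rw [h7] at h8
  nlinarith [mul_nonneg (neg_nonneg.2 hle) hpos.le]

/-- Homogeneous coordinates of the point of the paraboloid with given tangent forms. -/
noncomputable def paraboloidCoord (c : Fin 4 → Plane) (R : Fin 4 → ℝ) (w : Space) : Fin 4 → ℝ :=
  (soddyMatrix c R)⁻¹ *ᵥ fun k => tangentForm k w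

/-- The point of the plane with given homogeneous coordinates on the paraboloid. -/
noncomputable def planePoint (X : Fin 4 → ℝ) : Plane := !₂[X 0 / X 3, X 1 / X 3]

theorem planePoint_smul (X : Fin 4 → ℝ) {s : ℝ} (hs : 0 < s) :
    planePoint (s • X) = planePoint X := by
  simp only [planePoint, Pi.smul_apply, smul_eq_mul, mul_div_mul_left _ _ hs.ne']

theorem planePoint_paraboloidPoint (x : Plane) : planePoint (paraboloidPoint x) = x := by
  ext i
  fin_cases i <;> simp [planePoint, paraboloidPoint]

theorem smul_paraboloidPoint_planePoint {X : Fin 4 → ℝ} (h3 : X 3 ≠ 0)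
    (h : X 0 ^ 2 + X 1 ^ 2 = X 2 * X 3) : X 3 • paraboloidPoint (planePoint X) = X := by
  ext i
  fin_cases i
  · simp [planePoint, paraboloidPoint, mul_div_cancel₀ _ h3]
  · simp [planePoint, paraboloidPoint, mul_div_cancel₀ _ h3]
  · simp only [planePoint, paraboloidPoint]
    simp
    field_simp
    linarith
  · simp [paraboloidPoint]

theorem paraboloidCoord_smul (w : Space) {s : ℝ} (hs : 0 < s) :
    paraboloidCoord c R (s • w) = s • paraboloidCoord c R w := by
  rw [paraboloidCoord, paraboloidCoord, ← Matrix.mulVec_smul]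
  congr 1
  ext k
  rw [tangentForm_smul k w hs]
  rfl

theorem continuous_paraboloidCoord : Continuous (paraboloidCoord c R) :=
  continuous_const.matrix_mulVec (continuous_pi fun k => continuous_tangentForm k)

theorem soddyMatrix_mulVec_paraboloidCoord (hR : ∀ i, R i ≠ 0)
    (hc : ∀ i j, i ≠ j → ‖c i - c j‖ ^ 2 = (R i + R j) ^ 2) (w : Space) :
    soddyMatrix c R *ᵥ paraboloidCoord c R w = fun k => tangentForm k w := by
  rw [paraboloidCoord, Matrix.mulVec_mulVec, Matrix.mul_nonsing_inv _ (soddyMatrix_isUnit hR hc),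
    Matrix.one_mulVec]

theorem paraboloidCoord_sq (hR : ∀ i, R i ≠ 0)
    (hc : ∀ i j, i ≠ j → ‖c i - c j‖ ^ 2 = (R i + R j) ^ 2) (w : Space) :
    paraboloidCoord c R w 0 ^ 2 + paraboloidCoord c R w 1 ^ 2 =
      paraboloidCoord c R w 2 * paraboloidCoord c R w 3 := by
  have h := descartesForm_mulVec hR hc (paraboloidCoord c R w)
  rw [soddyMatrix_mulVec_paraboloidCoord hR hc, descartesForm_tangentForm] at h
  linarith

theorem tangentForm_eq_smul_soddyCoord (hR : ∀ i, R i ≠ 0)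
    (hc : ∀ i j, i ≠ j → ‖c i - c j‖ ^ 2 = (R i + R j) ^ 2) {w : Space}
    (h3 : paraboloidCoord c R w 3 ≠ 0) : (fun k => tangentForm k w) =
      paraboloidCoord c R w 3 • soddyCoord c R (planePoint (paraboloidCoord c R w)) := by
  rw [soddyCoord, ← Matrix.mulVec_smul,
    smul_paraboloidPoint_planePoint h3 (paraboloidCoord_sq hR hc w),
    soddyMatrix_mulVec_paraboloidCoord hR hc]

/-- The forms of `w` sum to `4 * ‖w‖ > 0`. A negative last coordinate would make that sum negative
by `sum_soddyCoord_pos`; a zero one leaves only the point at infinity, on the ray of the pole. -/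
theorem paraboloidCoord_three_pos (hR : ∀ i, R i ≠ 0)
    (hc : ∀ i j, i ≠ j → ‖c i - c j‖ ^ 2 = (R i + R j) ^ 2) (hpos : 0 < ∑ i, (R i)⁻¹) {w : Space}
    (hw : ¬ SameRay ℝ w (soddyPoint fun i => (R i)⁻¹)) : 0 < paraboloidCoord c R w 3 := by
  have hw0 : 0 < ‖w‖ := norm_pos_iff.2 fun h => hw (h ▸ SameRay.zero_left _)
  have hsum := sum_tangentForm w
  rcases lt_trichotomy (paraboloidCoord c R w 3) 0 with h | h | h
  · exfalso
    have h1 := tangentForm_eq_smul_soddyCoord hR hc h.ne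
    have h2 : ∑ k, tangentForm k w = paraboloidCoord c R w 3 *
        ∑ k, soddyCoord c R (planePoint (paraboloidCoord c R w)) k := by
      rw [Finset.mul_sum]
      exact Finset.sum_congr rfl fun k _ => congrFun h1 k
    have h3 := sum_soddyCoord_pos hR hc hpos (planePoint (paraboloidCoord c R w))
    nlinarith
  · exfalso
    have hsq := paraboloidCoord_sq hR hc w
    rw [h, mul_zero] at hsq
    have hz : ∀ a b : ℝ, a ^ 2 + b ^ 2 = 0 → a = 0 ∧ b = 0 := fun a b hab =>
      ⟨by nlinarith [sq_nonneg a, sq_nonneg b], by nlinarith [sq_nonneg a, sq_nonneg b]⟩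
    obtain ⟨h0, h1⟩ := hz _ _ hsq
    have hX : paraboloidCoord c R w = paraboloidCoord c R w 2 • ![0, 0, 1, 0] := by
      ext i
      fin_cases i
      · simpa using h0
      · simpa using h1
      · simp
      · simpa using h
    have h2 := soddyMatrix_mulVec_paraboloidCoord hR hc w
    rw [hX, Matrix.mulVec_smul, soddyMatrix_mulVec_single] at h2
    have h3 : w = paraboloidCoord c R w 2 • soddyPoint fun i => (R i)⁻¹ := by
      rw [← soddyPoint_smul, h2, soddyPoint_tangentForm]
    have h4 : ∑ k, tangentForm k w = paraboloidCoord c R w 2 * ∑ i, (R i)⁻¹ := by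
      rw [Finset.mul_sum]
      exact Finset.sum_congr rfl fun k _ => (congrFun h2 k).symm
    refine hw ?_
    rw [h3]
    refine SameRay.sameRay_nonneg_smul_left _ ?_
    by_contra! hneg
    nlinarith
  · exact h

theorem tangentForm_soddyPoint_soddyCoord (hR : ∀ i, R i ≠ 0)
    (hc : ∀ i j, i ≠ j → ‖c i - c j‖ ^ 2 = (R i + R j) ^ 2) (hpos : 0 < ∑ i, (R i)⁻¹)
    (x : Plane) (k : Fin 4) :
    tangentForm k (soddyPoint (soddyCoord c R x)) = soddyCoord c R x k :=
  tangentForm_soddyPoint (descartesForm_soddyCoord hR hc x)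
    (sum_soddyCoord_pos hR hc hpos x).le k

theorem paraboloidCoord_soddyPoint (hR : ∀ i, R i ≠ 0)
    (hc : ∀ i j, i ≠ j → ‖c i - c j‖ ^ 2 = (R i + R j) ^ 2) (hpos : 0 < ∑ i, (R i)⁻¹)
    (x : Plane) : paraboloidCoord c R (soddyPoint (soddyCoord c R x)) = paraboloidPoint x := by
  rw [paraboloidCoord]
  simp only [tangentForm_soddyPoint_soddyCoord hR hc hpos]
  change (soddyMatrix c R)⁻¹ *ᵥ (soddyMatrix c R *ᵥ paraboloidPoint x) = _
  rw [Matrix.mulVec_mulVec, Matrix.nonsing_inv_mul _ (soddyMatrix_isUnit hR hc),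
    Matrix.one_mulVec]

theorem paraboloidCoord_pole (hR : ∀ i, R i ≠ 0)
    (hc : ∀ i j, i ≠ j → ‖c i - c j‖ ^ 2 = (R i + R j) ^ 2) (hpos : 0 < ∑ i, (R i)⁻¹) :
    paraboloidCoord c R (soddyPoint fun i => (R i)⁻¹) = ![0, 0, 1, 0] := by
  rw [paraboloidCoord]
  simp only [tangentForm_soddyPoint (descartesForm_curvature hR hc) hpos.le]
  rw [← soddyMatrix_mulVec_single (c := c), Matrix.mulVec_mulVec,
    Matrix.nonsing_inv_mul _ (soddyMatrix_isUnit hR hc), Matrix.one_mulVec]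

theorem soddyPoint_curvature_ne_zero (hR : ∀ i, R i ≠ 0)
    (hc : ∀ i j, i ≠ j → ‖c i - c j‖ ^ 2 = (R i + R j) ^ 2) (hpos : 0 < ∑ i, (R i)⁻¹) :
    (soddyPoint fun i => (R i)⁻¹) ≠ 0 := fun h => by
  have := norm_soddyPoint (descartesForm_curvature hR hc) hpos.le
  rw [h, norm_zero] at this
  linarith

/-- The chart in which four mutually touching circles are described by the fan of a tetrahedron. -/
noncomputable def tangentChart (hR : ∀ i, R i ≠ 0)
    (hc : ∀ i j, i ≠ j → ‖c i - c j‖ ^ 2 = (R i + R j) ^ 2) (hpos : 0 < ∑ i, (R i)⁻¹) :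
    SphereChart where
  toFun x := soddyPoint (soddyCoord c R x)
  inv w := planePoint (paraboloidCoord c R w)
  pole := soddyPoint fun i => (R i)⁻¹
  pole_ne := soddyPoint_curvature_ne_zero hR hc hpos
  cont := continuous_soddyPoint.comp continuous_soddyCoord
  cont_inv := by
    have hX : ∀ i, Continuous fun w => paraboloidCoord c R w i := fun i =>
      (continuous_apply i).comp continuous_paraboloidCoord
    have hd : ∀ i, ContinuousOn (fun w => paraboloidCoord c R w i / paraboloidCoord c R w 3)
        {w | ¬ SameRay ℝ w (soddyPoint fun i => (R i)⁻¹)} := fun i =>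
      (hX i).continuousOn.div (hX 3).continuousOn fun w hw =>
        (paraboloidCoord_three_pos hR hc hpos hw).ne'
    refine (PiLp.continuous_toLp 2 _).comp_continuousOn (continuousOn_pi.2 fun i => ?_)
    fin_cases i
    · exact hd 0
    · exact hd 1
  not_sameRay x h := by
    have h3 := paraboloidCoord_soddyPoint hR hc hpos x
    have h0 : soddyPoint (soddyCoord c R x) ≠ 0 := fun h => by
      have := norm_soddyPoint (descartesForm_soddyCoord hR hc x)
        (sum_soddyCoord_pos hR hc hpos x).le
      rw [h, norm_zero] at this
      linarith [sum_soddyCoord_pos hR hc hpos x]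
    obtain ⟨r, hr, h⟩ := h.exists_pos_right h0 (soddyPoint_curvature_ne_zero hR hc hpos)
    rw [h, paraboloidCoord_smul _ hr, paraboloidCoord_pole hR hc hpos] at h3
    have := congrFun h3 3
    simp [paraboloidPoint] at this
  inv_toFun x := by
    rw [paraboloidCoord_soddyPoint hR hc hpos, planePoint_paraboloidPoint]
  inv_smul w s hs := by
    rw [paraboloidCoord_smul _ hs, planePoint_smul _ hs]
  toFun_inv w hw := by
    have h3 := paraboloidCoord_three_pos hR hc hpos hw
    refine ⟨(paraboloidCoord c R w 3)⁻¹, inv_pos.2 h3, ?_⟩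
    have h := congrArg soddyPoint (tangentForm_eq_smul_soddyCoord hR hc h3.ne')
    rw [soddyPoint_tangentForm, soddyPoint_smul] at h
    nth_rewrite 3 [h]
    rw [smul_smul, inv_mul_cancel₀ h3.ne', one_smul]

end

/-- Four mutually touching circles, the radii being counted negative for the circles that contain
the others, are described by the fan of a tetrahedron. -/
theorem tangentFan_represents {S : CircleSystem} {C : Fin 4 → EuclideanGeometry.Sphere Plane}
    (hinj : Function.Injective C) (hS : ∀ D, D ∈ S.circles ↔ ∃ i, C i = D) {R : Fin 4 → ℝ}
    (hR : ∀ i, R i ≠ 0) (hCR : ∀ i, (C i).radius = |R i|)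
    (hc : ∀ i j, i ≠ j → ‖(C i).center - (C j).center‖ ^ 2 = (R i + R j) ^ 2)
    (hpos : 0 < ∑ i, (R i)⁻¹) {flip : Fin 4 → Bool} (hflip : ∀ i, flip i = true ↔ R i < 0) :
    tangentFan.Represents (tangentChart (c := fun i => (C i).center) hR hc hpos) S C flip := by
  -- Dividing by a negative radius makes the form positive inside the circle, which is what `flip`
  -- records.
  have hY : ∀ x i, tangentForm i ((tangentChart (c := fun i => (C i).center) hR hc hpos).toFun x) =
      power (C i) x / R i := by
    intro x i
    refine (tangentForm_soddyPoint_soddyCoord hR hc hpos x i).trans ?_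
    rw [soddyCoord_apply, power, hCR, sq_abs]
  refine ⟨hinj, hS, fun i x => ?_, fun i x => ?_, fun i => ?_⟩
  · rw [mem_iff_power_eq_zero (S.radius_pos _ ((hS _).2 ⟨i, rfl⟩))]
    change _ ↔ tangentForm i _ = 0
    rw [hY, div_eq_zero_iff, or_iff_left (hR i)]
  · rw [mem_inside_iff_power_neg (S.radius_pos _ ((hS _).2 ⟨i, rfl⟩))]
    change _ ↔ if flip i = true then 0 < tangentForm i _ else tangentForm i _ < 0
    rw [hY]
    by_cases h : R i < 0
    · rw [if_pos ((hflip i).2 h), div_pos_iff]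
      exact ⟨fun h' => Or.inr ⟨h', h⟩, fun h' => by rcases h' with h' | h' <;> [linarith; exact h'.1]⟩
    · have h' : 0 < R i := lt_of_le_of_ne (not_lt.1 h) (hR i).symm
      rw [if_neg (fun hf => h ((hflip i).1 hf)), div_neg_iff]
      exact ⟨fun h'' => Or.inr ⟨h'', h'⟩,
        fun h'' => by rcases h'' with h'' | h'' <;> [linarith; exact h''.1]⟩
  · change tangentForm i (soddyPoint fun i => (R i)⁻¹) ≠ 0
    rw [tangentForm_soddyPoint (descartesForm_curvature hR hc) hpos.le]
    exact inv_ne_zero (hR i)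

/-! ### Arcs cut off by chords -/

/-- Twice the signed area of the triangle `p q x`. -/
noncomputable def orient (p q x : Plane) : ℝ :=
  (q 0 - p 0) * (x 1 - p 1) - (q 1 - p 1) * (x 0 - p 0)

theorem continuous_orient (p q : Plane) : Continuous (orient p q) := by
  unfold orient; fun_prop

theorem orient_swap (p q x : Plane) : orient q p x = - orient p q x := by
  unfold orient; ring

theorem plane_ext {x y : Plane} (h0 : x 0 = y 0) (h1 : x 1 = y 1) : x = y := by
  ext i; fin_cases i <;> assumption

theorem sq_add_sq_pos_of_ne {x y : Plane} (h : x ≠ y) : 0 < (x 0 - y 0) ^ 2 + (x 1 - y 1) ^ 2 := by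
  rw [← norm_sub_sq_plane]
  exact pow_pos (norm_pos_iff.2 (sub_ne_zero.2 h)) 2

/-- The inner product of `x - p` with the normal direction of the circle at its point `p`. -/
noncomputable def normalPart (C : EuclideanGeometry.Sphere Plane) (p x : Plane) : ℝ :=
  (C.center 0 - p 0) * (x 0 - p 0) + (C.center 1 - p 1) * (x 1 - p 1)

theorem mem_circle_iff {C : EuclideanGeometry.Sphere Plane} {p : Plane} (hp : p ∈ C) (x : Plane) :
    x ∈ C ↔ (x 0 - p 0) ^ 2 + (x 1 - p 1) ^ 2 = 2 * normalPart C p x := by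
  have hp2 : ‖p - C.center‖ ^ 2 = C.radius ^ 2 := by
    rw [← dist_eq_norm, EuclideanGeometry.mem_sphere.1 hp]
  have h0 : 0 ≤ C.radius := by rw [← EuclideanGeometry.mem_sphere.1 hp]; exact dist_nonneg
  rw [EuclideanGeometry.mem_sphere, dist_eq_norm, ← sq_eq_sq₀ (norm_nonneg _) h0, ← hp2,
    norm_sub_sq_plane, norm_sub_sq_plane, normalPart]
  constructor <;> intro h <;> linarith

theorem normalPart_pos {C : EuclideanGeometry.Sphere Plane} {p x : Plane} (hp : p ∈ C) (hx : x ∈ C)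
    (hxp : x ≠ p) : 0 < normalPart C p x := by
  have := (mem_circle_iff hp x).1 hx
  linarith [sq_add_sq_pos_of_ne hxp]

/-- The second intersection of the circle with the line through its point `p` and `u`. -/
noncomputable def secondPoint (C : EuclideanGeometry.Sphere Plane) (p u : Plane) : Plane :=
  p + (2 * normalPart C p u / ((u 0 - p 0) ^ 2 + (u 1 - p 1) ^ 2)) • (u - p)

theorem secondPoint_of_mem {C : EuclideanGeometry.Sphere Plane} {p x : Plane} (hp : p ∈ C)
    (hx : x ∈ C) (hxp : x ≠ p) : secondPoint C p x = x := by
  rw [secondPoint, ← (mem_circle_iff hp x).1 hx, div_self (sq_add_sq_pos_of_ne hxp).ne', one_smul,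
    add_sub_cancel]

theorem secondPoint_mem {C : EuclideanGeometry.Sphere Plane} {p u : Plane} (hp : p ∈ C)
    (hu : u ≠ p) : secondPoint C p u ∈ C := by
  have h := sq_add_sq_pos_of_ne hu
  rw [mem_circle_iff hp]
  simp only [secondPoint, normalPart, PiLp.add_apply, PiLp.smul_apply, PiLp.sub_apply, smul_eq_mul,
    add_sub_cancel_left]
  field_simp

theorem orient_secondPoint (C : EuclideanGeometry.Sphere Plane) (p q u : Plane) :
    orient p q (secondPoint C p u) =
      2 * normalPart C p u / ((u 0 - p 0) ^ 2 + (u 1 - p 1) ^ 2) * orient p q u := by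
  simp only [secondPoint, orient, PiLp.add_apply, PiLp.smul_apply, PiLp.sub_apply, smul_eq_mul,
    add_sub_cancel_left]
  ring

theorem continuousAt_secondPoint (C : EuclideanGeometry.Sphere Plane) {p u : Plane} (hu : u ≠ p) :
    ContinuousAt (secondPoint C p) u := by
  have hc : Continuous (normalPart C p) := by unfold normalPart; fun_prop
  have h2 : Continuous fun u : Plane => (u 0 - p 0) ^ 2 + (u 1 - p 1) ^ 2 := by fun_prop
  exact continuousAt_const.add (((continuous_const.mul hc).continuousAt.div h2.continuousAt
    (sq_add_sq_pos_of_ne hu).ne').smul (continuous_id.sub continuous_const).continuousAt)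

/-- A circle without one of its points is connected. -/
theorem isPreconnected_circle_diff_singleton {C : EuclideanGeometry.Sphere Plane} {p : Plane}
    (hp : p ∈ C) : IsPreconnected ((C : Set Plane) \ {p}) := by
  have hconv : Convex ℝ {u : Plane | 0 < normalPart C p u} := by
    intro u hu v hv a b ha hb hab
    replace hu : 0 < normalPart C p u := hu
    replace hv : 0 < normalPart C p v := hv
    have e : normalPart C p (a • u + b • v) = a * normalPart C p u + b * normalPart C p v := by
      simp only [normalPart, PiLp.add_apply, PiLp.smul_apply, smul_eq_mul]
      linear_combination (-(C.center 0 - p 0) * p 0 - (C.center 1 - p 1) * p 1) * (-hab)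
    change 0 < normalPart C p (a • u + b • v)
    rw [e]
    rcases ha.eq_or_lt with rfl | ha
    · obtain rfl : b = 1 := by linarith
      linarith
    · have := mul_pos ha hu
      have := mul_nonneg hb hv.le
      linarith
  have hne : ∀ u, 0 < normalPart C p u → u ≠ p := by
    rintro u hu rfl
    simp [normalPart] at hu
  -- Projection from `p` maps the open half plane beyond the tangent at `p` onto the circle without
  -- `p`, fixing the points of the circle.
  have := hconv.isPreconnected.image (secondPoint C p) fun u hu =>
    (continuousAt_secondPoint C (hne u hu)).continuousWithinAt
  convert this using 1
  ext x
  constructor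
  · rintro ⟨hx, hxp⟩
    exact ⟨x, normalPart_pos hp hx hxp, secondPoint_of_mem hp hx hxp⟩
  · rintro ⟨u, hu, rfl⟩
    replace hu : 0 < normalPart C p u := hu
    refine ⟨secondPoint_mem hp (hne u hu), fun h => ?_⟩
    have hpos := sq_add_sq_pos_of_ne (hne u hu)
    have h' : secondPoint C p u = p := h
    rw [secondPoint, add_eq_left, smul_eq_zero, sub_eq_zero] at h'
    rcases h' with h' | h'
    · exact (div_pos (by linarith) hpos).ne' h'
    · exact hne u hu h'

/-- The open arc of a circle to the left of the line from `p` to `q`. -/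
def cap (C : EuclideanGeometry.Sphere Plane) (p q : Plane) : Set Plane :=
  {x | x ∈ C ∧ 0 < orient p q x}

/-- The arc is the image, under projection from `p`, of a convex set: the part of the half plane
beyond the tangent at `p` to the left of the chord. -/
theorem isPreconnected_cap {C : EuclideanGeometry.Sphere Plane} {p : Plane} (hp : p ∈ C)
    (q : Plane) : IsPreconnected (cap C p q) := by
  have hconv : Convex ℝ {u : Plane | 0 < normalPart C p u ∧ 0 < orient p q u} := by
    intro u hu v hv a b ha hb hab
    obtain ⟨hu, hu'⟩ := hu
    obtain ⟨hv, hv'⟩ := hv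
    have e : normalPart C p (a • u + b • v) = a * normalPart C p u + b * normalPart C p v := by
      simp only [normalPart, PiLp.add_apply, PiLp.smul_apply, smul_eq_mul]
      linear_combination (-(C.center 0 - p 0) * p 0 - (C.center 1 - p 1) * p 1) * (-hab)
    have e' : orient p q (a • u + b • v) = a * orient p q u + b * orient p q v := by
      simp only [orient, PiLp.add_apply, PiLp.smul_apply, smul_eq_mul]
      linear_combination (-(q 0 - p 0) * p 1 + (q 1 - p 1) * p 0) * (-hab)
    change 0 < normalPart C p (a • u + b • v) ∧ 0 < orient p q (a • u + b • v)
    rw [e, e']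
    rcases ha.eq_or_lt with rfl | ha
    · obtain rfl : b = 1 := by linarith
      constructor <;> linarith
    · have := mul_pos ha hu
      have := mul_nonneg hb hv.le
      have := mul_pos ha hu'
      have := mul_nonneg hb hv'.le
      constructor <;> linarith
  have hne : ∀ u, 0 < orient p q u → u ≠ p := by
    rintro u hu rfl
    simp [orient] at hu
  have := hconv.isPreconnected.image (secondPoint C p) fun u hu =>
    (continuousAt_secondPoint C (hne u hu.2)).continuousWithinAt
  convert this using 1
  ext x
  constructor
  · rintro ⟨hx, hxo⟩
    have hxp := hne x hxo
    exact ⟨x, ⟨normalPart_pos hp hx hxp, hxo⟩, secondPoint_of_mem hp hx hxp⟩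
  · rintro ⟨u, ⟨hu, hu'⟩, rfl⟩
    refine ⟨secondPoint_mem hp (hne u hu'), ?_⟩
    rw [orient_secondPoint]
    have hpos := sq_add_sq_pos_of_ne (hne u hu')
    positivity

/-- With `p` as origin, points of the circle satisfy `‖y‖ ^ 2 = 2 * ⟪c, y⟫`, whose right side is
linear. For parallel `x` and `q` this forces `‖x‖ ^ 2 = ⟪x, q⟫ = ‖q‖ ^ 2`, hence `x = q`. -/
theorem eq_or_eq_of_orient_eq_zero {C : EuclideanGeometry.Sphere Plane} {p q x : Plane}
    (hp : p ∈ C) (hq : q ∈ C) (hpq : p ≠ q) (hx : x ∈ C) (h : orient p q x = 0) :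
    x = p ∨ x = q := by
  by_cases hxp : x = p
  · exact Or.inl hxp
  right
  have hn := sq_add_sq_pos_of_ne (Ne.symm hpq)
  have hxn := sq_add_sq_pos_of_ne hxp
  have h1 := (mem_circle_iff hp x).1 hx
  have h2 := (mem_circle_iff hp q).1 hq
  unfold normalPart at h1 h2
  unfold orient at h
  set a := q 0 - p 0
  set b := q 1 - p 1
  set u := x 0 - p 0
  set v := x 1 - p 1
  set m := C.center 0 - p 0
  set n := C.center 1 - p 1
  have h3 : (a * u + b * v) * (u ^ 2 + v ^ 2 - (a * u + b * v)) = 0 := by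
    have e1 : (a ^ 2 + b ^ 2) * u = (a * u + b * v) * a := by linear_combination -b * h
    have e2 : (a ^ 2 + b ^ 2) * v = (a * u + b * v) * b := by linear_combination a * h
    have e3 : (a ^ 2 + b ^ 2) * (u ^ 2 + v ^ 2) = (a ^ 2 + b ^ 2) * (a * u + b * v) := by
      rw [h1]
      linear_combination 2 * m * e1 + 2 * n * e2 - (a * u + b * v) * h2
    have e4 := mul_left_cancel₀ hn.ne' e3
    rw [e4]; ring
  have hne : a * u + b * v ≠ 0 := by
    intro h0
    have : (a ^ 2 + b ^ 2) * (u ^ 2 + v ^ 2) = 0 := by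
      linear_combination (a * u + b * v) * h0 + (a * v - b * u) * h
    rcases mul_eq_zero.1 this with h' | h'
    · exact hn.ne' h'
    · exact hxn.ne' h'
  have h4 : u ^ 2 + v ^ 2 = a * u + b * v := by
    have := (mul_eq_zero.1 h3).resolve_left hne
    linarith
  have h5 : (u ^ 2 + v ^ 2) * (a ^ 2 + b ^ 2 - (a * u + b * v)) = 0 := by
    linear_combination (a * v - b * u) * h - (a * u + b * v) * h4
  have h6 : a ^ 2 + b ^ 2 = a * u + b * v := by
    have := (mul_eq_zero.1 h5).resolve_left hxn.ne'
    linarith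
  have h7 : (u - a) ^ 2 + (v - b) ^ 2 = 0 := by linear_combination h4 + h6
  have h8 : u = a := by nlinarith [sq_nonneg (u - a), sq_nonneg (v - b)]
  have h9 : v = b := by nlinarith [sq_nonneg (u - a), sq_nonneg (v - b)]
  exact plane_ext (by simpa [u, a] using h8) (by simpa [v, b] using h9)

/-- The point `q` is moved slightly at right angles to the chord, to the side given by the sign of
`s`, and projected back onto the circle from `p`. -/
theorem mem_closure_side {C : EuclideanGeometry.Sphere Plane} {p q : Plane}
    (hp : p ∈ C) (hq : q ∈ C) (hqp : q ≠ p) {s : ℝ} (hs : s ≠ 0) :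
    q ∈ closure {x | x ∈ C ∧ 0 < s * orient p q x} := by
  let f : ℝ → Plane := fun δ => !₂[q 0 - δ * s * (q 1 - p 1), q 1 + δ * s * (q 0 - p 0)]
  have hf : Continuous f := by
    refine (PiLp.continuous_toLp 2 _).comp (continuous_pi fun i => ?_)
    fin_cases i
    · change Continuous fun δ : ℝ => q 0 - δ * s * (q 1 - p 1)
      fun_prop
    · change Continuous fun δ : ℝ => q 1 + δ * s * (q 0 - p 0)
      fun_prop
  have hf0 : f 0 = q := plane_ext (by simp [f]) (by simp [f])
  have hlim : Tendsto (fun δ => secondPoint C p (f δ)) (𝓝[>] 0) (𝓝 q) := by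
    have h1 : ContinuousAt (secondPoint C p) (f 0) := by
      rw [hf0]; exact continuousAt_secondPoint C hqp
    have h2 := (ContinuousAt.comp h1 hf.continuousAt).tendsto
    simp only [Function.comp_def, hf0, secondPoint_of_mem hp hq hqp] at h2
    exact h2.mono_left nhdsWithin_le_nhds
  have hN : ∀ᶠ δ in 𝓝[>] (0 : ℝ), 0 < normalPart C p (f δ) := by
    have hc : Continuous (normalPart C p) := by unfold normalPart; fun_prop
    have h0 : 0 < normalPart C p (f 0) := by rw [hf0]; exact normalPart_pos hp hq hqp
    exact ((hc.comp hf).continuousAt.eventually (lt_mem_nhds h0)).filter_mono nhdsWithin_le_nhds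
  refine mem_closure_of_tendsto hlim ?_
  filter_upwards [hN, self_mem_nhdsWithin] with δ h1 (h2 : 0 < δ)
  have ho : 0 < s * orient p q (f δ) := by
    have : s * orient p q (f δ) = δ * s ^ 2 * ((q 0 - p 0) ^ 2 + (q 1 - p 1) ^ 2) := by
      simp only [orient, f]
      simp
      ring
    rw [this]
    exact mul_pos (by positivity) (sq_add_sq_pos_of_ne hqp)
  have hne : f δ ≠ p := by
    intro h
    rw [h] at ho
    simp [orient] at ho
  refine ⟨secondPoint_mem hp hne, ?_⟩
  rw [orient_secondPoint, mul_left_comm]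
  have := sq_add_sq_pos_of_ne hne
  positivity

theorem right_mem_closure_cap {C : EuclideanGeometry.Sphere Plane} {p q : Plane}
    (hp : p ∈ C) (hq : q ∈ C) (hpq : p ≠ q) : q ∈ closure (cap C p q) := by
  simpa only [cap, one_mul] using mem_closure_side hp hq hpq.symm one_ne_zero

theorem left_mem_closure_cap {C : EuclideanGeometry.Sphere Plane} {p q : Plane}
    (hp : p ∈ C) (hq : q ∈ C) (hpq : p ≠ q) : p ∈ closure (cap C p q) := by
  have h := mem_closure_side hq hp hpq (neg_ne_zero.2 one_ne_zero)
  simpa only [cap, orient_swap p q, neg_mul, one_mul, neg_neg] using h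

theorem nonempty_cap {C : EuclideanGeometry.Sphere Plane} {p q : Plane}
    (hp : p ∈ C) (hq : q ∈ C) (hpq : p ≠ q) : (cap C p q).Nonempty :=
  closure_nonempty_iff.1 ⟨q, right_mem_closure_cap hp hq hpq⟩

theorem closure_cap_diff {C : EuclideanGeometry.Sphere Plane} {p q : Plane}
    (hp : p ∈ C) (hq : q ∈ C) (hpq : p ≠ q) : closure (cap C p q) \ cap C p q = {p, q} := by
  apply Subset.antisymm
  · rintro x ⟨hx, hxc⟩
    have hcl : IsClosed {x | x ∈ C ∧ 0 ≤ orient p q x} := by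
      rw [Set.ofPred_and]
      refine IsClosed.inter ?_ (isClosed_le continuous_const (continuous_orient p q))
      exact Metric.isClosed_sphere (x := C.center) (ε := C.radius)
    have hsub : cap C p q ⊆ {x | x ∈ C ∧ 0 ≤ orient p q x} := fun y hy => ⟨hy.1, hy.2.le⟩
    have hx' := closure_minimal hsub hcl hx
    have h0 : orient p q x = 0 := by
      by_contra hne
      exact hxc ⟨hx'.1, lt_of_le_of_ne hx'.2 (Ne.symm hne)⟩
    exact eq_or_eq_of_orient_eq_zero hp hq hpq hx'.1 h0
  · rintro x (rfl | rfl)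
    · exact ⟨left_mem_closure_cap hp hq hpq, fun h => by simpa [orient] using h.2⟩
    · refine ⟨right_mem_closure_cap hp hq hpq, fun h => ?_⟩
      have : orient p x x = 0 := by unfold orient; ring
      exact h.2.ne' this

theorem disjoint_cap_swap (C : EuclideanGeometry.Sphere Plane) (p q : Plane) :
    Disjoint (cap C p q) (cap C q p) := by
  refine Set.disjoint_left.2 fun x hx hx' => ?_
  have := hx'.2
  rw [orient_swap] at this
  linarith [hx.2]

/-- An open arc cut off by two vertices is an arc of the system if it contains no vertex. -/
theorem cap_mem_arcs {S : CircleSystem} {C : EuclideanGeometry.Sphere Plane} (hC : C ∈ S.circles)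
    {p q : Plane} (hp : p ∈ C) (hq : q ∈ C) (hpq : p ≠ q) (hpS : p ∈ S.vertices)
    (hqS : q ∈ S.vertices) (hS : ∀ x ∈ cap C p q, x ∉ S.vertices) : cap C p q ∈ S.arcs := by
  obtain ⟨x, hx⟩ := nonempty_cap hp hq hpq
  have hcap : ((C : Set Plane) \ S.vertices) ∩ {x | 0 < orient p q x} = cap C p q := by
    ext y
    exact ⟨fun h => ⟨h.1.1, h.2⟩, fun h => ⟨⟨h.1, hS y h⟩, h.2⟩⟩
  refine ⟨C, hC, x, ⟨hx.1, hS x hx⟩, ?_⟩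
  rw [← hcap]
  refine (connectedComponentIn_eq_inter_of_partition (O' := {x | orient p q x < 0})
    (isOpen_lt continuous_const (continuous_orient p q))
    (isOpen_lt (continuous_orient p q) continuous_const) ?_ ?_ ?_ (hcap ▸ hx)).symm
  · intro y hy
    rcases lt_trichotomy (orient p q y) 0 with h | h | h
    · exact Or.inr h
    · rcases eq_or_eq_of_orient_eq_zero hp hq hpq hy.1 h with rfl | rfl
      · exact absurd hpS hy.2
      · exact absurd hqS hy.2
    · exact Or.inl h
  · rw [eq_empty_iff_forall_notMem]
    rintro y ⟨-, h1, h2⟩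
    exact lt_asymm (show 0 < orient p q y from h1) h2
  · rw [hcap]; exact isPreconnected_cap hp q

/-! ### Local consequences of realizing the octahedron graph -/

namespace CircleSystem

variable {S : CircleSystem}

/-- The graph has no multiple edges: an edge is determined by its ends. -/
theorem arc_eq_of_ends_eq (h : S.Realizes octahedronGraph) {a b : Set Plane} (ha : a ∈ S.arcs)
    (hb : b ∈ S.arcs) (hab : closure a \ a = closure b \ b) : a = b := by
  obtain ⟨φ, ψ, hψ⟩ := h
  have h1 := hψ (ψ.symm ⟨a, ha⟩)
  have h2 := hψ (ψ.symm ⟨b, hb⟩)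
  rw [Equiv.apply_symm_apply] at h1 h2
  rw [hab, h2] at h1
  have hinj : Function.Injective fun v => (φ v : Plane) := Subtype.val_injective.comp φ.injective
  have h3 := hinj.image_injective h1
  have h4 : ψ.symm ⟨b, hb⟩ = ψ.symm ⟨a, ha⟩ :=
    Subtype.ext (Sym2.ext fun v => Set.ext_iff.1 h3 v)
  exact congrArg Subtype.val (ψ.symm.injective h4).symm

theorem exists_ends (h : S.Realizes octahedronGraph) {a : Set Plane} (ha : a ∈ S.arcs) :
    ∃ p q, p ≠ q ∧ closure a \ a = {p, q} := by
  obtain ⟨φ, ψ, hψ⟩ := h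
  have h1 := hψ (ψ.symm ⟨a, ha⟩)
  rw [Equiv.apply_symm_apply] at h1
  generalize ψ.symm ⟨a, ha⟩ = e at h1
  obtain ⟨⟨u, v⟩, huv⟩ := e
  have hadj : octahedronGraph.Adj u v := huv
  refine ⟨φ u, φ v, fun h => hadj.ne (φ.injective (Subtype.ext h)), ?_⟩
  have h2 : {w | w ∈ (Sym2.mk u v : Sym2 (Fin 3 × Fin 2))} = {u, v} := by
    ext w; exact Sym2.mem_iff
  rw [h1, ← image_pair (fun v => (φ v : Plane)), ← h2]

/-- The arcs ending at a point correspond to edges at one vertex, and the octahedron graph is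
regular of degree four. -/
theorem card_le_four_of_common_end (h : S.Realizes octahedronGraph) {κ : Type} [Fintype κ]
    {f : κ → Set Plane} (hf : Function.Injective f) (hfa : ∀ k, f k ∈ S.arcs) {p : Plane}
    (hp : ∀ k, p ∈ closure (f k) \ f k) : Fintype.card κ ≤ 4 := by
  classical
  obtain ⟨φ, ψ, hψ⟩ := h
  rcases isEmpty_or_nonempty κ with hκ | ⟨⟨k₀⟩⟩
  · simp
  have hmem : ∀ k, ∃ v, v ∈ ((ψ.symm ⟨f k, hfa k⟩ : octahedronGraph.edgeSet) :
      Sym2 (Fin 3 × Fin 2)) ∧ (φ v : Plane) = p := by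
    intro k
    have h1 := hψ (ψ.symm ⟨f k, hfa k⟩)
    rw [Equiv.apply_symm_apply] at h1
    have h2 := hp k
    rw [h1] at h2
    exact h2
  obtain ⟨v, -, hv⟩ := hmem k₀
  have hmem' : ∀ k, v ∈ ((ψ.symm ⟨f k, hfa k⟩ : octahedronGraph.edgeSet) :
      Sym2 (Fin 3 × Fin 2)) := by
    intro k
    obtain ⟨v', hv', hp'⟩ := hmem k
    have : v' = v := φ.injective (Subtype.ext (hp'.trans hv.symm))
    exact this ▸ hv'
  let g : κ → Sym2 (Fin 3 × Fin 2) := fun k => (ψ.symm ⟨f k, hfa k⟩ : octahedronGraph.edgeSet)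
  have hg : Function.Injective g := by
    intro k l hkl
    have := ψ.symm.injective (Subtype.ext hkl)
    exact hf (congrArg Subtype.val this)
  have hdeg : ∀ v : Fin 3 × Fin 2, octahedronGraph.degree v = 4 := by decide
  rw [← hdeg v, ← SimpleGraph.card_incidenceFinset_eq_degree, ← Finset.card_univ]
  refine Finset.card_le_card_of_injOn g (fun k _ => ?_) hg.injOn
  simp only [SimpleGraph.coe_incidenceFinset]
  exact ⟨(ψ.symm ⟨f k, hfa k⟩).2, hmem' k⟩

theorem finite_vertices (h : S.Realizes octahedronGraph) : S.vertices.Finite := by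
  obtain ⟨φ, -⟩ := h
  have := Finite.of_equiv _ φ
  exact Set.toFinite _

theorem ncard_vertices (h : S.Realizes octahedronGraph) : S.vertices.ncard = 6 := by
  obtain ⟨φ, -⟩ := h
  rw [← Nat.card_coe_set_eq, ← Nat.card_congr φ]
  simp

theorem mem_vertices_of_mem {C D : EuclideanGeometry.Sphere Plane} (hC : C ∈ S.circles)
    (hD : D ∈ S.circles) (hCD : C ≠ D) {p : Plane} (hpC : p ∈ C) (hpD : p ∈ D) :
    p ∈ S.vertices := ⟨C, hC, D, hD, hCD, hpC, hpD⟩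

/-- If no arc of two circles has the same two end points, then the two circles do not both have a
free arc between the same points. -/
theorem not_parallel_caps (h : S.Realizes octahedronGraph)
    {C D : EuclideanGeometry.Sphere Plane} (hC : C ∈ S.circles) (hD : D ∈ S.circles) (hCD : C ≠ D)
    {p q p' q' : Plane} (hpq : p ≠ q) (hpC : p ∈ C) (hpD : p ∈ D) (hqC : q ∈ C) (hqD : q ∈ D)
    (hpq' : p' = p ∧ q' = q ∨ p' = q ∧ q' = p)
    (hS : ∀ x ∈ cap C p q, x ∉ S.vertices) (hS' : ∀ x ∈ cap D p' q', x ∉ S.vertices) : False := by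
  have hp := mem_vertices_of_mem hC hD hCD hpC hpD
  have hq := mem_vertices_of_mem hC hD hCD hqC hqD
  have h1 := cap_mem_arcs hC hpC hqC hpq hp hq hS
  have key : cap D p' q' ∈ S.arcs ∧ closure (cap D p' q') \ cap D p' q' = {p, q} := by
    rcases hpq' with ⟨rfl, rfl⟩ | ⟨rfl, rfl⟩
    · exact ⟨cap_mem_arcs hD hpD hqD hpq hp hq hS', closure_cap_diff hpD hqD hpq⟩
    · refine ⟨cap_mem_arcs hD hqD hpD hpq.symm hq hp hS', ?_⟩
      rw [closure_cap_diff hqD hpD hpq.symm, pair_comm]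
  have h2 := arc_eq_of_ends_eq h h1 key.1 ((closure_cap_diff hpC hqC hpq).trans key.2.symm)
  obtain ⟨x, hx⟩ := nonempty_cap hpC hqC hpq
  have hx' := hx
  rw [h2] at hx'
  exact hS x hx (mem_vertices_of_mem hC hD hCD hx.1 hx'.1)

/-- Every circle contains at least three vertices. -/
theorem three_le_ncard (h : S.Realizes octahedronGraph) {C : EuclideanGeometry.Sphere Plane}
    (hC : C ∈ S.circles) : 3 ≤ ((C : Set Plane) ∩ S.vertices).ncard := by
  have hr := S.radius_pos C hC
  have hfin : ((C : Set Plane) ∩ S.vertices).Finite := (finite_vertices h).inter_of_right _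
  have hCinf : (C : Set Plane).Infinite :=
    (isPreconnected_sphere one_lt_rank_plane C.center C.radius).infinite_of_nontrivial
      (nontrivial_circle hr)
  -- A circle with at most one vertex has a single arc, all of whose ends are vertices on the
  -- circle; but an arc has two ends.
  have hnot : ∀ p ∈ C, ¬ (C : Set Plane) ∩ S.vertices ⊆ {p} := by
    intro p hp hsub
    have hpre : IsPreconnected ((C : Set Plane) \ S.vertices) := by
      rcases Set.subset_singleton_iff_eq.1 hsub with he | he
      · rw [← Set.sdiff_inter_self_eq_sdiff, Set.inter_comm, he, sdiff_empty]
        exact isPreconnected_sphere one_lt_rank_plane C.center C.radius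
      · rw [← Set.sdiff_inter_self_eq_sdiff, Set.inter_comm, he]
        exact isPreconnected_circle_diff_singleton hp
    obtain ⟨x, hx⟩ : ((C : Set Plane) \ S.vertices).Nonempty :=
      (hCinf.sdiff (finite_vertices h)).nonempty
    have harc : (C : Set Plane) \ S.vertices ∈ S.arcs :=
      ⟨C, hC, x, hx, (hpre.connectedComponentIn hx).symm⟩
    obtain ⟨u, v, huv, he⟩ := exists_ends h harc
    have hcl : closure ((C : Set Plane) \ S.vertices) ⊆ C :=
      closure_minimal sdiff_subset (Metric.isClosed_sphere (x := C.center) (ε := C.radius))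
    have hsub' : ∀ y, y ∈ ({u, v} : Set Plane) → y = p := by
      intro y hy
      rw [← he] at hy
      have hyC : y ∈ (C : Set Plane) := hcl hy.1
      have hyS : y ∈ S.vertices := by
        by_contra hn
        exact hy.2 ⟨hyC, hn⟩
      exact hsub ⟨hyC, hyS⟩
    exact huv ((hsub' u (by simp)).trans (hsub' v (by simp)).symm)
  obtain ⟨p₀, hp₀⟩ := hCinf.nonempty
  obtain ⟨p, hp⟩ : ((C : Set Plane) ∩ S.vertices).Nonempty := by
    by_contra he
    rw [not_nonempty_iff_eq_empty] at he
    exact hnot p₀ hp₀ (by rw [he]; exact empty_subset _)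
  obtain ⟨q, hq, hqp⟩ : ∃ q ∈ (C : Set Plane) ∩ S.vertices, q ≠ p := by
    by_contra! hc
    exact hnot p hp.1 fun y hy => hc y hy
  -- If `p` and `q` were the only vertices on the circle, its two arcs would have the same ends.
  obtain ⟨r, hr, hrp, hrq⟩ : ∃ r ∈ (C : Set Plane) ∩ S.vertices, r ≠ p ∧ r ≠ q := by
    by_contra! hc
    have hfree : ∀ a b : Plane, (∀ y ∈ (C : Set Plane) ∩ S.vertices, y = a ∨ y = b) →
        ∀ x ∈ cap C a b, x ∉ S.vertices := by
      intro a b hab x hx hxS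
      have := hx.2
      rcases hab x ⟨hx.1, hxS⟩ with rfl | rfl
      · simp [orient] at this
      · have h0 : orient a x x = 0 := by unfold orient; ring
        linarith
    have hab : ∀ y ∈ (C : Set Plane) ∩ S.vertices, y = p ∨ y = q := fun y hy => by
      by_cases hyp : y = p
      · exact Or.inl hyp
      · exact Or.inr (hc y hy hyp)
    have h1 := cap_mem_arcs hC hp.1 hq.1 hqp.symm hp.2 hq.2 (hfree p q hab)
    have h2 := cap_mem_arcs hC hq.1 hp.1 hqp hq.2 hp.2
      (hfree q p fun y hy => (hab y hy).symm)
    have h3 := arc_eq_of_ends_eq h h1 h2 (by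
      rw [closure_cap_diff hp.1 hq.1 hqp.symm, closure_cap_diff hq.1 hp.1 hqp, pair_comm])
    obtain ⟨x, hx⟩ := nonempty_cap hp.1 hq.1 hqp.symm
    exact Set.disjoint_left.1 (disjoint_cap_swap C p q) hx (h3 ▸ hx)
  have hsub : ({p, q, r} : Set Plane) ⊆ (C : Set Plane) ∩ S.vertices := by
    rintro x (rfl | rfl | rfl) <;> assumption
  have hcard : ({p, q, r} : Set Plane).ncard = 3 :=
    Set.ncard_eq_three.2 ⟨p, q, r, hqp.symm, hrp.symm, hrq.symm, rfl⟩
  rw [← hcard]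
  exact Set.ncard_le_ncard hsub hfin

/-- At every vertex on a circle, two arcs of the circle end. -/
theorem exists_two_arcs (h : S.Realizes octahedronGraph) {C : EuclideanGeometry.Sphere Plane}
    (hC : C ∈ S.circles) {p : Plane} (hpC : p ∈ C) (hpS : p ∈ S.vertices) :
    ∃ a b : Set Plane, a ≠ b ∧ a ∈ S.arcs ∧ b ∈ S.arcs ∧ a ⊆ C ∧ b ⊆ C ∧
      a.Nonempty ∧ b.Nonempty ∧ (∀ x ∈ a, x ∉ S.vertices) ∧ (∀ x ∈ b, x ∉ S.vertices) ∧
      p ∈ closure a \ a ∧ p ∈ closure b \ b := by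
  have hfin : ((C : Set Plane) ∩ S.vertices).Finite := (finite_vertices h).inter_of_right _
  have hfin' : (((C : Set Plane) ∩ S.vertices) \ {p}).Finite := hfin.sdiff
  have hne : (((C : Set Plane) ∩ S.vertices) \ {p}).Nonempty := by
    rw [← Set.ncard_pos hfin', Set.ncard_sdiff_singleton_of_mem
      (show p ∈ (C : Set Plane) ∩ S.vertices from ⟨hpC, hpS⟩)]
    have := three_le_ncard h hC
    omega
  -- The slope of the line from `p` to `x` relative to the normal at `p` orders the circle without
  -- `p`. The vertices next to `p` are those of largest and of smallest slope.
  let t : Plane → ℝ := fun x => orient p C.center x / normalPart C p x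
  have ht : ∀ x ∈ C, x ≠ p → ∀ y ∈ C, y ≠ p → (0 < orient p x y ↔ t x < t y) := by
    intro x hx hxp y hy hyp
    have h1 := normalPart_pos hpC hx hxp
    have h2 := normalPart_pos hpC hy hyp
    have hcp : C.center ≠ p := by
      rintro hcp
      rw [← hcp] at h1
      simp [normalPart] at h1
    have h3 := sq_add_sq_pos_of_ne hcp
    have e : ((C.center 0 - p 0) ^ 2 + (C.center 1 - p 1) ^ 2) * orient p x y =
        normalPart C p x * orient p C.center y - orient p C.center x * normalPart C p y := by
      unfold orient normalPart; ring
    simp only [t]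
    rw [div_lt_div_iff₀ h1 h2]
    constructor
    · intro h0
      have := mul_pos h3 h0
      linarith
    · intro h0
      exact pos_of_mul_pos_right (by rw [e]; linarith) h3.le
  obtain ⟨q, ⟨⟨hqC, hqS⟩, hqp⟩, hqmax⟩ := Set.exists_max_image _ t hfin' hne
  obtain ⟨r, ⟨⟨hrC, hrS⟩, hrp⟩, hrmin⟩ := Set.exists_min_image _ t hfin' hne
  replace hqp : q ≠ p := hqp
  replace hrp : r ≠ p := hrp
  have hq : ∀ x ∈ cap C p q, x ∉ S.vertices := by
    intro x hx hxS
    have hxp : x ≠ p := by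
      rintro rfl
      simpa [orient] using hx.2
    have h1 := (ht q hqC hqp x hx.1 hxp).1 hx.2
    exact absurd h1 (not_lt.2 (hqmax x ⟨⟨hx.1, hxS⟩, hxp⟩))
  have hr : ∀ x ∈ cap C r p, x ∉ S.vertices := by
    intro x hx hxS
    have hxp : x ≠ p := by
      rintro rfl
      have h0 : orient r x x = 0 := by unfold orient; ring
      linarith [hx.2]
    have h0 : orient r p x = orient p x r := by unfold orient; ring
    have h1 := (ht x hx.1 hxp r hrC hrp).1 (h0 ▸ hx.2)
    exact absurd h1 (not_lt.2 (hrmin x ⟨⟨hx.1, hxS⟩, hxp⟩))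
  refine ⟨cap C p q, cap C r p, fun he => ?_, cap_mem_arcs hC hpC hqC hqp.symm hpS hqS hq,
    cap_mem_arcs hC hrC hpC hrp hrS hpS hr, fun x hx => hx.1, fun x hx => hx.1,
    nonempty_cap hpC hqC hqp.symm, nonempty_cap hrC hpC hrp, hq, hr, ?_, ?_⟩
  · have h1 := closure_cap_diff hpC hqC hqp.symm
    rw [he, closure_cap_diff hrC hpC hrp] at h1
    have hrq : r = q := by
      have : r ∈ ({p, q} : Set Plane) := h1 ▸ mem_insert r {p}
      exact this.resolve_left hrp
    subst hrq
    obtain ⟨x, hx⟩ := nonempty_cap hpC hqC hqp.symm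
    exact Set.disjoint_left.1 (disjoint_cap_swap C p r) hx (he ▸ hx)
  · rw [closure_cap_diff hpC hqC hqp.symm]; simp
  · rw [closure_cap_diff hrC hpC hrp]; simp

/-- No three circles have a common point. -/
theorem no_triple (h : S.Realizes octahedronGraph) {C : Fin 3 → EuclideanGeometry.Sphere Plane}
    (hinj : Function.Injective C) (hC : ∀ i, C i ∈ S.circles) {p : Plane} (hp : ∀ i, p ∈ C i) :
    False := by
  have hpS : p ∈ S.vertices :=
    mem_vertices_of_mem (hC 0) (hC 1) (hinj.ne (by decide)) (hp 0) (hp 1)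
  choose a b hab ha hb haC hbC hane hbne haS hbS hpa hpb using
    fun i => exists_two_arcs h (hC i) (hp i) hpS
  -- Each of the three circles has two arcs ending at `p`. All six are distinct, since a point on
  -- two circles is a vertex and no arc contains one; but the degree is four.
  let f : Fin 3 × Bool → Set Plane := fun k => if k.2 then a k.1 else b k.1
  have hfC : ∀ k, f k ⊆ C k.1 := by
    rintro ⟨i, _ | _⟩
    · exact hbC i
    · exact haC i
  have hfne : ∀ k, (f k).Nonempty := by
    rintro ⟨i, _ | _⟩
    · exact hbne i
    · exact hane i
  have hfS : ∀ k, ∀ x ∈ f k, x ∉ S.vertices := by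
    rintro ⟨i, _ | _⟩
    · exact hbS i
    · exact haS i
  have hinjf : Function.Injective f := by
    rintro k l hkl
    have h1 : k.1 = l.1 := by
      by_contra hne
      obtain ⟨x, hx⟩ := hfne k
      exact hfS k x hx (mem_vertices_of_mem (hC k.1) (hC l.1) (hinj.ne hne) (hfC k hx)
        (hfC l (hkl ▸ hx)))
    obtain ⟨i, s⟩ := k
    obtain ⟨j, t⟩ := l
    obtain rfl : i = j := h1
    cases s <;> cases t <;> simp [f] at hkl ⊢
    · exact hab i hkl.symm
    · exact hab i hkl
  have := card_le_four_of_common_end h hinjf (p := p)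
    (by rintro ⟨i, _ | _⟩ <;> [exact hb i; exact ha i])
    (by rintro ⟨i, _ | _⟩ <;> [exact hpb i; exact hpa i])
  simp at this

end CircleSystem

/-! ### Counting incidences: three crossing or four touching circles -/

namespace CircleSystem

variable {S : CircleSystem}

theorem inter_subset_vertices {C D : EuclideanGeometry.Sphere Plane} (hC : C ∈ S.circles)
    (hD : D ∈ S.circles) (hCD : C ≠ D) : (C : Set Plane) ∩ D ⊆ S.vertices := fun _ hp =>
  mem_vertices_of_mem hC hD hCD hp.1 hp.2

theorem ncard_inter_le_two (h : S.Realizes octahedronGraph) {C D : EuclideanGeometry.Sphere Plane}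
    (hC : C ∈ S.circles) (hD : D ∈ S.circles) (hCD : C ≠ D) :
    ((C : Set Plane) ∩ D).ncard ≤ 2 := by
  by_contra! hlt
  have hfin := (finite_vertices h).subset (inter_subset_vertices hC hD hCD)
  obtain ⟨p, hp, q, hq, r, hr, hpq, hpr, hqr⟩ := (Set.two_lt_ncard hfin).1 hlt
  have hdim : Module.finrank ℝ Plane = 2 := finrank_euclideanSpace_fin
  rcases EuclideanGeometry.eq_of_mem_sphere_of_mem_sphere_of_finrank_eq_two hdim hCD hpq
    hp.1 hq.1 hr.1 hp.2 hq.2 hr.2 with h | h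
  · exact hpr h.symm
  · exact hqr h.symm

open Classical in
/-- Every vertex lies on exactly two circles. -/
theorem card_circles_at_vertex (h : S.Realizes octahedronGraph) {p : Plane}
    (hp : p ∈ S.vertices) : (S.circles.filter fun C => p ∈ C).card = 2 := by
  apply le_antisymm
  · by_contra! hlt
    obtain ⟨A, hA, B, hB, D, hD, hAB, hAD, hBD⟩ := Finset.two_lt_card.1 hlt
    rw [Finset.mem_filter] at hA hB hD
    refine no_triple h (C := ![A, B, D]) (p := p) ?_ ?_ ?_
    · intro i j hij
      fin_cases i <;> fin_cases j <;> simp_all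
    · intro i
      fin_cases i <;> simp_all
    · intro i
      fin_cases i <;> simp_all
  · obtain ⟨C, hC, D, hD, hCD, hpC, hpD⟩ := hp
    refine Finset.one_lt_card.2 ⟨C, ?_, D, ?_, hCD⟩
    · exact Finset.mem_filter.2 ⟨hC, hpC⟩
    · exact Finset.mem_filter.2 ⟨hD, hpD⟩

/-- Double counting: six vertices, each on exactly two circles. -/
theorem sum_ncard (h : S.Realizes octahedronGraph) :
    ∑ C ∈ S.circles, ((C : Set Plane) ∩ S.vertices).ncard = 12 := by
  classical
  set P := (finite_vertices h).toFinset with hP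
  have hcard : P.card = 6 := by
    rw [← ncard_vertices h, Set.ncard_eq_toFinset_card _ (finite_vertices h)]
  have h1 := Finset.sum_card_bipartiteAbove_eq_sum_card_bipartiteBelow (s := S.circles) (t := P)
    fun C p => p ∈ C
  have h2 : ∑ p ∈ P, (S.circles.bipartiteBelow (fun C p => p ∈ C) p).card = 12 := by
    have h3 : ∀ p ∈ P, (S.circles.bipartiteBelow (fun C p => p ∈ C) p).card = 2 := fun p hp => by
      rw [Finset.bipartiteBelow]
      convert card_circles_at_vertex h ((finite_vertices h).mem_toFinset.1 hp)
    rw [Finset.sum_congr rfl h3, Finset.sum_const, hcard]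
    rfl
  rw [← h2, ← h1]
  refine Finset.sum_congr rfl fun C _ => ?_
  rw [← Set.ncard_coe_finset]
  congr 1
  ext p
  rw [Finset.bipartiteAbove, Finset.mem_coe, Finset.mem_filter, hP, Set.Finite.mem_toFinset]
  exact and_comm

/-- A vertex on `C` lies on some other circle too. -/
theorem ncard_le_sum (h : S.Realizes octahedronGraph) [DecidableEq (EuclideanGeometry.Sphere Plane)]
    {C : EuclideanGeometry.Sphere Plane} (hC : C ∈ S.circles) :
    ((C : Set Plane) ∩ S.vertices).ncard ≤
      ∑ D ∈ S.circles.erase C, ((C : Set Plane) ∩ D).ncard := by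
  have hsub : (C : Set Plane) ∩ S.vertices ⊆ ⋃ D ∈ S.circles.erase C, (C : Set Plane) ∩ D := by
    rintro p ⟨hpC, A, hA, B, hB, hAB, hpA, hpB⟩
    simp only [mem_iUnion, Finset.mem_erase]
    by_cases hAC : A = C
    · subst hAC
      exact ⟨B, ⟨hAB.symm, hB⟩, hpC, hpB⟩
    · exact ⟨A, ⟨hAC, hA⟩, hpC, hpA⟩
  have hfin : (⋃ D ∈ S.circles.erase C, (C : Set Plane) ∩ D).Finite := by
    refine (finite_vertices h).subset (iUnion₂_subset fun D hD => ?_)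
    rw [Finset.mem_erase] at hD
    exact inter_subset_vertices hC hD.2 hD.1.symm
  exact (Set.ncard_le_ncard hsub hfin).trans (Finset.set_ncard_biUnion_le _ _)

/-- Only one vertex on `C` differs from `p` and `q`, and it lies on one side of their chord. -/
theorem exists_free_cap (h : S.Realizes octahedronGraph) {C : EuclideanGeometry.Sphere Plane}
    (hC3 : ((C : Set Plane) ∩ S.vertices).ncard = 3) {p q : Plane}
    (hp : p ∈ C) (hq : q ∈ C) (hpq : p ≠ q) (hpS : p ∈ S.vertices) (hqS : q ∈ S.vertices) :
    (∀ x ∈ cap C p q, x ∉ S.vertices) ∨ (∀ x ∈ cap C q p, x ∉ S.vertices) := by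
  by_contra! hcon
  obtain ⟨⟨x, hx, hxS⟩, ⟨y, hy, hyS⟩⟩ := hcon
  have hne : ∀ z ∈ cap C p q ∪ cap C q p, z ≠ p ∧ z ≠ q := by
    have h1 : orient p q p = 0 ∧ orient p q q = 0 := by unfold orient; constructor <;> ring
    have h2 : orient q p p = 0 ∧ orient q p q = 0 := by unfold orient; constructor <;> ring
    rintro z (hz | hz) <;> constructor <;> rintro rfl
    · exact hz.2.ne' h1.1
    · exact hz.2.ne' h1.2
    · exact hz.2.ne' h2.1
    · exact hz.2.ne' h2.2
  have hxy : x ≠ y := fun e => Set.disjoint_left.1 (disjoint_cap_swap C p q) hx (e ▸ hy)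
  obtain ⟨hxp, hxq⟩ := hne x (Or.inl hx)
  obtain ⟨hyp, hyq⟩ := hne y (Or.inr hy)
  have hsub : (({p, q, x, y} : Finset Plane) : Set Plane) ⊆ (C : Set Plane) ∩ S.vertices := by
    intro z hz
    simp only [Finset.coe_insert, Finset.coe_singleton, mem_insert_iff, mem_singleton_iff] at hz
    rcases hz with rfl | rfl | rfl | rfl
    exacts [⟨hp, hpS⟩, ⟨hq, hqS⟩, ⟨hx.1, hxS⟩, ⟨hy.1, hyS⟩]
  have h4 := Set.ncard_le_ncard hsub ((finite_vertices h).inter_of_right _)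
  rw [Set.ncard_coe_finset, hC3, Finset.card_insert_of_notMem (by simp [hpq, hxp.symm, hyp.symm]),
    Finset.card_insert_of_notMem (by simp [hxq.symm, hyq.symm]),
    Finset.card_insert_of_notMem (by simpa using hxy), Finset.card_singleton] at h4
  omega

/-- A realization of the octahedron graph consists of three mutually crossing or four mutually
touching circles. -/
theorem three_crossing_or_four_touching (h : S.Realizes octahedronGraph) :
    (S.circles.card = 3 ∧ ∀ C ∈ S.circles, ∀ D ∈ S.circles, C ≠ D → Cross C D) ∨
    (S.circles.card = 4 ∧ ∀ C ∈ S.circles, ∀ D ∈ S.circles, C ≠ D → Touch C D) := by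
  classical
  have hsum := sum_ncard h
  have h3 : ∀ C ∈ S.circles, 3 ≤ ((C : Set Plane) ∩ S.vertices).ncard :=
    fun C hC => three_le_ncard h hC
  -- Twelve incidences, at least three on every circle.
  have hle4 : S.circles.card ≤ 4 := by
    have := Finset.card_nsmul_le_sum S.circles _ 3 h3
    rw [hsum, smul_eq_mul] at this
    omega
  have hle2 : ∀ C ∈ S.circles, ∀ D ∈ S.circles.erase C, ((C : Set Plane) ∩ D).ncard ≤ 2 := by
    intro C hC D hD
    rw [Finset.mem_erase] at hD
    exact ncard_inter_le_two h hC hD.2 hD.1.symm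
  have hup : ∀ C ∈ S.circles,
      ((C : Set Plane) ∩ S.vertices).ncard ≤ (S.circles.card - 1) * 2 := by
    intro C hC
    refine (ncard_le_sum h hC).trans ((Finset.sum_le_card_nsmul _ _ 2 (hle2 C hC)).trans ?_)
    rw [Finset.card_erase_of_mem hC, smul_eq_mul]
  obtain ⟨C₀, hC₀⟩ : S.circles.Nonempty := by
    by_contra hne
    rw [Finset.not_nonempty_iff_eq_empty] at hne
    rw [hne] at hsum
    simp at hsum
  have hge3 : 3 ≤ S.circles.card := by
    have := hup C₀ hC₀
    have := h3 C₀ hC₀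
    omega
  -- If `k` other circles, each meeting `C` in at most `m` points, must cover `k * m` vertices on
  -- `C`, then each meets it in exactly `m`.
  have key : ∀ m k : ℕ, (∀ C ∈ S.circles, ((C : Set Plane) ∩ S.vertices).ncard = k * m) →
      S.circles.card = k + 1 →
      (∀ C ∈ S.circles, ∀ D ∈ S.circles.erase C, ((C : Set Plane) ∩ D).ncard ≤ m) →
      ∀ C ∈ S.circles, ∀ D ∈ S.circles, C ≠ D → ((C : Set Plane) ∩ D).ncard = m := by
    intro m k hk hcard hm C hC D hD hCD
    have hDe : D ∈ S.circles.erase C := Finset.mem_erase.2 ⟨hCD.symm, hD⟩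
    refine le_antisymm (hm C hC D hDe) ?_
    by_contra! hlt
    have h1 := Finset.sum_lt_sum (hm C hC) ⟨D, hDe, hlt⟩
    rw [Finset.sum_const, Finset.card_erase_of_mem hC, hcard, smul_eq_mul,
      Nat.add_sub_cancel] at h1
    have h2 := ncard_le_sum h hC
    rw [hk C hC] at h2
    omega
  rcases (by omega : S.circles.card = 3 ∨ S.circles.card = 4) with hcard | hcard
  · refine Or.inl ⟨hcard, key 2 2 ?_ hcard hle2⟩
    intro C hC
    -- Three counts of at most four add up to twelve, so each equals four.
    have hup' : ∀ D ∈ S.circles, ((D : Set Plane) ∩ S.vertices).ncard ≤ 4 := fun D hD => by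
      have := hup D hD
      rw [hcard] at this
      exact this
    refine le_antisymm (hup' C hC) ?_
    by_contra! hlt
    have := Finset.sum_lt_sum hup' ⟨C, hC, hlt⟩
    rw [hsum, Finset.sum_const, hcard] at this
    simp at this
  · have hk : ∀ C ∈ S.circles, ((C : Set Plane) ∩ S.vertices).ncard = 3 := by
      intro C hC
      refine le_antisymm ?_ (h3 C hC)
      by_contra! hlt
      have := Finset.sum_lt_sum h3 ⟨C, hC, hlt⟩
      rw [hsum, Finset.sum_const, hcard] at this
      simp at this
    refine Or.inr ⟨hcard, key 1 3 hk hcard ?_⟩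
    intro C hC D hD
    rw [Finset.mem_erase] at hD
    obtain ⟨hDC, hD⟩ := hD
    by_contra! hlt
    obtain ⟨p, hp, q, hq, hpq⟩ := (Set.one_lt_ncard
      ((finite_vertices h).subset (inter_subset_vertices hC hD hDC.symm))).1 hlt
    have hpS := inter_subset_vertices hC hD hDC.symm hp
    have hqS := inter_subset_vertices hC hD hDC.symm hq
    -- With two common points, both circles would have a free arc between them: a double edge. The
    -- four cases are the sides of the chord on which these arcs lie.
    rcases exists_free_cap h (hk C hC) hp.1 hq.1 hpq hpS hqS with h1 | h1 <;>
    rcases exists_free_cap h (hk D hD) hp.2 hq.2 hpq hpS hqS with h2 | h2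
    · exact not_parallel_caps h hC hD hDC.symm hpq hp.1 hp.2 hq.1 hq.2 (Or.inl ⟨rfl, rfl⟩) h1 h2
    · exact not_parallel_caps h hC hD hDC.symm hpq hp.1 hp.2 hq.1 hq.2 (Or.inr ⟨rfl, rfl⟩) h1 h2
    · exact not_parallel_caps h hC hD hDC.symm hpq.symm hq.1 hq.2 hp.1 hp.2
        (Or.inr ⟨rfl, rfl⟩) h1 h2
    · exact not_parallel_caps h hC hD hDC.symm hpq.symm hq.1 hq.2 hp.1 hp.2
        (Or.inl ⟨rfl, rfl⟩) h1 h2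

end CircleSystem

/-! ### Three crossing circles and their radical center -/

/-- The quadratic terms of two powers cancel, so their difference is affine. -/
theorem power_sub_power_lineMap (A B : EuclideanGeometry.Sphere Plane) (p q : Plane) (t : ℝ) :
    power B (AffineMap.lineMap p q t) - power A (AffineMap.lineMap p q t) =
      (1 - t) * (power B p - power A p) + t * (power B q - power A q) := by
  simp only [power, norm_sub_sq_plane, AffineMap.lineMap_apply_module, PiLp.add_apply,
    PiLp.smul_apply, smul_eq_mul]
  ring

/-- If two common points of the circles `A` and `B` are separated by the circle `D`, then the three
circles have a radical center in their interiors. -/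
theorem exists_radical_center {A B D : EuclideanGeometry.Sphere Plane} (hA : 0 < A.radius)
    (hB : 0 < B.radius) {p q : Plane} (hpA : p ∈ A) (hpB : p ∈ B) (hqA : q ∈ A) (hqB : q ∈ B)
    (hpq : p ≠ q) (hD : power D p * power D q < 0) :
    ∃ (z : Plane) (κ : ℝ), 0 < κ ∧ power A z = -κ ∧ power B z = -κ ∧ power D z = -κ := by
  rw [mem_iff_power_eq_zero hA] at hpA hqA
  rw [mem_iff_power_eq_zero hB] at hpB hqB
  set u := power D p
  set v := power D q
  have huv : u - v ≠ 0 := by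
    intro h
    have : u = v := by linarith
    rw [this] at hD
    nlinarith [mul_self_nonneg v]
  -- On the chord from `p` to `q` the powers of `A` and `B` agree, and the power of `D` minus that
  -- of `A` runs affinely from `u` to `v`. It vanishes at the parameter `u / (u - v)`, which is
  -- interior because `u` and `v` have opposite signs.
  have ht0 : 0 < u / (u - v) := by
    rcases mul_neg_iff.1 hD with ⟨h1, h2⟩ | ⟨h1, h2⟩
    · exact div_pos h1 (by linarith)
    · exact div_pos_of_neg_of_neg h1 (by linarith)
  have ht1 : u / (u - v) < 1 := by
    rcases mul_neg_iff.1 hD with ⟨h1, h2⟩ | ⟨h1, h2⟩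
    · rw [div_lt_one (by linarith)]; linarith
    · rw [div_lt_one_of_neg (by linarith)]; linarith
  set z : Plane := AffineMap.lineMap p q (u / (u - v))
  have hzA : power A z < 0 := by
    rw [← mem_inside_iff_power_neg hA]
    refine openSegment_subset_inside hA ((mem_iff_power_eq_zero hA p).2 hpA)
      ((mem_iff_power_eq_zero hA q).2 hqA) hpq ?_
    rw [openSegment_eq_image_lineMap]
    exact ⟨_, ⟨ht0, ht1⟩, rfl⟩
  have h1 := power_sub_power_lineMap A B p q (u / (u - v))
  have h2 := power_sub_power_lineMap A D p q (u / (u - v))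
  rw [hpA, hqA, hpB, hqB] at h1
  rw [hpA, hqA] at h2
  have h3 : (1 - u / (u - v)) * (u - 0) + u / (u - v) * (v - 0) = 0 := by
    field_simp
    ring
  refine ⟨z, -power A z, by linarith, by ring, ?_, ?_⟩
  · change power B z - power A z = _ at h1
    linarith
  · change power D z - power A z = (1 - u / (u - v)) * (u - 0) + u / (u - v) * (v - 0) at h2
    linarith

/-- Two points of the circle `A` on the same side of the circle `B` are on the same side of the
common chord. -/
theorem orient_mul_orient_pos {A B : EuclideanGeometry.Sphere Plane} (hA : 0 < A.radius)
    (hB : 0 < B.radius) {p q : Plane} (hpA : p ∈ A) (hpB : p ∈ B) (hqA : q ∈ A) (hqB : q ∈ B)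
    (hpq : p ≠ q) {x y : Plane} (hx : x ∈ A) (hy : y ∈ A) (hxy : 0 < power B x * power B y) :
    0 < orient p q x * orient p q y := by
  rw [mem_iff_power_eq_zero hA] at hpA hqA hx hy
  rw [mem_iff_power_eq_zero hB] at hpB hqB
  have hn := sq_add_sq_pos_of_ne hpq.symm
  -- The difference of the two powers is affine and vanishes at `p` and `q`, so it is a multiple of
  -- `orient p q`; `c` is the factor up to the squared length of the chord. On `A` the difference is
  -- the power of `B`.
  let c : ℝ := (-2 * (B.center 1 - A.center 1) * (q 0 - p 0) +
    2 * (B.center 0 - A.center 0) * (q 1 - p 1))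
  have key : ∀ z, ((q 0 - p 0) ^ 2 + (q 1 - p 1) ^ 2) * (power B z - power A z) =
      c * orient p q z := by
    intro z
    simp only [power, norm_sub_sq_plane] at hpA hqA hpB hqB ⊢
    simp only [c, orient]
    linear_combination ((q 0 - p 0) ^ 2 + (q 1 - p 1) ^ 2) * (hpB - hpA) +
      ((q 0 - p 0) * (z 0 - p 0) + (q 1 - p 1) * (z 1 - p 1)) * (hqB - hqA - hpB + hpA)
  have kx := key x
  have ky := key y
  rw [hx, sub_zero] at kx
  rw [hy, sub_zero] at ky
  have h1 : 0 < c ^ 2 * (orient p q x * orient p q y) := by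
    have : c ^ 2 * (orient p q x * orient p q y) =
        ((q 0 - p 0) ^ 2 + (q 1 - p 1) ^ 2) ^ 2 * (power B x * power B y) := by
      linear_combination -(c * orient p q y) * kx -
        ((q 0 - p 0) ^ 2 + (q 1 - p 1) ^ 2) * power B x * ky
    rw [this]
    positivity
  exact pos_of_mul_pos_right h1 (sq_nonneg c)

namespace CircleSystem

variable {S : CircleSystem}

/-- If `a` and `b` are on the same side of `B`, they are on the same side of the chord from `p` to
`q`, and the arc of `A` on its other side is free. -/
theorem exists_free_cap_of_power {A B D : EuclideanGeometry.Sphere Plane} (hA : A ∈ S.circles)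
    (hB : B ∈ S.circles) (hall : ∀ E ∈ S.circles, E = A ∨ E = B ∨ E = D)
    {p q a b : Plane} (hpq : p ≠ q) (hAB : (A : Set Plane) ∩ B = {p, q})
    (hAD : (A : Set Plane) ∩ D = {a, b}) (hab : 0 < power B a * power B b) :
    (∀ x ∈ cap A p q, x ∉ S.vertices) ∨ (∀ x ∈ cap A q p, x ∉ S.vertices) := by
  have hp : p ∈ (A : Set Plane) ∩ B := by rw [hAB]; simp
  have hq : q ∈ (A : Set Plane) ∩ B := by rw [hAB]; simp
  have ha : a ∈ (A : Set Plane) ∩ D := by rw [hAD]; simp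
  have hb : b ∈ (A : Set Plane) ∩ D := by rw [hAD]; simp
  have ho := orient_mul_orient_pos (S.radius_pos A hA) (S.radius_pos B hB) hp.1 hp.2 hq.1 hq.2 hpq
    ha.1 hb.1 hab
  have hv : ∀ x ∈ A, x ∈ S.vertices → x = p ∨ x = q ∨ x = a ∨ x = b := by
    rintro x hxA ⟨E, hE, E', hE', hne, hxE, hxE'⟩
    have hcase : x ∈ B ∨ x ∈ D := by
      rcases hall E hE with rfl | rfl | rfl
      · rcases hall E' hE' with rfl | rfl | rfl
        · exact absurd rfl hne
        · exact Or.inl hxE'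
        · exact Or.inr hxE'
      · exact Or.inl hxE
      · exact Or.inr hxE
    rcases hcase with hx | hx
    · have : x ∈ (A : Set Plane) ∩ B := ⟨hxA, hx⟩
      rw [hAB] at this
      rcases this with h | h
      · exact Or.inl h
      · exact Or.inr (Or.inl h)
    · have : x ∈ (A : Set Plane) ∩ D := ⟨hxA, hx⟩
      rw [hAD] at this
      exact Or.inr (Or.inr this)
  have h1 : orient p q p = 0 ∧ orient p q q = 0 := by unfold orient; constructor <;> ring
  rcases pos_and_pos_or_neg_and_neg_of_mul_pos ho with ⟨ha', hb'⟩ | ⟨ha', hb'⟩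
  · right
    intro x hx hxS
    have hxo := hx.2
    rw [orient_swap] at hxo
    rcases hv x hx.1 hxS with rfl | rfl | rfl | rfl <;> linarith
  · left
    intro x hx hxS
    have hxo := hx.2
    rcases hv x hx.1 hxS with rfl | rfl | rfl | rfl <;> linarith

theorem not_mem_three (h : S.Realizes octahedronGraph) {A B D : EuclideanGeometry.Sphere Plane}
    (hA : A ∈ S.circles) (hB : B ∈ S.circles) (hD : D ∈ S.circles) (hAB : A ≠ B) (hAD : A ≠ D)
    (hBD : B ≠ D) {p : Plane} (hpA : p ∈ A) (hpB : p ∈ B) (hpD : p ∈ D) : False := by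
  refine no_triple h (C := ![A, B, D]) (p := p) ?_ ?_ ?_
  · intro i j hij
    fin_cases i <;> fin_cases j <;> simp_all
  · intro i
    fin_cases i <;> simp_all
  · intro i
    fin_cases i <;> simp_all

/-- If `D` separates the common points of `A` and `B`, or `A` those of `B` and `D`, the radical
center is found on their chord. Otherwise both `A` and `D` have a free arc between the two points of
`A ∩ D`, a double edge. -/
theorem exists_radical_center_of_realizes (h : S.Realizes octahedronGraph)
    {A B D : EuclideanGeometry.Sphere Plane} (hA : A ∈ S.circles) (hB : B ∈ S.circles)
    (hD : D ∈ S.circles) (hAB : A ≠ B) (hAD : A ≠ D) (hBD : B ≠ D)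
    (hall : ∀ E ∈ S.circles, E = A ∨ E = B ∨ E = D)
    (hcross : ∀ C ∈ S.circles, ∀ D ∈ S.circles, C ≠ D → Cross C D) :
    ∃ (z : Plane) (κ : ℝ), 0 < κ ∧ power A z = -κ ∧ power B z = -κ ∧ power D z = -κ := by
  obtain ⟨c, c', hc, hcAB⟩ := Set.ncard_eq_two.1 (hcross A hA B hB hAB)
  obtain ⟨b, b', hb, hbAD⟩ := Set.ncard_eq_two.1 (hcross A hA D hD hAD)
  obtain ⟨a, a', ha, haBD⟩ := Set.ncard_eq_two.1 (hcross B hB D hD hBD)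
  have rA := S.radius_pos A hA
  have rB := S.radius_pos B hB
  have rD := S.radius_pos D hD
  have mc : c ∈ (A : Set Plane) ∩ B := by rw [hcAB]; simp
  have mc' : c' ∈ (A : Set Plane) ∩ B := by rw [hcAB]; simp
  have mb : b ∈ (A : Set Plane) ∩ D := by rw [hbAD]; simp
  have mb' : b' ∈ (A : Set Plane) ∩ D := by rw [hbAD]; simp
  have ma : a ∈ (B : Set Plane) ∩ D := by rw [haBD]; simp
  have ma' : a' ∈ (B : Set Plane) ∩ D := by rw [haBD]; simp
  have nD : ∀ x ∈ (A : Set Plane) ∩ B, power D x ≠ 0 := fun x hx h0 =>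
    not_mem_three h hA hB hD hAB hAD hBD hx.1 hx.2 ((mem_iff_power_eq_zero rD x).2 h0)
  have nA : ∀ x ∈ (B : Set Plane) ∩ D, power A x ≠ 0 := fun x hx h0 =>
    not_mem_three h hA hB hD hAB hAD hBD ((mem_iff_power_eq_zero rA x).2 h0) hx.1 hx.2
  rcases lt_or_gt_of_ne (mul_ne_zero (nD c mc) (nD c' mc')) with h1 | h1
  · exact exists_radical_center rA rB mc.1 mc.2 mc'.1 mc'.2 hc h1
  rcases lt_or_gt_of_ne (mul_ne_zero (nA a ma) (nA a' ma')) with h2 | h2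
  · obtain ⟨z, κ, hκ, e1, e2, e3⟩ := exists_radical_center rB rD ma.1 ma.2 ma'.1 ma'.2 ha h2
    exact ⟨z, κ, hκ, e3, e1, e2⟩
  exfalso
  have f1 := exists_free_cap_of_power hA hD (D := B)
    (fun E hE => (hall E hE).imp_right Or.symm) hb hbAD hcAB h1
  have f2 := exists_free_cap_of_power hD hA (D := B)
    (fun E hE => by rcases hall E hE with h | h | h <;> simp [h]) hb
    (by rw [inter_comm, hbAD]) (by rw [inter_comm, haBD]) h2
  rcases f1 with f1 | f1 <;> rcases f2 with f2 | f2
  · exact not_parallel_caps h hA hD hAD hb mb.1 mb.2 mb'.1 mb'.2 (Or.inl ⟨rfl, rfl⟩) f1 f2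
  · exact not_parallel_caps h hA hD hAD hb mb.1 mb.2 mb'.1 mb'.2 (Or.inr ⟨rfl, rfl⟩) f1 f2
  · exact not_parallel_caps h hA hD hAD hb.symm mb'.1 mb'.2 mb.1 mb.2 (Or.inr ⟨rfl, rfl⟩) f1 f2
  · exact not_parallel_caps h hA hD hAD hb.symm mb'.1 mb'.2 mb.1 mb.2 (Or.inl ⟨rfl, rfl⟩) f1 f2

theorem exists_enum {n : ℕ} (hcard : S.circles.card = n) :
    ∃ C : Fin n → EuclideanGeometry.Sphere Plane, Function.Injective C ∧
      ∀ D, D ∈ S.circles ↔ ∃ i, C i = D := by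
  let e := S.circles.equivFinOfCardEq hcard
  refine ⟨fun i => (e.symm i : EuclideanGeometry.Sphere Plane),
    Subtype.val_injective.comp e.symm.injective, fun D => ⟨fun hD => ⟨e ⟨D, hD⟩, by simp⟩, ?_⟩⟩
  rintro ⟨i, rfl⟩
  exact (e.symm i).2

/-- In the plane, `v` and `y` are both orthogonal to `a ≠ 0`, hence parallel; so `y` inherits
orthogonality to `b` from `v`. -/
theorem dot_eq_zero_of_dot_eq_zero {a₀ a₁ b₀ b₁ v₀ v₁ y₀ y₁ : ℝ} (ha : 0 < a₀ ^ 2 + a₁ ^ 2)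
    (hv : 0 < v₀ ^ 2 + v₁ ^ 2) (hva : v₀ * a₀ + v₁ * a₁ = 0) (hvb : v₀ * b₀ + v₁ * b₁ = 0)
    (hya : y₀ * a₀ + y₁ * a₁ = 0) : y₀ * b₀ + y₁ * b₁ = 0 := by
  have hcross : v₀ * y₁ - v₁ * y₀ = 0 := by
    refine (mul_eq_zero_iff_left ha.ne').1 ?_
    linear_combination (a₀ * y₁ - a₁ * y₀) * hva + (a₁ * v₀ - a₀ * v₁) * hya
  refine (mul_eq_zero_iff_left hv.ne').1 ?_
  linear_combination (v₀ * y₀ + v₁ * y₁) * hvb + (v₀ * b₁ - v₁ * b₀) * hcross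

/-- The oriented dual of three mutually crossing circles that realize the octahedron graph. -/
theorem orientedDual_of_threeCrossing (h : S.Realizes octahedronGraph)
    (hS : S.IsThreeCrossing) :
    Nonempty (crossingFan.DualAdj (fun _ => false) ≃r S.orientedDual.Adj) := by
  obtain ⟨C, hinj, hC⟩ := exists_enum hS.1
  have hm : ∀ i, C i ∈ S.circles := fun i => (hC _).2 ⟨i, rfl⟩
  have hne : ∀ i j, i ≠ j → C i ≠ C j := fun i j hij => hinj.ne hij
  obtain ⟨z, κ, hκ, e0, e1, e2⟩ := exists_radical_center_of_realizes h (hm 0) (hm 1) (hm 2)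
    (hne 0 1 (by decide)) (hne 0 2 (by decide)) (hne 1 2 (by decide)) (fun E hE => by
      obtain ⟨i, rfl⟩ := (hC E).1 hE
      fin_cases i <;> simp) hS.2
  have hz : ∀ i, power (C i) z = -κ := by
    intro i; fin_cases i <;> assumption
  obtain ⟨p, p', -, hpp⟩ := Set.ncard_eq_two.1 (hS.2 _ (hm 0) _ (hm 1) (hne 0 1 (by decide)))
  have hp : p ∈ (C 0 : Set Plane) ∩ C 1 := by rw [hpp]; simp
  have hcen : (C 0).center ≠ (C 1).center :=
    (EuclideanGeometry.Sphere.center_ne_iff_ne_of_mem hp.1 hp.2).2 (hne 0 1 (by decide))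
  refine (crossingFan_represents hinj hC hκ hz ?_).nonempty_orientedDual_iso
  intro v hv
  -- If the centers were collinear, `p - z` would be orthogonal to their line, because `p` and `z`
  -- both have equal powers for `C 0` and `C 1`. Then `p` would lie on `C 2` as well.
  by_contra hv0
  refine no_triple h hinj hm (p := p) fun i => ?_
  have p0 := (mem_iff_power_eq_zero (S.radius_pos _ (hm 0)) p).1 hp.1
  have p1 := (mem_iff_power_eq_zero (S.radius_pos _ (hm 1)) p).1 hp.2
  have p2 : power (C 2) p = 0 := by
    have hpos := sq_add_sq_pos_of_ne hcen
    have hv1 := hv 0 1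
    have hv2 := hv 0 2
    have hvpos := sq_add_sq_pos_of_ne hv0
    simp only [PiLp.inner_apply, Fin.sum_univ_two, PiLp.sub_apply, RCLike.inner_apply,
      conj_trivial] at hv1 hv2
    simp only [PiLp.zero_apply, sub_zero] at hvpos
    simp only [power, norm_sub_sq_plane] at p0 p1 e0 e1 e2 ⊢
    have key := dot_eq_zero_of_dot_eq_zero (a₀ := (C 0).center 0 - (C 1).center 0)
      (a₁ := (C 0).center 1 - (C 1).center 1) (b₀ := (C 0).center 0 - (C 2).center 0)
      (b₁ := (C 0).center 1 - (C 2).center 1) (v₀ := v 0) (v₁ := v 1) (y₀ := p 0 - z 0)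
      (y₁ := p 1 - z 1) hpos hvpos (by linear_combination hv1) (by linear_combination hv2)
      (by linear_combination (p1 - p0 - e1 + e0) / 2)
    linear_combination p0 + e2 - e0 + 2 * key
  fin_cases i
  · exact hp.1
  · exact hp.2
  · exact (mem_iff_power_eq_zero (S.radius_pos _ (hm 2)) p).2 p2

end CircleSystem

/-! ### Four touching circles: inner and outer tangency -/

namespace CircleSystem

/-- Reflection in the line of centers preserves both circles, so a single common point lies on that
line. The three distances between it and the centers are then related by an equation that factors.
-/
theorem dist_center_of_touch {C D : EuclideanGeometry.Sphere Plane} (hC : 0 < C.radius)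
    (hD : 0 < D.radius) (hne : C ≠ D) (h : Touch C D) :
    dist C.center D.center = C.radius + D.radius ∨
      dist C.center D.center = D.radius - C.radius ∨
      dist C.center D.center = C.radius - D.radius := by
  obtain ⟨p, hp⟩ := Set.ncard_eq_one.1 h
  have hpm : p ∈ (C : Set Plane) ∩ D := by rw [hp]; rfl
  have hcen : D.center ≠ C.center :=
    ((EuclideanGeometry.Sphere.center_ne_iff_ne_of_mem hpm.1 hpm.2).2 hne).symm
  have hd := sq_add_sq_pos_of_ne hcen
  have pC := (mem_iff_power_eq_zero hC p).1 hpm.1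
  have pD := (mem_iff_power_eq_zero hD p).1 hpm.2
  have hdist : dist C.center D.center ^ 2 =
      (D.center 0 - C.center 0) ^ 2 + (D.center 1 - C.center 1) ^ 2 := by
    rw [dist_comm, dist_eq_norm, norm_sub_sq_plane]
  have hd0 : 0 ≤ dist C.center D.center := dist_nonneg
  simp only [power, norm_sub_sq_plane] at pC pD
  set d0 := D.center 0 - C.center 0 with hd0'
  set d1 := D.center 1 - C.center 1 with hd1'
  set u0 := p 0 - C.center 0 with hu0
  set u1 := p 1 - C.center 1 with hu1
  -- the mirror image of the common point in the line of centers is a common point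
  let t : ℝ := 2 * (u0 * d0 + u1 * d1) / (d0 ^ 2 + d1 ^ 2)
  have ht : t * (d0 ^ 2 + d1 ^ 2) = 2 * (u0 * d0 + u1 * d1) := div_mul_cancel₀ _ hd.ne'
  let p' : Plane := !₂[C.center 0 + t * d0 - u0, C.center 1 + t * d1 - u1]
  have hp'C : p' ∈ C := by
    rw [mem_iff_power_eq_zero hC]
    simp only [power, norm_sub_sq_plane, p', Matrix.cons_val_zero, Matrix.cons_val_one]
    linear_combination pC + t * ht
  have hp'D : p' ∈ D := by
    rw [mem_iff_power_eq_zero hD]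
    simp only [power, norm_sub_sq_plane, p', Matrix.cons_val_zero, Matrix.cons_val_one]
    have e0 : C.center 0 + t * d0 - u0 - D.center 0 = t * d0 - u0 - d0 := by rw [hd0']; ring
    have e1 : C.center 1 + t * d1 - u1 - D.center 1 = t * d1 - u1 - d1 := by rw [hd1']; ring
    have e2 : p 0 - D.center 0 = u0 - d0 := by rw [hd0', hu0]; ring
    have e3 : p 1 - D.center 1 = u1 - d1 := by rw [hd1', hu1]; ring
    rw [e2, e3] at pD
    rw [e0, e1]
    linear_combination pD + (t - 2) * ht
  have hpp : p' = p := by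
    have : p' ∈ (C : Set Plane) ∩ D := ⟨hp'C, hp'D⟩
    rwa [hp] at this
  have f0 : C.center 0 + t * d0 - u0 = p 0 := congrArg (fun x : Plane => x 0) hpp
  have f1 : C.center 1 + t * d1 - u1 = p 1 := congrArg (fun x : Plane => x 1) hpp
  have hcross : u0 * d1 - u1 * d0 = 0 := by
    linear_combination (d0 * f1 - d1 * f0 - d0 * hu1 + d1 * hu0) / 2
  have hdot : 2 * (u0 * d0 + u1 * d1) =
      C.radius ^ 2 + dist C.center D.center ^ 2 - D.radius ^ 2 := by
    rw [hdist]
    linear_combination pC - pD - (p 0 - D.center 0 + u0 - d0) * (hd0' - hu0) -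
      (p 1 - D.center 1 + u1 - d1) * (hd1' - hu1)
  have hprod : (dist C.center D.center - (C.radius + D.radius)) *
      ((dist C.center D.center + (C.radius + D.radius)) *
      ((dist C.center D.center - (D.radius - C.radius)) *
      (dist C.center D.center - (C.radius - D.radius)))) = 0 := by
    have h1 : (u0 * d0 + u1 * d1) ^ 2 = C.radius ^ 2 * dist C.center D.center ^ 2 := by
      rw [hdist]
      linear_combination (d0 ^ 2 + d1 ^ 2) * pC - (u0 * d1 - u1 * d0) * hcross
    linear_combination 4 * h1 - (2 * (u0 * d0 + u1 * d1) + C.radius ^ 2 +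
      dist C.center D.center ^ 2 - D.radius ^ 2) * hdot
  rcases mul_eq_zero.1 hprod with h | h
  · left; linarith
  rcases mul_eq_zero.1 h with h | h
  · linarith
  rcases mul_eq_zero.1 h with h | h
  · right; left; linarith
  · right; right; linarith

theorem inside_subset_inside {C D : EuclideanGeometry.Sphere Plane}
    (h : dist C.center D.center = D.radius - C.radius) : inside C ⊆ inside D :=
  Metric.ball_subset_ball' (by linarith)

theorem disjoint_inside {C D : EuclideanGeometry.Sphere Plane}
    (h : dist C.center D.center = C.radius + D.radius) : Disjoint (inside C) (inside D) :=
  Metric.ball_disjoint_ball h.ge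

/-- As a point of `C`, which touches `D` from inside, `p` is at most `D.radius` away from the center
of `D`; as a point of `E` it is at least that far. -/
theorem mem_of_mem_of_dist_center {C D E : EuclideanGeometry.Sphere Plane} {p : Plane}
    (hCD : dist C.center D.center = D.radius - C.radius)
    (hDE : dist D.center E.center = D.radius + E.radius ∨
      dist D.center E.center = E.radius - D.radius) (hpC : p ∈ C) (hpE : p ∈ E) : p ∈ D := by
  rw [EuclideanGeometry.mem_sphere] at *
  have h1 := dist_triangle p C.center D.center
  have h2 := dist_triangle p D.center E.center
  have h3 := dist_triangle D.center p E.center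
  rw [dist_comm D.center p] at h3
  rcases hDE with h | h <;> linarith

variable {S : CircleSystem}

/-- With any other kind of tangency between `D` and `E`, the common point of `C` and `E` would also
lie on `D`. -/
theorem dist_center_of_internal (h : S.Realizes octahedronGraph)
    (ht : ∀ C ∈ S.circles, ∀ D ∈ S.circles, C ≠ D → Touch C D)
    {C D E : EuclideanGeometry.Sphere Plane} (hC : C ∈ S.circles) (hD : D ∈ S.circles)
    (hE : E ∈ S.circles) (hne : C ≠ D) (hED : E ≠ D)
    (hCD : dist C.center D.center = D.radius - C.radius) :
    dist E.center D.center = D.radius - E.radius := by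
  by_cases hCE : C = E
  · rwa [← hCE]
  obtain ⟨p, hp⟩ := Set.ncard_eq_one.1 (ht C hC E hE hCE)
  have hpm : p ∈ (C : Set Plane) ∩ E := by rw [hp]; rfl
  have key : ¬ (dist D.center E.center = D.radius + E.radius ∨
      dist D.center E.center = E.radius - D.radius) := fun hDE =>
    not_mem_three h hC hD hE hne hCE hED.symm hpm.1
      (mem_of_mem_of_dist_center hCD hDE hpm.1 hpm.2) hpm.2
  rw [not_or] at key
  rcases dist_center_of_touch (S.radius_pos D hD) (S.radius_pos E hE) hED.symm
    (ht D hD E hE hED.symm) with h | h | h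
  · exact absurd h key.1
  · exact absurd h key.2
  · rw [dist_comm, h]

theorem radius_lt_radius {C D : EuclideanGeometry.Sphere Plane} (hne : C ≠ D)
    (h : dist C.center D.center = D.radius - C.radius) : C.radius < D.radius := by
  by_contra! hle
  have h0 : dist C.center D.center = 0 := le_antisymm (by linarith) dist_nonneg
  exact hne (EuclideanGeometry.Sphere.ext (dist_eq_zero.1 h0) (by linarith))

/-- Four mutually touching circles in a realization of the octahedron graph either touch each other
from outside, or one of them surrounds the others. -/
theorem dist_centers_of_touch (h : S.Realizes octahedronGraph)
    (ht : ∀ C ∈ S.circles, ∀ D ∈ S.circles, C ≠ D → Touch C D) :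
    (∀ C ∈ S.circles, ∀ D ∈ S.circles, C ≠ D → dist C.center D.center = C.radius + D.radius) ∨
    ∃ O ∈ S.circles,
      (∀ C ∈ S.circles, C ≠ O → dist C.center O.center = O.radius - C.radius) ∧
      ∀ C ∈ S.circles, ∀ D ∈ S.circles, C ≠ O → D ≠ O → C ≠ D →
        dist C.center D.center = C.radius + D.radius := by
  by_cases hex : ∃ C ∈ S.circles, ∃ O ∈ S.circles, C ≠ O ∧
      dist C.center O.center = O.radius - C.radius
  · right
    obtain ⟨A, hA, O, hO, hne, hAO⟩ := hex
    have hin : ∀ C ∈ S.circles, C ≠ O → dist C.center O.center = O.radius - C.radius :=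
      fun C hC hCO => dist_center_of_internal h ht hA hO hC hne hCO hAO
    -- If `D` had a circle touching it from inside, then `O` would touch `D` from inside too, and
    -- each of the two radii would be smaller than the other.
    have hnot : ∀ C ∈ S.circles, ∀ D ∈ S.circles, D ≠ O → C ≠ D →
        dist C.center D.center ≠ D.radius - C.radius := by
      intro C hC D hD hDO hCD hin'
      have h1 := radius_lt_radius hDO (hin D hD hDO)
      have h2 := radius_lt_radius hDO.symm
        (dist_center_of_internal h ht hC hD hO hCD hDO.symm hin')
      linarith
    refine ⟨O, hO, hin, fun C hC D hD hCO hDO hCD => ?_⟩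
    rcases dist_center_of_touch (S.radius_pos C hC) (S.radius_pos D hD) hCD (ht C hC D hD hCD)
      with h | h | h
    · exact h
    · exact absurd h (hnot C hC D hD hDO hCD)
    · rw [dist_comm] at h
      exact absurd h (hnot D hD C hC hCO hCD.symm)
  · left
    intro C hC D hD hCD
    rcases dist_center_of_touch (S.radius_pos C hC) (S.radius_pos D hD) hCD (ht C hC D hD hCD)
      with h | h | h
    · exact h
    · exact absurd ⟨C, hC, D, hD, hCD, h⟩ hex
    · rw [dist_comm] at h
      exact absurd ⟨D, hD, C, hC, hCD.symm, h⟩ hex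

/-- The oriented dual of four circles that touch each other from outside. -/
theorem orientedDual_of_external (hcard : S.circles.card = 4)
    (hd : ∀ C ∈ S.circles, ∀ D ∈ S.circles, C ≠ D →
      dist C.center D.center = C.radius + D.radius) :
    Nonempty (tangentFan.DualAdj (fun _ => false) ≃r S.orientedDual.Adj) := by
  obtain ⟨C, hinj, hC⟩ := exists_enum hcard
  have hm : ∀ i, C i ∈ S.circles := fun i => (hC _).2 ⟨i, rfl⟩
  have hr : ∀ i, 0 < (C i).radius := fun i => S.radius_pos _ (hm i)
  refine (tangentFan_represents (R := fun i => (C i).radius) hinj hC (fun i => (hr i).ne')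
    (fun i => (abs_of_pos (hr i)).symm) (fun i j hij => ?_)
    (Finset.sum_pos (fun i _ => inv_pos.2 (hr i)) Finset.univ_nonempty)
    (fun i => ?_)).nonempty_orientedDual_iso
  · rw [← dist_eq_norm, hd _ (hm i) _ (hm j) (hinj.ne hij)]
  · simpa using (hr i).le

/-- The oriented dual of three circles that touch each other from outside and a surrounding
circle. -/
theorem orientedDual_of_internal (hcard : S.circles.card = 4)
    {O : EuclideanGeometry.Sphere Plane} (hO : O ∈ S.circles)
    (hin : ∀ C ∈ S.circles, C ≠ O → dist C.center O.center = O.radius - C.radius)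
    (hd : ∀ C ∈ S.circles, ∀ D ∈ S.circles, C ≠ O → D ≠ O → C ≠ D →
      dist C.center D.center = C.radius + D.radius) :
    Nonempty (tangentFan.DualAdj (fun i => decide (i = 0)) ≃r S.orientedDual.Adj) := by
  obtain ⟨C, hinj, hC, hC0⟩ : ∃ C : Fin 4 → EuclideanGeometry.Sphere Plane,
      Function.Injective C ∧ (∀ D, D ∈ S.circles ↔ ∃ i, C i = D) ∧ C 0 = O := by
    obtain ⟨C, hinj, hC⟩ := exists_enum hcard
    obtain ⟨k, hk⟩ := (hC O).1 hO
    refine ⟨C ∘ Equiv.swap 0 k, hinj.comp (Equiv.injective _), fun D => ?_, by simp [hk]⟩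
    rw [hC, (Equiv.swap 0 k).surjective.exists]
    rfl
  have hm : ∀ i, C i ∈ S.circles := fun i => (hC _).2 ⟨i, rfl⟩
  have hr : ∀ i, 0 < (C i).radius := fun i => S.radius_pos _ (hm i)
  have hneO : ∀ i, i ≠ 0 → C i ≠ O := fun i hi => hC0 ▸ hinj.ne hi
  have hlt : (C 1).radius < (C 0).radius := by
    rw [hC0]
    exact radius_lt_radius (hneO 1 (by decide)) (hin _ (hm 1) (hneO 1 (by decide)))
  -- The negative radius of the surrounding circle turns its inner tangencies into the signed
  -- condition.
  refine (tangentFan_represents (R := fun i => if i = 0 then -(C i).radius else (C i).radius)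
    hinj hC (fun i => ?_) (fun i => ?_) (fun i j hij => ?_) ?_
    (fun i => ?_)).nonempty_orientedDual_iso
  · split_ifs
    · exact neg_ne_zero.2 (hr i).ne'
    · exact (hr i).ne'
  · split_ifs <;> simp [abs_of_pos (hr i)]
  · rw [← dist_eq_norm]
    by_cases hi : i = 0
    · have hj : j ≠ 0 := fun h => hij (hi.trans h.symm)
      subst hi
      rw [dist_comm, hC0, hin _ (hm j) (hneO j hj)]
      simp only [if_true, if_neg hj]
      ring
    · by_cases hj : j = 0
      · subst hj
        rw [hC0, hin _ (hm i) (hneO i hi)]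
        simp only [if_true, if_neg hi]
        ring
      · simp only [if_neg hi, if_neg hj]
        rw [hd _ (hm i) _ (hm j) (hneO i hi) (hneO j hj) (hinj.ne hij)]
  -- The curvature of one inner circle already outweighs the negative one of the larger surrounding
  -- circle.
  · have h1 : (C 0).radius⁻¹ < (C 1).radius⁻¹ := inv_strictAnti₀ (hr 1) hlt
    have h2 := inv_pos.2 (hr 2)
    have h3 := inv_pos.2 (hr 3)
    simp only [Fin.sum_univ_four, if_true, inv_neg]
    have e1 : ((1 : Fin 4) = 0) = False := by decide
    have e2 : ((2 : Fin 4) = 0) = False := by decide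
    have e3 : ((3 : Fin 4) = 0) = False := by decide
    simp only [e1, e2, e3, if_false]
    linarith
  · by_cases hi : i = 0
    · simp [hi, hr 0]
    · simp [hi, (hr i).le]

/-- The realizations of the octahedron graph and their oriented duals. -/
theorem classification (h : S.Realizes octahedronGraph) :
    (S.IsThreeCrossing ∧
      Nonempty (crossingFan.DualAdj (fun _ => false) ≃r S.orientedDual.Adj)) ∨
    (S.IsFourTouchingDisjoint ∧
      Nonempty (tangentFan.DualAdj (fun _ => false) ≃r S.orientedDual.Adj)) ∨
    (S.IsThreeTouchingInOne ∧
      Nonempty (tangentFan.DualAdj (fun i => decide (i = 0)) ≃r S.orientedDual.Adj)) := by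
  rcases three_crossing_or_four_touching h with h3 | ⟨hcard, ht⟩
  · exact Or.inl ⟨h3, orientedDual_of_threeCrossing h h3⟩
  rcases dist_centers_of_touch h ht with hd | ⟨O, hO, hin, hd⟩
  · exact Or.inr (Or.inl ⟨⟨hcard, fun C hC D hD hCD =>
      ⟨ht C hC D hD hCD, disjoint_inside (hd C hC D hD hCD)⟩⟩, orientedDual_of_external hcard hd⟩)
  · exact Or.inr (Or.inr ⟨⟨hcard, ht, O, hO, fun C hC hCO => inside_subset_inside (hin C hC hCO),
      fun C hC D hD hCO hDO hCD => disjoint_inside (hd C hC D hD hCO hDO hCD)⟩,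
      orientedDual_of_internal hcard hO hin hd⟩)

end CircleSystem

/-! ### Sinks distinguish the three oriented duals -/

/-- The number of vertices without outgoing edges of a digraph. -/
noncomputable def sinkCount {α : Type*} (r : α → α → Prop) : ℕ :=
  Nat.card {a // ∀ b, ¬ r a b}

theorem sinkCount_congr {α β : Type*} {r : α → α → Prop} {s : β → β → Prop} (φ : r ≃r s) :
    sinkCount r = sinkCount s :=
  Nat.card_congr (φ.toEquiv.subtypeEquiv fun a => by
    rw [φ.surjective.forall]
    simp [φ.map_rel_iff])

theorem Fan.sinkCount_dualAdj {ι F : Type} [Fintype F] [DecidableEq F] (K : Fan ι F)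
    (flip : ι → Bool) : sinkCount (K.DualAdj flip) =
      (Finset.univ.filter fun f => ∀ e, K.inner flip e ≠ f).card := by
  classical
  rw [sinkCount, ← Fintype.card_subtype, ← Nat.card_eq_fintype_card]
  refine Nat.card_congr (Equiv.subtypeEquivRight fun f => ?_)
  simp only [DualAdj, not_exists, not_and]
  exact ⟨fun h e he => h _ e he rfl, fun h b e he => absurd he (h e)⟩

/-- The only sink is the orthant where all three powers are positive, the exterior of all circles.
-/
theorem sinkCount_crossingFan : sinkCount (crossingFan.DualAdj fun _ => false) = 1 := by
  rw [Fan.sinkCount_dualAdj]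
  change (Finset.univ.filter fun f : Fin 3 → Fin 2 => ∀ e : EdgeIndex, edgeSigns e 1 ≠ f).card = 1
  decide

/-- The sinks are the four gaps. -/
theorem sinkCount_tangentFan_external : sinkCount (tangentFan.DualAdj fun _ => false) = 4 := by
  rw [Fan.sinkCount_dualAdj]
  change (Finset.univ.filter fun f : Fin 4 ⊕ Fin 4 => ∀ e : EdgeIndex,
    Sum.inl (capIndex e) ≠ f).card = 4
  decide

/-- The sinks are the exterior of the surrounding circle and the gap bounded by the three inner
circles; the other gaps have edges into that exterior. -/
theorem sinkCount_tangentFan_internal :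
    sinkCount (tangentFan.DualAdj fun i => decide (i = 0)) = 2 := by
  rw [Fan.sinkCount_dualAdj]
  change (Finset.univ.filter fun f : Fin 4 ⊕ Fin 4 => ∀ e : EdgeIndex,
    (if decide (capIndex e = 0) = true then Sum.inr (gapIndex e) else Sum.inl (capIndex e))
      ≠ f).card = 2
  decide

namespace CircleSystem

variable {S S' : CircleSystem}

theorem not_isThreeCrossing_of_card (h : S.circles.card = 4) : ¬ S.IsThreeCrossing := fun h' => by
  have := h'.1
  omega

theorem inside_nonempty {C : EuclideanGeometry.Sphere Plane} (hC : 0 < C.radius) :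
    (inside C).Nonempty := Metric.nonempty_ball.2 hC

theorem not_isThreeTouchingInOne (h : S.IsFourTouchingDisjoint) : ¬ S.IsThreeTouchingInOne := by
  rintro ⟨hcard, -, O, hO, hin, -⟩
  obtain ⟨C, hC, hCO⟩ := Finset.exists_mem_ne (by omega : 1 < S.circles.card) O
  obtain ⟨x, hx⟩ := inside_nonempty (S.radius_pos C hC)
  exact Set.disjoint_left.1 (h.2 C hC O hO hCO).2 hx (hin C hC hCO hx)

/-- The number of sinks of the oriented dual tells which configuration a realization shows. -/
theorem sinkCount_orientedDual (h : S.Realizes octahedronGraph) :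
    (S.IsThreeCrossing ↔ sinkCount S.orientedDual.Adj = 1) ∧
    (S.IsFourTouchingDisjoint ↔ sinkCount S.orientedDual.Adj = 4) ∧
    (S.IsThreeTouchingInOne ↔ sinkCount S.orientedDual.Adj = 2) := by
  rcases classification h with ⟨h1, ⟨φ⟩⟩ | ⟨h1, ⟨φ⟩⟩ | ⟨h1, ⟨φ⟩⟩
  · have h2 : ¬ S.IsFourTouchingDisjoint := fun h' => not_isThreeCrossing_of_card h'.1 h1
    have h3 : ¬ S.IsThreeTouchingInOne := fun h' => not_isThreeCrossing_of_card h'.1 h1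
    simp [← sinkCount_congr φ, sinkCount_crossingFan, h1, h2, h3]
  · have h2 := not_isThreeCrossing_of_card h1.1
    have h3 := not_isThreeTouchingInOne h1
    simp [← sinkCount_congr φ, sinkCount_tangentFan_external, h1, h2, h3]
  · have h2 := not_isThreeCrossing_of_card h1.1
    have h3 : ¬ S.IsFourTouchingDisjoint := fun h' => not_isThreeTouchingInOne h' h1
    simp [← sinkCount_congr φ, sinkCount_tangentFan_internal, h1, h2, h3]

/-- Each oriented dual is isomorphic to one of three models, whose numbers of sinks differ. -/
theorem nonempty_orientedDual_iso_iff (h : S.Realizes octahedronGraph)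
    (h' : S'.Realizes octahedronGraph) :
    Nonempty (S.orientedDual.Adj ≃r S'.orientedDual.Adj) ↔
      sinkCount S.orientedDual.Adj = sinkCount S'.orientedDual.Adj := by
  refine ⟨fun ⟨φ⟩ => sinkCount_congr φ, fun heq => ?_⟩
  rcases classification h with ⟨-, ⟨φ⟩⟩ | ⟨-, ⟨φ⟩⟩ | ⟨-, ⟨φ⟩⟩ <;>
  rcases classification h' with ⟨-, ⟨ψ⟩⟩ | ⟨-, ⟨ψ⟩⟩ | ⟨-, ⟨ψ⟩⟩ <;>
  first
  | exact ⟨φ.symm.trans ψ⟩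
  | simp [← sinkCount_congr φ, ← sinkCount_congr ψ, sinkCount_crossingFan,
      sinkCount_tangentFan_external, sinkCount_tangentFan_internal] at heq

/-! ### Examples of the three configurations -/

/-- The system of the circles of a finite family. -/
noncomputable def ofFamily {n : ℕ} (C : Fin n → EuclideanGeometry.Sphere Plane)
    (hC : ∀ i, 0 < (C i).radius) : CircleSystem := by
  classical
  exact
    { circles := Finset.univ.image C
      radius_pos := by
        intro D hD
        obtain ⟨i, -, rfl⟩ := Finset.mem_image.1 hD
        exact hC i }

theorem mem_ofFamily {n : ℕ} {C : Fin n → EuclideanGeometry.Sphere Plane}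
    (hC : ∀ i, 0 < (C i).radius) (D : EuclideanGeometry.Sphere Plane) :
    D ∈ (ofFamily C hC).circles ↔ ∃ i, C i = D := by
  simp [ofFamily]

theorem exists_isThreeCrossing :
    ∃ S : CircleSystem, S.Realizes octahedronGraph ∧ S.IsThreeCrossing := by
  -- The centers are not collinear, and the radii give the origin the power `-1` with respect to
  -- each circle.
  let c : Fin 3 → Plane := ![!₂[0, 0], !₂[1, 0], !₂[0, 1]]
  let C : Fin 3 → EuclideanGeometry.Sphere Plane := fun i =>
    ⟨c i, √(1 + ‖(0 : Plane) - c i‖ ^ 2)⟩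
  have hr : ∀ i, 0 < (C i).radius := fun i => by
    change 0 < √(1 + ‖(0 : Plane) - c i‖ ^ 2)
    positivity
  have hc : Function.Injective c := by
    intro i j hij
    have h0 := congrArg (fun x : Plane => x 0) hij
    have h1 := congrArg (fun x : Plane => x 1) hij
    fin_cases i <;> fin_cases j <;> simp [c] at h0 h1 ⊢
  have hinj : Function.Injective C := fun i j hij =>
    hc (congrArg EuclideanGeometry.Sphere.center hij)
  have H := crossingFan_represents (q := 0) (κ := 1) hinj (mem_ofFamily hr) one_pos
    (fun i => by
      change ‖(0 : Plane) - c i‖ ^ 2 - √(1 + ‖(0 : Plane) - c i‖ ^ 2) ^ 2 = -1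
      rw [Real.sq_sqrt (by positivity)]
      ring)
    (fun v hv => by
      have h1 : ⟪v, (c 0 - 0) - (c 1 - 0)⟫ = 0 := hv 0 1
      have h2 : ⟪v, (c 0 - 0) - (c 2 - 0)⟫ = 0 := hv 0 2
      simp [c, PiLp.inner_apply, Fin.sum_univ_two] at h1 h2
      exact plane_ext h1 h2)
  refine ⟨ofFamily C hr, H.realizes, (sinkCount_orientedDual H.realizes).1.2 ?_⟩
  obtain ⟨φ⟩ := H.nonempty_orientedDual_iso
  rw [← sinkCount_congr φ, sinkCount_crossingFan]

/-- Signed radii and centers that satisfy the tangency conditions belong to a realization of the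
octahedron graph. -/
theorem exists_realizes_of_signed_radii (c : Fin 4 → Plane) (R : Fin 4 → ℝ) (hR : ∀ i, R i ≠ 0)
    (hc : ∀ i j, i ≠ j → ‖c i - c j‖ ^ 2 = (R i + R j) ^ 2)
    (hne : ∀ i j, i ≠ j → R i + R j ≠ 0) (hpos : 0 < ∑ i, (R i)⁻¹) {flip : Fin 4 → Bool}
    (hflip : ∀ i, flip i = true ↔ R i < 0) :
    ∃ S : CircleSystem, S.Realizes octahedronGraph ∧
      sinkCount S.orientedDual.Adj = sinkCount (tangentFan.DualAdj flip) := by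
  let C : Fin 4 → EuclideanGeometry.Sphere Plane := fun i => ⟨c i, |R i|⟩
  have hinj : Function.Injective C := by
    intro i j hij
    by_contra h
    have h1 : c i = c j := congrArg EuclideanGeometry.Sphere.center hij
    have h2 := hc i j h
    rw [h1, sub_self, norm_zero] at h2
    exact hne i j h (pow_eq_zero_iff two_ne_zero |>.1 (by linarith))
  have H := tangentFan_represents hinj (mem_ofFamily fun i => abs_pos.2 (hR i)) hR
    (fun i => rfl) hc hpos hflip
  obtain ⟨φ⟩ := H.nonempty_orientedDual_iso
  exact ⟨_, H.realizes, (sinkCount_congr φ).symm⟩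

theorem exists_isFourTouchingDisjoint :
    ∃ S : CircleSystem, S.Realizes octahedronGraph ∧ S.IsFourTouchingDisjoint := by
  -- The curvatures 15, 2, 2, 3: the first circle is the small one in the gap between the other
  -- three.
  obtain ⟨S, hS, h⟩ := exists_realizes_of_signed_radii
    ![!₂[0, 4 / 15], !₂[1 / 2, 0], !₂[-1 / 2, 0], !₂[0, 2 / 3]] ![1 / 15, 1 / 2, 1 / 2, 1 / 3]
    (flip := fun _ => false)
    (fun i => by fin_cases i <;> norm_num)
    (fun i j hij => by
      rw [norm_sub_sq_plane]
      fin_cases i <;> fin_cases j <;> first | exact absurd rfl hij | norm_num)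
    (fun i j _ => by fin_cases i <;> fin_cases j <;> norm_num)
    (by simp only [Fin.sum_univ_four, Matrix.cons_val]; norm_num)
    (fun i => by fin_cases i <;> norm_num)
  exact ⟨S, hS, (sinkCount_orientedDual hS).2.1.2 (h.trans sinkCount_tangentFan_external)⟩

theorem exists_isThreeTouchingInOne :
    ∃ S : CircleSystem, S.Realizes octahedronGraph ∧ S.IsThreeTouchingInOne := by
  -- The curvatures -1, 2, 2, 3: the same three circles inside the unit circle.
  obtain ⟨S, hS, h⟩ := exists_realizes_of_signed_radii
    ![!₂[0, 0], !₂[1 / 2, 0], !₂[-1 / 2, 0], !₂[0, 2 / 3]] ![-1, 1 / 2, 1 / 2, 1 / 3]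
    (flip := fun i => decide (i = 0))
    (fun i => by fin_cases i <;> norm_num)
    (fun i j hij => by
      rw [norm_sub_sq_plane]
      fin_cases i <;> fin_cases j <;> first | exact absurd rfl hij | norm_num)
    (fun i j hij => by fin_cases i <;> fin_cases j <;> first | exact absurd rfl hij | norm_num)
    (by simp only [Fin.sum_univ_four, Matrix.cons_val]; norm_num)
    (fun i => by fin_cases i <;> norm_num)
  exact ⟨S, hS, (sinkCount_orientedDual hS).2.2.2 (h.trans sinkCount_tangentFan_internal)⟩

end CircleSystem

/-! ### The classification up to equivalence -/

theorem lemma4 :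
    -- there are exactly three equivalence classes of realizations
    Nat.card (Quotient (CircleRealization.setoid octahedronGraph)) = 3 ∧
    -- each of the three configurations occurs as a realization
    (∃ R : CircleRealization octahedronGraph, R.1.IsThreeCrossing) ∧
    (∃ R : CircleRealization octahedronGraph, R.1.IsFourTouchingDisjoint) ∧
    (∃ R : CircleRealization octahedronGraph, R.1.IsThreeTouchingInOne) ∧
    -- every realization is one of them
    (∀ R : CircleRealization octahedronGraph,
      R.1.IsThreeCrossing ∨ R.1.IsFourTouchingDisjoint ∨ R.1.IsThreeTouchingInOne) ∧
    -- realizations are equivalent exactly if they show the same configuration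
    (∀ R R' : CircleRealization octahedronGraph, R.Equivalent R' ↔
      (R.1.IsThreeCrossing ∧ R'.1.IsThreeCrossing) ∨
      (R.1.IsFourTouchingDisjoint ∧ R'.1.IsFourTouchingDisjoint) ∨
      (R.1.IsThreeTouchingInOne ∧ R'.1.IsThreeTouchingInOne)) := by
  obtain ⟨S₁, hS₁, h₁⟩ := CircleSystem.exists_isThreeCrossing
  obtain ⟨S₂, hS₂, h₂⟩ := CircleSystem.exists_isFourTouchingDisjoint
  obtain ⟨S₃, hS₃, h₃⟩ := CircleSystem.exists_isThreeTouchingInOne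
  have hall : ∀ R : CircleRealization octahedronGraph,
      R.1.IsThreeCrossing ∨ R.1.IsFourTouchingDisjoint ∨ R.1.IsThreeTouchingInOne := fun R => by
    rcases CircleSystem.classification R.2 with h | h | h
    · exact Or.inl h.1
    · exact Or.inr (Or.inl h.1)
    · exact Or.inr (Or.inr h.1)
  have hequiv : ∀ R R' : CircleRealization octahedronGraph, R.Equivalent R' ↔
      (R.1.IsThreeCrossing ∧ R'.1.IsThreeCrossing) ∨
      (R.1.IsFourTouchingDisjoint ∧ R'.1.IsFourTouchingDisjoint) ∨
      (R.1.IsThreeTouchingInOne ∧ R'.1.IsThreeTouchingInOne) := by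
    intro R R'
    have e := CircleSystem.nonempty_orientedDual_iso_iff R.2 R'.2
    have hR := hall R
    obtain ⟨a, b, c⟩ := CircleSystem.sinkCount_orientedDual R.2
    obtain ⟨a', b', c'⟩ := CircleSystem.sinkCount_orientedDual R'.2
    -- Equivalence and configurations are now all expressed by the two numbers of sinks, each of
    -- which is 1, 4 or 2.
    rw [CircleRealization.Equivalent, e, a, b, c, a', b', c']
    rw [a, b, c] at hR
    omega
  refine ⟨?_, ⟨⟨S₁, hS₁⟩, h₁⟩, ⟨⟨S₂, hS₂⟩, h₂⟩, ⟨⟨S₃, hS₃⟩, h₃⟩, hall, hequiv⟩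
  let rep : Fin 3 → CircleRealization octahedronGraph := ![⟨S₁, hS₁⟩, ⟨S₂, hS₂⟩, ⟨S₃, hS₃⟩]
  have hbij : Function.Bijective fun i =>
      Quotient.mk (CircleRealization.setoid octahedronGraph) (rep i) := by
    constructor
    · intro i j hij
      have hs := (CircleSystem.nonempty_orientedDual_iso_iff (rep i).2 (rep j).2).1
        (Quotient.exact hij)
      have c₁ := (CircleSystem.sinkCount_orientedDual hS₁).1.1 h₁
      have c₂ := (CircleSystem.sinkCount_orientedDual hS₂).2.1.1 h₂
      have c₃ := (CircleSystem.sinkCount_orientedDual hS₃).2.2.1 h₃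
      fin_cases i <;> fin_cases j <;> first
        | rfl
        | (simp only [rep] at hs
           simp [c₁, c₂, c₃] at hs)
    · intro x
      induction x using Quotient.inductionOn with
      | h R =>
        rcases hall R with h | h | h
        · exact ⟨0, Quotient.sound ((hequiv _ _).2 (Or.inl ⟨h₁, h⟩))⟩
        · exact ⟨1, Quotient.sound ((hequiv _ _).2 (Or.inr (Or.inl ⟨h₂, h⟩)))⟩
        · exact ⟨2, Quotient.sound ((hequiv _ _).2 (Or.inr (Or.inr ⟨h₃, h⟩)))⟩
  rw [← Nat.card_congr (Equiv.ofBijective _ hbij), Nat.card_fin]
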